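/- Let $(\xi,\lambda)$ be a random vector with $\xi\in\mathbb{N}=\{1,2,\dots\}$ and $\lambda\in(0,1)$ almost surely ($\xi$ and $\lambda$ may be dependent), and put $\rho=(1-\lambda)/\lambda$. Let $((\xi_k,\lambda_k))_{k\in\mathbb{Z}}$ be independent copies of $(\xi,\lambda)$. Put $S_n=\sum_{k=1}^n\xi_k$ for $n>0$, $S_0=0$ and $S_n=-\sum_{k=n+1}^0\xi_k$ for $n<0$, and define the sparse random environment $\omega=(\omega_n)_{n\in\mathbb{Z}}$ by $\omega_n=\lambda_{k+1}$ if $n=S_k$ for some $k\in\mathbb{Z}$, and $\omega_n=\tfrac12$ otherwise. Given the environment, let $X=(X_n)_{n\ge 0}$ be the Markov chain on $\mathbb{Z}$ with $X_0=0$ that jumps from $i$ to $i+1$ with probability $\omega_i$ and from $i$ to $i-1$ with probability $1-\omega_i$. Let $\mathbb{P}$ be the annealed law (the joint law of the sequence $((\xi_k,\lambda_k))_{k\in\mathbb{Z}}$ and of $X$), $\mathbb{E}$ the corresponding expectation, and $T_n=\inf\{k\ge0: X_k=n\}$. Assume that $\mathbb{E}\log\rho$ exists and $\mathbb{E}\log\rho\in[-\infty,0)$,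 and that $\mathbb{E}\xi<\infty$. Put $v:=\mathbb{E}\xi/\mathbb{E}T_{S_1}$ (with $v=0$ if $\mathbb{E}T_{S_1}=\infty$). Then $v<\infty$ and, $\mathbb{P}$-almost surely, $$\lim_{n\to\infty}\frac{X_n}{n}=v\qquad\text{and}\qquad\lim_{n\to\infty}\frac{T_n}{n}=\frac1v ,$$ where $1/0=\infty$. Moreover, if $\mathbb{E}\rho<1$, $\mathbb{E}\rho\xi<\infty$ and $\mathbb{E}\xi^2<\infty$, then $v>0$ and $$v=\frac{(1-\mathbb{E}\rho)\,\mathbb{E}\xi}{(1-\mathbb{E}\rho)\,\mathbb{E}\xi^2+2\,\mathbb{E}\xi\,\mathbb{E}\rho\xi},\qquad \frac1v=\frac1{\mathbb{E}\xi}\left(\mathbb{E}\xi^2+\frac{2\,\mathbb{E}\xi\,\mathbb{E}\rho\xi}{1-\mathbb{E}\rho}\right),$$ and otherwise $v=0$ (that is, $1/v=\infty$). -/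

import Mathlib

open MeasureTheory ProbabilityTheory Filter Topology
open scoped ENNReal

namespace SparseRWRE

/-- Environments: elements of `(0,1)^ℤ`, with the product (Borel) sigma-algebra. -/
abbrev Env := ℤ → Set.Ioo (0 : ℝ) 1

/-- Trajectories `X_0, X_1, …` in `ℤ`, with the sigma-algebra generated by the cylinder sets. -/
abbrev Path := ℕ → ℤ

/-- Positive integers carry the discrete sigma-algebra. -/
instance : MeasurableSpace ℕ+ := ⊤

instance : DiscreteMeasurableSpace ℕ+ := ⟨fun _ => trivial⟩

/-- Two-sided sequences of pairs `(ξ_k, λ_k)`, `k ∈ ℤ`. -/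
abbrev Marks := ℤ → ℕ+ × Set.Ioo (0 : ℝ) 1

/-! ### The quenched walk -/

/-- One step of the walk in the environment `ω` from the site `i`: to `i + 1` with probability
`ω i` and to `i - 1` with probability `1 - ω i`. -/
noncomputable def step (ω : Env) (i : ℤ) : Measure ℤ :=
  ENNReal.ofReal (ω i : ℝ) • Measure.dirac (i + 1) +
    ENNReal.ofReal (1 - (ω i : ℝ)) • Measure.dirac (i - 1)

instance (ω : Env) (i : ℤ) : IsProbabilityMeasure (step ω i) := by
  refine ⟨?_⟩
  have h := (ω i).2
  simp only [step, Measure.coe_add, Measure.coe_smul, Pi.add_apply, Pi.smul_apply, measure_univ,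
    smul_eq_mul, mul_one]
  rw [← ENNReal.ofReal_add h.1.le (by linarith [h.2])]
  simp

/-- The transition kernel at time `n`: the next position depends on the past only through the
current position. -/
noncomputable def stepKernel (ω : Env) (n : ℕ) :
    Kernel (Π _ : Finset.Iic n, ℤ) ℤ where
  toFun x := step ω (x ⟨n, Finset.mem_Iic.2 le_rfl⟩)
  measurable' := Measurable.of_discrete

instance (ω : Env) (n : ℕ) : IsMarkovKernel (stepKernel ω n) :=
  ⟨fun x => inferInstanceAs (IsProbabilityMeasure (step ω (x ⟨n, Finset.mem_Iic.2 le_rfl⟩)))⟩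

/-- The quenched law of the walk in the environment `ω`: the law on trajectories of the Markov
chain that starts at `0` and moves according to `step ω`. -/
noncomputable def quenched (ω : Env) : Measure Path :=
  Kernel.traj (X := fun _ => ℤ) (stepKernel ω) 0 (fun _ => 0)

instance (ω : Env) : IsProbabilityMeasure (quenched ω) := by
  unfold quenched; infer_instance

theorem measurable_step_apply (i : ℤ) (D : Set ℤ) : Measurable fun ω : Env => step ω i D := by
  have h : Measurable fun ω : Env => ((ω i : Set.Ioo (0 : ℝ) 1) : ℝ) :=
    measurable_subtype_coe.comp (measurable_pi_apply i)
  simp only [step, Measure.coe_add, Measure.coe_smul, Pi.add_apply, Pi.smul_apply, smul_eq_mul]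
  exact (h.ennreal_ofReal.mul_const _).add ((measurable_const.sub h).ennreal_ofReal.mul_const _)

theorem measurable_partialTraj_apply (n : ℕ) (B : Set (Π _ : Finset.Iic n, ℤ)) :
    Measurable fun ω : Env =>
      Kernel.partialTraj (X := fun _ => ℤ) (stepKernel ω) 0 n (fun _ => 0) B := by
  induction n with
  | zero => simp only [Kernel.partialTraj_zero]; exact measurable_const
  | succ n ih =>
    have key : ∀ ω : Env,
        Kernel.partialTraj (X := fun _ => ℤ) (stepKernel ω) 0 (n + 1) (fun _ => 0) B =
          ∑' y : (Π _ : Finset.Iic n, ℤ),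
            step ω (y ⟨n, Finset.mem_Iic.2 le_rfl⟩)
              {z | IicProdIoc (X := fun _ => ℤ) n (n + 1)
                (y, MeasurableEquiv.piSingleton (X := fun _ => ℤ) n z) ∈ B} *
            Kernel.partialTraj (X := fun _ => ℤ) (stepKernel ω) 0 n (fun _ => 0) {y} := by
      intro ω
      have hm : MeasurableSet B := MeasurableSet.of_discrete
      have hB : MeasurableSet (IicProdIoc (X := fun _ => ℤ) n (n + 1) ⁻¹' B) :=
        measurable_IicProdIoc hm
      rw [Kernel.partialTraj_succ_of_le (Nat.zero_le n),
        Kernel.map_apply' _ (by fun_prop) _ hm, Kernel.comp_apply' _ _ _ hB,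
        lintegral_countable']
      refine tsum_congr fun y => ?_
      congr 1
      rw [Kernel.prod_apply, Kernel.id_apply, Measure.dirac_prod,
        Measure.map_apply (by fun_prop) hB,
        Kernel.map_apply' _ (by fun_prop) _ MeasurableSet.of_discrete]
      rfl
    simp only [key]
    exact Measurable.tsum fun y => (measurable_step_apply _ _).mul (ih _)

theorem measurable_quenched : Measurable quenched := by
  refine Measurable.measure_of_isPiSystem_of_isProbabilityMeasure
    generateFrom_measurableCylinders.symm isPiSystem_measurableCylinders fun s hs => ?_
  obtain ⟨I, t, ht, rfl⟩ := (mem_measurableCylinders _).1 hs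
  have hI : I ⊆ Finset.Iic (I.sup id) := fun i hi => Finset.mem_Iic.2 (Finset.le_sup (f := id) hi)
  have h : ∀ ω : Env, quenched ω (cylinder I t) =
      Kernel.partialTraj (X := fun _ => ℤ) (stepKernel ω) 0 (I.sup id) (fun _ => 0)
        (Finset.restrict₂ (π := fun _ => ℤ) hI ⁻¹' t) := by
    intro ω
    rw [← Kernel.traj_map_frestrictLe, Kernel.map_apply' _ (by fun_prop) _ MeasurableSet.of_discrete]
    rfl
  simp only [h]
  exact measurable_partialTraj_apply _ _

/-- The quenched laws as a probability kernel from environments to trajectories. -/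
noncomputable def quenchedKernel : Kernel Env Path := ⟨quenched, measurable_quenched⟩

instance : IsMarkovKernel quenchedKernel :=
  ⟨fun ω => inferInstanceAs (IsProbabilityMeasure (quenched ω))⟩

/-! ### The sparse environment -/

/-- The marked sites: `S_n = ξ_1 + ⋯ + ξ_n` for `n ≥ 0` (so `S_0 = 0`) and
`S_n = -(ξ_{n+1} + ⋯ + ξ_0)` for `n < 0`. -/
noncomputable def S (m : Marks) (n : ℤ) : ℤ :=
  if 0 ≤ n then ∑ k ∈ Finset.Icc 1 n, ((m k).1 : ℤ)
  else -∑ k ∈ Finset.Icc (n + 1) 0, ((m k).1 : ℤ)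

/-- The value `1/2` as an element of `(0,1)`. -/
noncomputable def half : Set.Ioo (0 : ℝ) 1 := ⟨1 / 2, by norm_num, by norm_num⟩

open Classical in
/-- The sparse environment: `ω_n = λ_{k+1}` if `n = S_k` for some (necessarily unique) `k ∈ ℤ`,
and `ω_n = 1/2` otherwise. -/
noncomputable def sparseEnv (m : Marks) : Env := fun n =>
  if h : ∃ k : ℤ, S m k = n then (m (h.choose + 1)).2 else half

theorem S_succ (m : Marks) (n : ℤ) : S m (n + 1) = S m n + (m (n + 1)).1 := by
  rcases lt_trichotomy n (-1) with h | rfl | h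
  · have e : Finset.Icc (n + 1) 0 = insert (n + 1) (Finset.Icc (n + 1 + 1) 0) := by
      ext; simp only [Finset.mem_Icc, Finset.mem_insert]; omega
    rw [S, S, if_neg (by omega), if_neg (by omega), e, Finset.sum_insert (by simp)]
    ring
  · simp [S]
  · have e : Finset.Icc 1 (n + 1) = insert (n + 1) (Finset.Icc 1 n) := by
      ext; simp only [Finset.mem_Icc, Finset.mem_insert]; omega
    rw [S, S, if_pos (by omega), if_pos (by omega), e, Finset.sum_insert (by simp)]
    ring

theorem S_strictMono (m : Marks) : StrictMono (S m) := by
  refine strictMono_int_of_lt_succ fun n => ?_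
  rw [S_succ]
  have := (m (n + 1)).1.pos
  omega

theorem sparseEnv_S (m : Marks) (k : ℤ) : sparseEnv m (S m k) = (m (k + 1)).2 := by
  have h : ∃ j : ℤ, S m j = S m k := ⟨k, rfl⟩
  rw [sparseEnv, dif_pos h, (S_strictMono m).injective h.choose_spec]

theorem measurable_S (k : ℤ) : Measurable fun m : Marks => S m k := by
  have h : ∀ j : ℤ, Measurable fun m : Marks => ((m j).1 : ℤ) := fun j =>
    (Measurable.of_discrete (f := fun x : ℕ+ => (x : ℤ))).comp
      (measurable_fst.comp (measurable_pi_apply j))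
  unfold S
  split_ifs
  · exact Finset.measurable_fun_sum _ fun j _ => h j
  · exact (Finset.measurable_fun_sum _ fun j _ => h j).neg

theorem measurable_sparseEnv : Measurable sparseEnv := by
  refine measurable_pi_lambda _ fun n => fun A hA => ?_
  have e : (fun m : Marks => sparseEnv m n) ⁻¹' A =
      (⋃ k : ℤ, {m | S m k = n} ∩ {m | (m (k + 1)).2 ∈ A}) ∪
        ((⋂ k : ℤ, {m | S m k = n}ᶜ) ∩ {_m | half ∈ A}) := by
    ext m
    simp only [Set.mem_preimage, Set.mem_union, Set.mem_iUnion, Set.mem_inter_iff,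
      Set.mem_ofPred_eq, Set.mem_iInter, Set.mem_compl_iff]
    by_cases h : ∃ k : ℤ, S m k = n
    · obtain ⟨k, rfl⟩ := h
      rw [sparseEnv_S]
      constructor
      · exact fun hk => Or.inl ⟨k, rfl, hk⟩
      · rintro (⟨j, hj, hA'⟩ | ⟨h, -⟩)
        · rwa [(S_strictMono m).injective hj] at hA'
        · exact absurd rfl (h k)
    · rw [sparseEnv, dif_neg h]
      push Not at h
      simp [h]
  have hS : ∀ k : ℤ, MeasurableSet {m : Marks | S m k = n} := fun k =>
    measurable_S k (measurableSet_singleton n)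
  rw [e]
  refine (MeasurableSet.iUnion fun k => (hS k).inter ?_).union
    ((MeasurableSet.iInter fun k => (hS k).compl).inter (MeasurableSet.const _))
  exact (measurable_snd.comp (measurable_pi_apply (k + 1))) hA

/-! ### The annealed law, passage times and speed -/

/-- The annealed law, on pairs (sequence `((ξ_k, λ_k))_k`, trajectory): the pairs `(ξ_k, λ_k)`,
`k ∈ ℤ`, are independent with law `ν`, and given them the trajectory has the quenched law in the
sparse environment that they determine. -/
noncomputable def annealed (ν : Measure (ℕ+ × Set.Ioo (0 : ℝ) 1)) : Measure (Marks × Path) :=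
  Measure.infinitePi (fun _ : ℤ => ν) ⊗ₘ quenchedKernel.comap sparseEnv measurable_sparseEnv

/-- The first passage time `T_n = inf {k ≥ 0 : X_k = n}`, with `inf ∅ = ∞`. -/
noncomputable def T (x : Path) (n : ℤ) : ℝ≥0∞ := ⨅ (k : ℕ) (_ : x k = n), (k : ℝ≥0∞)

/-- The number `v = E ξ / E T_{S_1}`, with the expectation of `T_{S_1}` under the annealed law. -/
noncomputable def speed (ν : Measure (ℕ+ × Set.Ioo (0 : ℝ) 1)) : ℝ≥0∞ :=
  (∫⁻ p, ((p.1 : ℕ) : ℝ≥0∞) ∂ν) / ∫⁻ q, T q.2 (S q.1 1) ∂(annealed ν)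

end SparseRWRE

namespace SparseRWRE

/-! ### Laws of sequences in a countable space -/

/-! The marked sites are renewal points for the passage times. Seen from `S_1` at the time when the
walk first reaches it, the pair (marks, trajectory) has its original annealed law: the marks are
shifted by one index, and the strong Markov property restarts the walk. Hence `passShift` preserves
`annealed ν` (`measurePreserving_passShift`), and since a nearest-neighbour path cannot skip a site,
`T_{S_k}` is the Birkhoff sum of `passTime` along `passShift` (`T_S_eq_sum`).

The law of large numbers for these sums is proved without ergodicity. The truncated duration `min
(passTime q) K` depends on at most `K` steps, so its quenched law depends only on the marks with
`|k| ≤ K + 1`. Two truncated durations more than `2K + 2` blocks apart are therefore independent,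
and the strong law for pairwise independent variables applies along residue classes
(`ae_tendsto_truncSum`). Letting `K` grow bounds the averages from below, also when the mean is
infinite; when the mean is finite, the maximal ergodic inequality makes the remainder negligible
(`ae_eventually_sum_le`).

The mean is computed from the quenched crossing times `u_i = E_i T_{i+1}`, for which a first step
analysis suggests `u_i = 1 + ρ_i + ρ_i u_{i-1}`. Along a block only its first site has a ratio
different from `1`, so with `c_k = 1 + u_{S_k - 1}` one gets `c_k = 2 ξ_k + ρ_k c_{k-1}`, and `c_0`
is `backSeries`. The recursion alone does not exclude infinite values; the upper bounds are
therefore proved for truncated times, which are finite, and the lower bounds for the full ones. The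
series converges almost surely because the products of the `ρ_k` decay exponentially while `ξ_k`
grows at most linearly. Summing over the first block gives `ξ_1 ^ 2 + ξ_1 ρ_1 c_0`. Taking
expectations, only `ξ_1` and `ρ_1` share an index, and the rest is a geometric series in `E ρ`
(`lintegral_passTime`). This formula holds in `ℝ≥0∞` with no moment condition on `ρ`, so it also
identifies when the mean is infinite.

Finally `T_{S_k} / k` and `S_k / k` give `T_n / n` by monotone interpolation, and inverting `T`
gives `X_n / n`. If `v > 0`, unit steps keep the walk close to its running maximum. If `v = 0`, the
lower bound comes instead from the walk being bounded below (`ae_bddBelow`), which is a resistance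
estimate. -/

theorem setOf_initial_eq {α : Type*} (n : ℕ) (p : ℕ → α) :
    {x : ℕ → α | ∀ i ≤ n, x i = p i} =
      Preorder.frestrictLe (π := fun _ => α) n ⁻¹'
        {Preorder.frestrictLe (π := fun _ => α) n p} := by
  ext x
  simp only [Set.mem_ofPred_eq, Set.mem_preimage, Set.mem_singleton_iff, funext_iff]
  exact ⟨fun h i => h i (Finset.mem_Iic.1 i.2), fun h i hi => h ⟨i, Finset.mem_Iic.2 hi⟩⟩

/-- Two finite laws of sequences in a countable space agree if all initial segments have the same
probabilities. -/
theorem measure_ext_of_initial {α : Type*} [Countable α] [MeasurableSpace α]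
    [DiscreteMeasurableSpace α] {μ ν : Measure (ℕ → α)} [IsFiniteMeasure μ]
    (h : ∀ (n : ℕ) (p : ℕ → α), μ {x | ∀ i ≤ n, x i = p i} = ν {x | ∀ i ≤ n, x i = p i}) :
    μ = ν := by
  have hm : ∀ n : ℕ, Measurable (Preorder.frestrictLe (π := fun _ => α) n) := fun n => by fun_prop
  have hmap : ∀ n : ℕ, μ.map (Preorder.frestrictLe (π := fun _ => α) n) =
      ν.map (Preorder.frestrictLe (π := fun _ => α) n) := by
    intro n
    refine Measure.ext_of_singleton fun y => ?_
    rw [Measure.map_apply (hm n) (measurableSet_singleton y),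
      Measure.map_apply (hm n) (measurableSet_singleton y)]
    rcases isEmpty_or_nonempty α with hα | ⟨⟨a⟩⟩
    · have := Set.eq_empty_of_isEmpty (Preorder.frestrictLe (π := fun _ => α) n ⁻¹' {y})
      simp [this]
    -- Any extension of `y` to a full sequence will do; the value `a` beyond `n` plays no role.
    have := h n (fun i => if hi : i ≤ n then y ⟨i, Finset.mem_Iic.2 hi⟩ else a)
    rw [setOf_initial_eq] at this
    have e : Preorder.frestrictLe (π := fun _ => α) n
        (fun i => if hi : i ≤ n then y ⟨i, Finset.mem_Iic.2 hi⟩ else a) = y := by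
      ext i
      simp [Finset.mem_Iic.1 i.2]
    rwa [e] at this
  have hcyl : ∀ s ∈ measurableCylinders (fun _ : ℕ => α), μ s = ν s := by
    intro s hs
    obtain ⟨I, t, ht, rfl⟩ := (mem_measurableCylinders _).1 hs
    have hI : I ⊆ Finset.Iic (I.sup id) :=
      fun i hi => Finset.mem_Iic.2 (Finset.le_sup (f := id) hi)
    have e : cylinder I t = Preorder.frestrictLe (π := fun _ => α) (I.sup id) ⁻¹'
        (Finset.restrict₂ (π := fun _ => α) hI ⁻¹' t) := rfl
    rw [e, ← Measure.map_apply (hm _) MeasurableSet.of_discrete, hmap,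
      Measure.map_apply (hm _) MeasurableSet.of_discrete]
  exact ext_of_generate_finite _ generateFrom_measurableCylinders.symm
    isPiSystem_measurableCylinders hcyl (hcyl _ (univ_mem_measurableCylinders _))

/-! ### The walk from an arbitrary starting point -/

/-- The quenched law of the walk in the environment `ω` that starts at `x`. -/
noncomputable def walk (ω : Env) (x : ℤ) : Measure Path :=
  Kernel.traj (X := fun _ => ℤ) (stepKernel ω) 0 (fun _ => x)

instance (ω : Env) (x : ℤ) : IsProbabilityMeasure (walk ω x) := by
  unfold walk; infer_instance

/-- The bridge from the Ionescu-Tulcea construction to an elementary Markov chain: through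
`measure_ext_of_initial`, identities between laws of walks reduce to finite products of one-step
probabilities. -/
theorem walk_initial (ω : Env) (x : ℤ) (n : ℕ) (p : Path) :
    walk ω x {y | ∀ i ≤ n, y i = p i} =
      if p 0 = x then ∏ i ∈ Finset.range n, step ω (p i) {p (i + 1)} else 0 := by
  have h0 : ∀ n, walk ω x {y | ∀ i ≤ n, y i = p i} =
      Kernel.partialTraj (X := fun _ => ℤ) (stepKernel ω) 0 n (fun _ => x)
        {Preorder.frestrictLe (π := fun _ => ℤ) n p} := by
    intro n
    rw [setOf_initial_eq, ← Kernel.traj_map_frestrictLe,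
      Kernel.map_apply' _ (by fun_prop) _ MeasurableSet.of_discrete]
    rfl
  rw [h0]
  induction n with
  | zero =>
    simp only [Kernel.partialTraj_zero, Kernel.deterministic_apply]
    rw [Measure.dirac_apply' _ MeasurableSet.of_discrete]
    have : ((fun _ => x : Π _ : Finset.Iic 0, ℤ) =
        Preorder.frestrictLe (π := fun _ => ℤ) 0 p) ↔ p 0 = x := by
      rw [funext_iff]
      constructor
      · intro h
        exact (h ⟨0, by simp⟩).symm
      · rintro rfl ⟨i, hi⟩
        have : i = 0 := by simpa using hi
        subst this; rfl
    simp only [Set.indicator, Set.mem_singleton_iff, Finset.range_zero, Finset.prod_empty,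
      Pi.one_apply]
    exact if_congr this rfl rfl
  | succ n ih =>
    have hm : MeasurableSet
        ({Preorder.frestrictLe (π := fun _ => ℤ) (n + 1) p} : Set (Π _ : Finset.Iic (n + 1), ℤ)) :=
      MeasurableSet.of_discrete
    have hB : MeasurableSet (IicProdIoc (X := fun _ => ℤ) n (n + 1) ⁻¹'
      ({Preorder.frestrictLe (π := fun _ => ℤ) (n + 1) p} : Set (Π _ : Finset.Iic (n + 1), ℤ))) :=
      measurable_IicProdIoc hm
    -- In the sum over all possible first `n` steps only the segment of `p` itself contributes.
    rw [Kernel.partialTraj_succ_of_le (Nat.zero_le n),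
      Kernel.map_apply' _ (by fun_prop) _ hm, Kernel.comp_apply' _ _ _ hB,
      lintegral_countable', tsum_eq_single (Preorder.frestrictLe (π := fun _ => ℤ) n p)]
    · rw [ih, Kernel.prod_apply, Kernel.id_apply, Measure.dirac_prod,
        Measure.map_apply (by fun_prop) hB,
        Kernel.map_apply' _ (by fun_prop) _ MeasurableSet.of_discrete, Finset.prod_range_succ]
      have : (MeasurableEquiv.piSingleton (X := fun _ => ℤ) n ⁻¹'
          (Prod.mk (Preorder.frestrictLe (π := fun _ => ℤ) n p) ⁻¹'
            (IicProdIoc (X := fun _ => ℤ) n (n + 1) ⁻¹'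
            ({Preorder.frestrictLe (π := fun _ => ℤ) (n + 1) p} :
                Set (Π _ : Finset.Iic (n + 1), ℤ))))) = {p (n + 1)} := by
        ext z
        simp only [Set.mem_preimage, Set.mem_singleton_iff, funext_iff, IicProdIoc]
        constructor
        · intro h
          have := h ⟨n + 1, by simp⟩
          simpa [MeasurableEquiv.piSingleton] using this
        · rintro rfl ⟨i, hi⟩
          by_cases hin : i ≤ n
          · simp [hin]
          · have : i = n + 1 := by have := Finset.mem_Iic.1 hi; omega
            subst this
            simp [MeasurableEquiv.piSingleton]
      rw [this]
      change step ω (p n) {p (n + 1)} * _ = _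
      split_ifs <;> simp [mul_comm]
    · intro y hy
      rw [Kernel.prod_apply, Kernel.id_apply, Measure.dirac_prod,
        Measure.map_apply (by fun_prop) hB]
      have : (Prod.mk y ⁻¹'
            (IicProdIoc (X := fun _ => ℤ) n (n + 1) ⁻¹'
            ({Preorder.frestrictLe (π := fun _ => ℤ) (n + 1) p} :
                Set (Π _ : Finset.Iic (n + 1), ℤ)))) = ∅ := by
        rw [Set.eq_empty_iff_forall_notMem]
        intro z hz
        apply hy
        ext ⟨i, hi⟩
        have hi' := Finset.mem_Iic.1 hi
        have := congrFun (Set.mem_singleton_iff.1 hz) ⟨i, Finset.mem_Iic.2 (by omega)⟩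
        simpa [IicProdIoc, hi'] using this
      rw [this, measure_empty, zero_mul]

/-! ### First step decomposition -/

/-- The trajectory that starts at `x` and goes on as `p`. -/
def pcons (x : ℤ) (p : Path) : Path
  | 0 => x
  | n + 1 => p n

@[simp] theorem pcons_zero (x : ℤ) (p : Path) : pcons x p 0 = x := rfl

@[simp] theorem pcons_succ (x : ℤ) (p : Path) (n : ℕ) : pcons x p (n + 1) = p n := rfl

theorem measurable_pcons (x : ℤ) : Measurable (pcons x) := by
  refine measurable_pi_lambda _ fun n => ?_
  cases n with
  | zero => exact measurable_const
  | succ n => exact measurable_pi_apply n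

theorem measurableSet_initial (n : ℕ) (p : Path) :
    MeasurableSet {y : Path | ∀ i ≤ n, y i = p i} := by
  rw [setOf_initial_eq]
  exact (by fun_prop : Measurable (Preorder.frestrictLe (π := fun _ => ℤ) n))
    (measurableSet_singleton _)

theorem step_singleton (ω : Env) (x y : ℤ) : step ω x {y} =
    ENNReal.ofReal (ω x) * (if y = x + 1 then 1 else 0) +
      ENNReal.ofReal (1 - ω x) * (if y = x - 1 then 1 else 0) := by
  simp [step, Set.indicator, eq_comm]

/-- Together with `walk_map_ptrans`, this is the only form in which the transition law is used
below: quenched statements follow from it by induction on time. -/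
theorem walk_eq_step (ω : Env) (x : ℤ) : walk ω x =
    ENNReal.ofReal (ω x) • (walk ω (x + 1)).map (pcons x) +
      ENNReal.ofReal (1 - ω x) • (walk ω (x - 1)).map (pcons x) := by
  refine measure_ext_of_initial fun n p => ?_
  have hone : ENNReal.ofReal (ω x) + ENNReal.ofReal (1 - ω x) = 1 := by
    rw [← ENNReal.ofReal_add (ω x).2.1.le (by linarith [(ω x).2.2])]
    simp
  cases n with
  | zero =>
    have h0 : ∀ z, (walk ω z).map (pcons x) {y | ∀ i ≤ 0, y i = p i} =
        if p 0 = x then 1 else 0 := by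
      intro z
      rw [Measure.map_apply (measurable_pcons x) (measurableSet_initial _ _)]
      have : pcons x ⁻¹' {y | ∀ i ≤ 0, y i = p i} = {_y | p 0 = x} := by
        ext y
        simp [eq_comm]
      rw [this]
      split_ifs with h <;> simp [h]
    rw [walk_initial]
    simp only [Measure.coe_add, Measure.coe_smul, Pi.add_apply, Pi.smul_apply, smul_eq_mul, h0,
      ← add_mul, hone]
    simp
  | succ n =>
    have key : ∀ z, (walk ω z).map (pcons x) {y | ∀ i ≤ n + 1, y i = p i} =
      if p 0 = x then (if p 1 = z then 1 else 0) *
        ∏ i ∈ Finset.range n, step ω (p (i + 1)) {p (i + 2)} else 0 := by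
      intro z
      rw [Measure.map_apply (measurable_pcons x) (measurableSet_initial _ _)]
      by_cases h0 : p 0 = x
      · have : pcons x ⁻¹' {y | ∀ i ≤ n + 1, y i = p i} = {y | ∀ i ≤ n, y i = p (i + 1)} := by
          ext y
          simp only [Set.mem_preimage, Set.mem_ofPred_eq]
          constructor
          · exact fun h i hi => h (i + 1) (by omega)
          · rintro h (_ | i) hi
            · exact h0.symm
            · exact h i (by omega)
        rw [this, walk_initial ω z n fun i => p (i + 1), if_pos h0]
        simp
      · have : pcons x ⁻¹' {y | ∀ i ≤ n + 1, y i = p i} = ∅ := by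
          rw [Set.eq_empty_iff_forall_notMem]
          exact fun y hy => h0 (hy 0 (by omega)).symm
        rw [this, measure_empty, if_neg h0]
    rw [walk_initial]
    simp only [Measure.coe_add, Measure.coe_smul, Pi.add_apply, Pi.smul_apply, smul_eq_mul, key]
    by_cases h0 : p 0 = x
    · simp only [h0, if_true]
      rw [Finset.prod_range_succ']
      simp only [zero_add, h0, step_singleton ω x]
      ring
    · simp [h0]

theorem ofReal_add_ofReal_one_sub (u : Set.Ioo (0 : ℝ) 1) :
    ENNReal.ofReal u + ENNReal.ofReal (1 - u) = 1 := by
  rw [← ENNReal.ofReal_add u.2.1.le (by linarith [u.2.2])]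
  simp

theorem walk_apply (ω : Env) (x : ℤ) {A : Set Path} (hA : MeasurableSet A) : walk ω x A =
    ENNReal.ofReal (ω x) * walk ω (x + 1) (pcons x ⁻¹' A) +
      ENNReal.ofReal (1 - ω x) * walk ω (x - 1) (pcons x ⁻¹' A) := by
  conv_lhs => rw [walk_eq_step]
  simp [Measure.map_apply (measurable_pcons x) hA]

theorem lintegral_walk (ω : Env) (x : ℤ) {f : Path → ℝ≥0∞} (hf : Measurable f) :
    ∫⁻ p, f p ∂(walk ω x) =
      ENNReal.ofReal (ω x) * ∫⁻ p, f (pcons x p) ∂(walk ω (x + 1)) +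
        ENNReal.ofReal (1 - ω x) * ∫⁻ p, f (pcons x p) ∂(walk ω (x - 1)) := by
  conv_lhs => rw [walk_eq_step]
  simp [lintegral_add_measure, lintegral_map hf (measurable_pcons x)]

theorem ae_walk_of_step {ω : Env} {x : ℤ} {Q : Path → Prop} (hQ : MeasurableSet {p | Q p})
    (h₁ : ∀ᵐ p ∂(walk ω (x + 1)), Q (pcons x p)) (h₂ : ∀ᵐ p ∂(walk ω (x - 1)), Q (pcons x p)) :
    ∀ᵐ p ∂(walk ω x), Q p := by
  have h := walk_apply ω x hQ.compl
  rw [ae_iff] at h₁ h₂ ⊢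
  have e : pcons x ⁻¹' {p | Q p}ᶜ = {p | ¬ Q (pcons x p)} := rfl
  rw [e, h₁, h₂, mul_zero, mul_zero, add_zero] at h
  exact h

theorem measurableSet_coord (n : ℕ) (y : ℤ) : MeasurableSet {p : Path | p n = y} :=
  measurable_pi_apply (X := fun _ : ℕ => ℤ) n (measurableSet_singleton y)

theorem ae_walk_start (ω : Env) (x : ℤ) : ∀ᵐ p ∂(walk ω x), p 0 = x :=
  ae_walk_of_step (measurableSet_coord 0 x)
    (ae_of_all _ fun _ => rfl) (ae_of_all _ fun _ => rfl)

theorem measurableSet_nearest (n : ℕ) :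
    MeasurableSet {p : Path | p (n + 1) = p n + 1 ∨ p (n + 1) = p n - 1} := by
  have h1 : Measurable fun p : Path => (p (n + 1), p n) :=
    (measurable_pi_apply _).prodMk (measurable_pi_apply _)
  exact h1 (MeasurableSet.of_discrete (s := {z : ℤ × ℤ | z.1 = z.2 + 1 ∨ z.1 = z.2 - 1}))

theorem ae_walk_nearest (ω : Env) (x : ℤ) :
    ∀ᵐ p ∂(walk ω x), ∀ n, p (n + 1) = p n + 1 ∨ p (n + 1) = p n - 1 := by
  rw [ae_all_iff]
  intro n
  induction n generalizing x with
  | zero =>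
    refine ae_walk_of_step (measurableSet_nearest 0) ?_ ?_
    · filter_upwards [ae_walk_start ω (x + 1)] with p hp
      exact Or.inl hp
    · filter_upwards [ae_walk_start ω (x - 1)] with p hp
      exact Or.inr hp
  | succ n ih => exact ae_walk_of_step (measurableSet_nearest _) (ih _) (ih _)

/-- Events that depend on the first `n` steps only feel the environment near the starting point. -/
theorem walk_congr {ω ω' : Env} {x : ℤ} {n : ℕ} (h : ∀ y, |y - x| ≤ n → ω y = ω' y)
    {A : Set Path} (hA : MeasurableSet A)
    (hn : ∀ p q : Path, (∀ i ≤ n, p i = q i) → (p ∈ A ↔ q ∈ A)) :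
    walk ω x A = walk ω' x A := by
  induction n generalizing x A with
  | zero =>
    have hc : ∀ ω, walk ω x A = walk ω x {_p | (fun _ => x) ∈ A} := by
      intro ω
      refine measure_congr ?_
      filter_upwards [ae_walk_start ω x] with p hp
      refine propext (hn _ _ fun i hi => ?_)
      rw [Nat.le_zero.1 hi, hp]
    rw [hc, hc]
    by_cases hx : (fun _ => x) ∈ A <;> simp [hx]
  | succ n ih =>
    have hx : ω x = ω' x := h x (by simp; positivity)
    have hA' : ∀ p q : Path, (∀ i ≤ n, p i = q i) → (p ∈ pcons x ⁻¹' A ↔ q ∈ pcons x ⁻¹' A) := by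
      refine fun p q hpq => hn _ _ fun i hi => ?_
      cases i with
      | zero => rfl
      | succ i => exact hpq i (by omega)
    have hm := measurable_pcons x hA
    rw [walk_apply ω x hA, walk_apply ω' x hA, hx, ih _ hm hA', ih _ hm hA']
    · intro y hy
      refine h y ?_
      rw [abs_le] at hy ⊢
      push_cast
      constructor <;> linarith
    · intro y hy
      refine h y ?_
      rw [abs_le] at hy ⊢
      push_cast
      constructor <;> linarith

/-- The trajectory `p` moved by `y`. -/
def ptrans (y : ℤ) (p : Path) : Path := fun n => p n + y

theorem measurable_ptrans (y : ℤ) : Measurable (ptrans y) :=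
  measurable_pi_lambda _ fun n =>
    (measurable_pi_apply (X := fun _ : ℕ => ℤ) n).add_const y

theorem walk_map_ptrans (ω : Env) (x y : ℤ) :
    (walk (fun z => ω (z + y)) x).map (ptrans y) = walk ω (x + y) := by
  refine measure_ext_of_initial fun n p => ?_
  rw [Measure.map_apply (measurable_ptrans y) (measurableSet_initial _ _)]
  have e : ptrans y ⁻¹' {q | ∀ i ≤ n, q i = p i} = {q | ∀ i ≤ n, q i = (fun i => p i - y) i} := by
    ext q
    simp only [Set.mem_preimage, Set.mem_ofPred_eq, ptrans, eq_sub_iff_add_eq]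
  rw [e, walk_initial, walk_initial]
  have h1 : ∀ a b : ℤ, step (fun z => ω (z + y)) (a - y) {b - y} = step ω a {b} := by
    intro a b
    have e1 : b - y = a - y + 1 ↔ b = a + 1 := by omega
    have e2 : b - y = a - y - 1 ↔ b = a - 1 := by omega
    simp only [step_singleton, sub_add_cancel, e1, e2]
  simp only [h1, sub_eq_iff_eq_add]

/-! ### Passage times -/

/-- The trajectories that are at `y` for the first time at time `t`. -/
def hits (y : ℤ) (t : ℕ) : Set Path := {p | p t = y ∧ ∀ s < t, p s ≠ y}

/-- The trajectory after time `t`. -/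
def pdrop (t : ℕ) (p : Path) : Path := fun n => p (t + n)

theorem measurable_pdrop (t : ℕ) : Measurable (pdrop t) :=
  measurable_pi_lambda _ fun _ => measurable_pi_apply _

theorem measurableSet_hits (y : ℤ) (t : ℕ) : MeasurableSet (hits y t) := by
  have : hits y t = {p | p t = y} ∩ ⋂ (s : ℕ) (_ : s < t), {p | p s = y}ᶜ := by
    ext p; simp [hits]
  rw [this]
  exact (measurableSet_coord t y).inter
    (MeasurableSet.iInter fun s => MeasurableSet.iInter fun _ => (measurableSet_coord s y).compl)

theorem T_of_mem_hits {y : ℤ} {t : ℕ} {p : Path} (h : p ∈ hits y t) : T p y = t := by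
  refine le_antisymm (iInf₂_le t h.1) (le_iInf₂ fun k hk => ?_)
  by_contra hlt
  push Not at hlt
  exact h.2 k (by exact_mod_cast hlt) hk

theorem exists_mem_hits {y : ℤ} {p : Path} {t : ℕ} (h : p t = y) : ∃ s ≤ t, p ∈ hits y s := by
  classical
  have hex : ∃ t, p t = y := ⟨t, h⟩
  exact ⟨Nat.find hex, Nat.find_min' hex h, Nat.find_spec hex, fun s hs => Nat.find_min hex hs⟩

theorem T_eq_top {y : ℤ} {p : Path} : T p y = ∞ ↔ ∀ t, p t ≠ y := by
  simp [T, iInf_eq_top]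

theorem T_eq_natCast {y : ℤ} {t : ℕ} {p : Path} : T p y = t ↔ p ∈ hits y t := by
  refine ⟨fun h => ?_, T_of_mem_hits⟩
  have hne : T p y ≠ ∞ := by rw [h]; exact ENNReal.natCast_ne_top t
  rw [Ne, T_eq_top] at hne
  push Not at hne
  obtain ⟨s, hs⟩ := hne
  obtain ⟨r, -, hr⟩ := exists_mem_hits hs
  have := T_of_mem_hits hr
  rw [h] at this
  have : t = r := by exact_mod_cast this
  rwa [this]

theorem exists_T_eq_natCast {y : ℤ} {p : Path} (h : T p y ≠ ∞) : ∃ t : ℕ, T p y = t := by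
  rw [Ne, T_eq_top] at h
  push Not at h
  obtain ⟨s, hs⟩ := h
  obtain ⟨r, -, hr⟩ := exists_mem_hits hs
  exact ⟨r, T_of_mem_hits hr⟩

theorem T_eq_zero {y : ℤ} {p : Path} (h : p 0 = y) : T p y = 0 := by
  have : p ∈ hits y 0 := ⟨h, by simp⟩
  simpa using T_of_mem_hits this

theorem mem_hits_pcons {x y : ℤ} (h : x ≠ y) {t : ℕ} {p : Path} :
    pcons x p ∈ hits y (t + 1) ↔ p ∈ hits y t := by
  simp only [hits, Set.mem_ofPred_eq, pcons_succ]
  refine and_congr_right fun _ => ⟨fun h' s hs => h' (s + 1) (by omega), ?_⟩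
  rintro h' (_ | s) hs
  · exact h
  · exact h' s (by omega)

theorem T_pcons {x y : ℤ} (h : x ≠ y) (p : Path) : T (pcons x p) y = T p y + 1 := by
  by_cases ht : T p y = ∞
  · rw [ht, top_add, T_eq_top]
    rw [T_eq_top] at ht
    rintro (_ | t)
    · exact h
    · exact ht t
  · obtain ⟨t, ht⟩ := exists_T_eq_natCast ht
    rw [ht]
    exact_mod_cast T_of_mem_hits ((mem_hits_pcons h).2 (T_eq_natCast.1 ht))

theorem measurable_T (y : ℤ) : Measurable fun p : Path => T p y := by
  classical
  unfold T
  refine Measurable.iInf fun k => ?_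
  have : (fun p : Path => ⨅ (_ : p k = y), (k : ℝ≥0∞)) =
      fun p : Path => if p k = y then (k : ℝ≥0∞) else ⊤ := by
    ext p
    split_ifs with h <;> simp [h]
  rw [this]
  exact Measurable.ite (measurableSet_coord k y) measurable_const
    measurable_const

theorem measurable_T_uncurry : Measurable fun z : Path × ℤ => T z.1 z.2 :=
  measurable_from_prod_countable_left measurable_T

/-- The strong Markov property at the passage time of `y`. -/
theorem walk_hits_inter (ω : Env) (x y : ℤ) (t : ℕ) {B : Set Path} (hB : MeasurableSet B) :
    walk ω x (hits y t ∩ pdrop t ⁻¹' B) = walk ω x (hits y t) * walk ω y B := by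
  -- The walk starts at `z` almost surely, so the event is null when exactly one of `z = y` and `t =
  -- 0` holds.
  have hnull : ∀ z t, (z = y ↔ t ≠ 0) → walk ω z (hits y t) = 0 := by
    intro z t h
    rw [← nonpos_iff_eq_zero, ← (ae_iff.1 (ae_walk_start ω z))]
    refine measure_mono fun p hp hz => ?_
    rcases Nat.eq_zero_or_pos t with rfl | ht
    · have := hp.1
      omega
    · exact hp.2 0 ht (hz.trans (h.2 ht.ne'))
  induction t generalizing x with
  | zero =>
    by_cases hxy : x = y
    · subst hxy
      have h1 : hits x 0 =ᵐ[walk ω x] Set.univ := by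
        filter_upwards [ae_walk_start ω x] with p hp
        exact propext ⟨fun _ => trivial, fun _ => ⟨hp, by simp⟩⟩
      have h2 : pdrop 0 ⁻¹' B = B := by
        ext p
        have : pdrop 0 p = p := by ext n; simp [pdrop]
        simp [this]
      rw [h2, measure_congr (h1.inter (ae_eq_refl B)), measure_congr h1]
      simp
    · have h1 := hnull x 0 (by simp [hxy])
      rw [h1, zero_mul]
      exact measure_mono_null Set.inter_subset_left h1
  | succ t ih =>
    by_cases hxy : x = y
    · have h1 := hnull x (t + 1) (by simp [hxy])
      rw [h1, zero_mul]
      exact measure_mono_null Set.inter_subset_left h1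
    · have e1 : pcons x ⁻¹' hits y (t + 1) = hits y t := by
        ext p; exact mem_hits_pcons hxy
      have e2 : pcons x ⁻¹' (hits y (t + 1) ∩ pdrop (t + 1) ⁻¹' B) = hits y t ∩ pdrop t ⁻¹' B := by
        rw [Set.preimage_inter, e1]
        congr 1
        ext p
        have : pdrop (t + 1) (pcons x p) = pdrop t p := by
          ext n
          simp only [pdrop]
          rw [show t + 1 + n = (t + n) + 1 by ring, pcons_succ]
        simp [this]
      rw [walk_apply ω x ((measurableSet_hits _ _).inter (measurable_pdrop _ hB)),
        walk_apply ω x (measurableSet_hits _ _), e1, e2, ih, ih]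
      ring

/-! ### Expected passage times -/

/-- The quenched expectation of `T_y ∧ n` for the walk that starts at `x`. -/
noncomputable def truncMean (ω : Env) (n : ℕ) (x y : ℤ) : ℝ≥0∞ :=
  ∫⁻ p, min (T p y) n ∂(walk ω x)

/-- The quenched expectation of `T_y` for the walk that starts at `x`. -/
noncomputable def passMean (ω : Env) (x y : ℤ) : ℝ≥0∞ := ∫⁻ p, T p y ∂(walk ω x)

/-- The quenched probability of `T_y ≤ n` for the walk that starts at `x`. -/
noncomputable def hitProb (ω : Env) (n : ℕ) (x y : ℤ) : ℝ≥0∞ := walk ω x {p | T p y ≤ n}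

variable {ω : Env}

theorem iSup_min_natCast (a : ℝ≥0∞) : ⨆ n : ℕ, min a n = a := by
  rw [← inf_iSup_eq, ENNReal.iSup_natCast, inf_top_eq]

theorem iSup_truncMean (x y : ℤ) : ⨆ n, truncMean ω n x y = passMean ω x y := by
  unfold truncMean passMean
  rw [← lintegral_iSup]
  · simp only [iSup_min_natCast]
  · exact fun n => (measurable_T y).min measurable_const
  · exact fun a b hab p => min_le_min le_rfl (by exact_mod_cast hab)

theorem truncMean_mono {x y : ℤ} : Monotone fun n => truncMean ω n x y := fun _ _ hab =>
  lintegral_mono fun _ => min_le_min le_rfl (by exact_mod_cast hab)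

theorem truncMean_le_passMean (n : ℕ) (x y : ℤ) : truncMean ω n x y ≤ passMean ω x y :=
  lintegral_mono fun _ => min_le_left _ _

theorem truncMean_le (n : ℕ) (x y : ℤ) : truncMean ω n x y ≤ n := by
  refine (lintegral_mono fun p => min_le_right _ _).trans ?_
  simp

theorem truncMean_self (n : ℕ) (y : ℤ) : truncMean ω n y y = 0 := by
  unfold truncMean
  rw [lintegral_eq_zero_iff ((measurable_T y).min measurable_const)]
  filter_upwards [ae_walk_start ω y] with p hp
  simp [T_eq_zero hp]

theorem truncMean_succ (n : ℕ) {x y : ℤ} (h : x ≠ y) : truncMean ω (n + 1) x y =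
    1 + ENNReal.ofReal (ω x) * truncMean ω n (x + 1) y +
      ENNReal.ofReal (1 - ω x) * truncMean ω n (x - 1) y := by
  have hm : Measurable fun p : Path => min (T p y) ((n + 1 : ℕ) : ℝ≥0∞) :=
    (measurable_T y).min measurable_const
  have e : ∀ z, ∫⁻ p, min (T (pcons x p) y) ((n + 1 : ℕ) : ℝ≥0∞) ∂(walk ω z) =
      1 + truncMean ω n z y := by
    intro z
    have : ∀ p, min (T (pcons x p) y) ((n + 1 : ℕ) : ℝ≥0∞) = 1 + min (T p y) n := by
      intro p
      rw [T_pcons h, Nat.cast_succ, min_add_add_right, add_comm]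
    simp only [this]
    rw [lintegral_add_left measurable_const]
    simp [truncMean]
  unfold truncMean at e ⊢
  rw [lintegral_walk ω x hm, e, e]
  set a := ∫⁻ p, min (T p y) n ∂(walk ω (x + 1))
  set b := ∫⁻ p, min (T p y) n ∂(walk ω (x - 1))
  calc _ = (ENNReal.ofReal (ω x) + ENNReal.ofReal (1 - ω x)) + ENNReal.ofReal (ω x) * a +
        ENNReal.ofReal (1 - ω x) * b := by ring
    _ = _ := by rw [ofReal_add_ofReal_one_sub]

theorem hitProb_self (n : ℕ) (y : ℤ) : hitProb ω n y y = 1 := by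
  unfold hitProb
  rw [← @measure_univ _ _ (walk ω y)]
  refine measure_congr ?_
  filter_upwards [ae_walk_start ω y] with p hp
  refine propext ⟨fun _ => trivial, fun _ => ?_⟩
  change T p y ≤ n
  simp [T_eq_zero hp]

theorem hitProb_zero {x y : ℤ} (h : x ≠ y) : hitProb ω 0 x y = 0 := by
  unfold hitProb
  rw [← nonpos_iff_eq_zero, ← (ae_iff.1 (ae_walk_start ω x))]
  refine measure_mono fun p hp => ?_
  have hT : T p y = (0 : ℕ) := by simpa using hp
  have := (T_eq_natCast.1 hT).1
  simp only [Set.mem_ofPred_eq]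
  omega

theorem hitProb_succ (n : ℕ) {x y : ℤ} (h : x ≠ y) : hitProb ω (n + 1) x y =
    ENNReal.ofReal (ω x) * hitProb ω n (x + 1) y +
      ENNReal.ofReal (1 - ω x) * hitProb ω n (x - 1) y := by
  unfold hitProb
  have hm : MeasurableSet {p : Path | T p y ≤ ((n + 1 : ℕ) : ℝ≥0∞)} :=
    measurableSet_le (measurable_T y) measurable_const
  rw [walk_apply ω x hm]
  have e : pcons x ⁻¹' {p : Path | T p y ≤ ((n + 1 : ℕ) : ℝ≥0∞)} = {p : Path | T p y ≤ n} := by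
    ext p
    simp only [Set.mem_preimage, Set.mem_ofPred_eq, T_pcons h, Nat.cast_succ]
    exact ENNReal.add_le_add_iff_right ENNReal.one_ne_top
  rw [e]

/-- The walk must visit `y` before `z`, and truncation is subadditive. The induction on the horizon
`n` lets both sides take one step; the constant `truncMean ω n y z` is unaffected because the two
step probabilities add up to `1`. -/
theorem truncMean_triangle (n : ℕ) {x y z : ℤ} (hxy : x ≤ y) (hyz : y < z) :
    truncMean ω n x z ≤ truncMean ω n x y + truncMean ω n y z := by
  induction n generalizing x with
  | zero =>
    have := truncMean_le (ω := ω) 0 x z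
    rw [Nat.cast_zero, nonpos_iff_eq_zero] at this
    simp [this]
  | succ n ih =>
    rcases hxy.eq_or_lt with rfl | hlt
    · exact le_add_self
    · rw [truncMean_succ n (by omega : x ≠ z), truncMean_succ n hlt.ne]
      refine le_trans ?_ (add_le_add le_rfl (truncMean_mono (Nat.le_succ n)))
      dsimp only
      set c := truncMean ω n y z
      calc _ ≤ 1 + ENNReal.ofReal (ω x) * (truncMean ω n (x + 1) y + c) +
            ENNReal.ofReal (1 - ω x) * (truncMean ω n (x - 1) y + c) := by
            gcongr
            · exact ih (by omega)
            · exact ih (by omega)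
        _ = 1 + ENNReal.ofReal (ω x) * truncMean ω n (x + 1) y +
            ENNReal.ofReal (1 - ω x) * truncMean ω n (x - 1) y +
            (ENNReal.ofReal (ω x) + ENNReal.ofReal (1 - ω x)) * c := by ring
        _ = _ := by rw [ofReal_add_ofReal_one_sub, one_mul]

/-- Converse of the triangle inequality: a walk that reaches `y` within `n` steps still has at least
`k` of the `n + k` steps left to look for `z`. -/
theorem le_truncMean_add (n k : ℕ) {x y z : ℤ} (hxy : x ≤ y) (hyz : y < z) :
    truncMean ω n x y + hitProb ω n x y * truncMean ω k y z ≤ truncMean ω (n + k) x z := by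
  induction n generalizing x with
  | zero =>
    rcases hxy.eq_or_lt with rfl | hlt
    · simp [truncMean_self, hitProb_self]
    · rw [hitProb_zero hlt.ne, zero_mul, add_zero]
      exact (truncMean_le _ _ _).trans (by simp)
  | succ n ih =>
    rcases hxy.eq_or_lt with rfl | hlt
    · rw [truncMean_self, hitProb_self, zero_add, one_mul]
      exact truncMean_mono (by omega)
    · rw [show n + 1 + k = n + k + 1 by ring, truncMean_succ _ (by omega : x ≠ z),
        truncMean_succ n hlt.ne, hitProb_succ n hlt.ne]
      set c := truncMean ω k y z
      calc _ = 1 + ENNReal.ofReal (ω x) * (truncMean ω n (x + 1) y + hitProb ω n (x + 1) y * c) +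
            ENNReal.ofReal (1 - ω x) * (truncMean ω n (x - 1) y + hitProb ω n (x - 1) y * c) := by
            ring
        _ ≤ _ := by
            gcongr
            · exact ih (by omega)
            · exact ih (by omega)

theorem ae_T_ne_top {x y : ℤ} (h : passMean ω x y ≠ ∞) : ∀ᵐ p ∂(walk ω x), T p y ≠ ∞ := by
  filter_upwards [ae_lt_top (measurable_T y) h] with p hp using hp.ne

theorem iSup_hitProb {x y : ℤ} (h : passMean ω x y ≠ ∞) : ⨆ n, hitProb ω n x y = 1 := by
  unfold hitProb
  have hmono : Monotone fun n : ℕ => {p : Path | T p y ≤ n} :=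
    fun a b hab p (hp : T p y ≤ a) => hp.trans (by exact_mod_cast hab)
  rw [← hmono.measure_iUnion, ← @measure_univ _ _ (walk ω x)]
  refine measure_congr ?_
  filter_upwards [ae_T_ne_top h] with p hp
  refine propext ⟨fun _ => trivial, fun _ => ?_⟩
  obtain ⟨t, ht⟩ := exists_T_eq_natCast hp
  exact Set.mem_iUnion.2 ⟨t, ht.le⟩

theorem passMean_self (y : ℤ) : passMean ω y y = 0 := by
  rw [← iSup_truncMean]
  simp [truncMean_self]

/-- Both truncated inequalities pass to the limit. If `passMean ω x y` is infinite, `hitProb` need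
not tend to `1`, but then both sides are infinite. -/
theorem passMean_add {x y z : ℤ} (hxy : x ≤ y) (hyz : y < z) :
    passMean ω x z = passMean ω x y + passMean ω y z := by
  refine le_antisymm ?_ ?_
  · rw [← iSup_truncMean]
    exact iSup_le fun n => (truncMean_triangle n hxy hyz).trans
      (add_le_add (truncMean_le_passMean _ _ _) (truncMean_le_passMean _ _ _))
  · have h1 : ∀ n, truncMean ω n x y + hitProb ω n x y * passMean ω y z ≤ passMean ω x z := by
      intro n
      rw [← iSup_truncMean y z, ENNReal.mul_iSup, ENNReal.add_iSup]
      exact iSup_le fun k => (le_truncMean_add n k hxy hyz).trans (truncMean_le_passMean _ _ _)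
    by_cases h : passMean ω x y = ∞
    · have : passMean ω x y ≤ passMean ω x z := by
        rw [← iSup_truncMean]
        exact iSup_le fun n => le_self_add.trans (h1 n)
      rw [h, top_le_iff] at this
      rw [this]
      exact le_top
    · have hm : Monotone fun n => hitProb ω n x y := fun a b hab =>
        measure_mono fun p (hp : T p y ≤ a) => hp.trans (by exact_mod_cast hab)
      rw [← one_mul (passMean ω y z), ← iSup_hitProb h, ENNReal.iSup_mul, ← iSup_truncMean,
        ENNReal.iSup_add_iSup_of_monotone truncMean_mono]
      · exact iSup_le h1
      · exact fun a b hab => mul_le_mul_left (hm hab) _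

/-- The ratio `ρ = (1 - λ) / λ`. -/
noncomputable def rho (u : Set.Ioo (0 : ℝ) 1) : ℝ≥0∞ := ENNReal.ofReal ((1 - u) / u)

theorem rho_ne_zero (u : Set.Ioo (0 : ℝ) 1) : rho u ≠ 0 := by
  have := u.2
  simp only [rho, ne_eq, ENNReal.ofReal_eq_zero, not_le]
  exact div_pos (by linarith [this.2]) this.1

theorem rho_ne_top (u : Set.Ioo (0 : ℝ) 1) : rho u ≠ ∞ := ENNReal.ofReal_ne_top

theorem rho_half : rho half = 1 := by
  simp only [rho, half]
  norm_num

theorem ofReal_mul_rho (u : Set.Ioo (0 : ℝ) 1) :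
    ENNReal.ofReal u * rho u = ENNReal.ofReal (1 - u) := by
  rw [rho, ← ENNReal.ofReal_mul u.2.1.le, mul_div_cancel₀ _ u.2.1.ne']

/-- The inequality is solved for `a` by cancelling `(1 - u) a` and dividing by `u`. The cancellation
needs `a` finite, which is why the upper bounds are proved for truncated means. -/
theorem le_of_le_step (u : Set.Ioo (0 : ℝ) 1) {a b : ℝ≥0∞} (ha : a ≠ ∞)
    (h : a ≤ 1 + ENNReal.ofReal (1 - u) * (b + a)) : a ≤ 1 + rho u + rho u * b := by
  have hu : ENNReal.ofReal u ≠ 0 := by simpa using u.2.1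
  rw [← ENNReal.mul_le_mul_iff_right hu ENNReal.ofReal_ne_top]
  have e : ENNReal.ofReal u * (1 + rho u + rho u * b) = 1 + ENNReal.ofReal (1 - u) * b := by
    rw [mul_add, mul_add, mul_one, ← mul_assoc, ofReal_mul_rho, ofReal_add_ofReal_one_sub]
  rw [e]
  have hfin : ENNReal.ofReal (1 - u) * a ≠ ∞ := ENNReal.mul_ne_top ENNReal.ofReal_ne_top ha
  rw [← ENNReal.add_le_add_iff_right hfin, ← add_mul, ofReal_add_ofReal_one_sub, one_mul]
  rwa [mul_add, ← add_assoc] at h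

theorem ge_of_ge_step (u : Set.Ioo (0 : ℝ) 1) {a b : ℝ≥0∞}
    (h : 1 + ENNReal.ofReal (1 - u) * (b + a) ≤ a) : 1 + rho u + rho u * b ≤ a := by
  by_cases ha : a = ∞
  · rw [ha]; exact le_top
  have hu : ENNReal.ofReal u ≠ 0 := by simpa using u.2.1
  rw [← ENNReal.mul_le_mul_iff_right hu ENNReal.ofReal_ne_top]
  have e : ENNReal.ofReal u * (1 + rho u + rho u * b) = 1 + ENNReal.ofReal (1 - u) * b := by
    rw [mul_add, mul_add, mul_one, ← mul_assoc, ofReal_mul_rho, ofReal_add_ofReal_one_sub]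
  rw [e]
  have hfin : ENNReal.ofReal (1 - u) * a ≠ ∞ := ENNReal.mul_ne_top ENNReal.ofReal_ne_top ha
  rw [← ENNReal.add_le_add_iff_right hfin, ← add_mul, ofReal_add_ofReal_one_sub, one_mul]
  rwa [mul_add, ← add_assoc] at h

/-- A first step to the left must be made up for by crossing from `i - 1` to `i` and then from `i`
to `i + 1` again. -/
theorem truncMean_succ_site_le (n : ℕ) (i : ℤ) : truncMean ω n i (i + 1) ≤
    1 + rho (ω i) + rho (ω i) * truncMean ω n (i - 1) (i - 1 + 1) := by
  refine le_of_le_step (ω i) (ne_top_of_le_ne_top (ENNReal.natCast_ne_top n)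
    (truncMean_le _ _ _)) ?_
  refine (truncMean_mono (Nat.le_succ n)).trans ?_
  dsimp only
  rw [Nat.succ_eq_add_one, truncMean_succ n (by omega), truncMean_self, mul_zero, add_zero]
  gcongr
  rw [sub_add_cancel]
  exact truncMean_triangle n (by omega) (by omega)

theorem passMean_succ_site_ge (i : ℤ) :
    1 + rho (ω i) + rho (ω i) * passMean ω (i - 1) (i - 1 + 1) ≤ passMean ω i (i + 1) := by
  refine ge_of_ge_step (ω i) ?_
  rw [sub_add_cancel, ← passMean_add (by omega) (by omega), ← iSup_truncMean (i - 1),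
    ENNReal.mul_iSup, ENNReal.add_iSup]
  refine iSup_le fun n => le_trans ?_ (truncMean_le_passMean (n + 1) _ _)
  rw [truncMean_succ n (by omega), truncMean_self, mul_zero, add_zero]

/-- At the unmarked sites of a block the ratio is `1`, so each further site adds `2` to the crossing
time. -/
theorem block_le {u r : ℤ → ℝ≥0∞} (hu : ∀ i, u i ≤ 1 + r i + r i * u (i - 1)) {s : ℤ} {l : ℕ}
    (hr : ∀ j : ℕ, 1 ≤ j → j < l → r (s + j) = 1) (j : ℕ) (hj : j < l) :
    u (s + j) ≤ 1 + r s * (1 + u (s - 1)) + 2 * j := by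
  induction j with
  | zero =>
    simp only [Nat.cast_zero, add_zero, mul_zero]
    exact (hu s).trans_eq (by ring)
  | succ j ih =>
    refine (hu _).trans ?_
    rw [hr (j + 1) (by omega) hj, one_mul,
      show s + ((j + 1 : ℕ) : ℤ) - 1 = s + j by push_cast; ring]
    calc 1 + 1 + u (s + j) ≤ 1 + 1 + (1 + r s * (1 + u (s - 1)) + 2 * j) := by
          gcongr; exact ih (by omega)
      _ = _ := by push_cast; ring

theorem block_ge {u r : ℤ → ℝ≥0∞} (hu : ∀ i, 1 + r i + r i * u (i - 1) ≤ u i) {s : ℤ} {l : ℕ}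
    (hr : ∀ j : ℕ, 1 ≤ j → j < l → r (s + j) = 1) (j : ℕ) (hj : j < l) :
    1 + r s * (1 + u (s - 1)) + 2 * j ≤ u (s + j) := by
  induction j with
  | zero =>
    simp only [Nat.cast_zero, add_zero, mul_zero]
    exact le_of_eq_of_le (by ring) (hu s)
  | succ j ih =>
    refine le_trans ?_ (hu _)
    rw [hr (j + 1) (by omega) hj, one_mul,
      show s + ((j + 1 : ℕ) : ℤ) - 1 = s + j by push_cast; ring]
    calc _ = 1 + 1 + (1 + r s * (1 + u (s - 1)) + 2 * j) := by push_cast; ring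
      _ ≤ 1 + 1 + u (s + j) := by gcongr; exact ih (by omega)

theorem truncMean_le_sum (n : ℕ) (x : ℤ) (l : ℕ) : truncMean ω n x (x + l) ≤
    ∑ j ∈ Finset.range l, truncMean ω n (x + j) (x + j + 1) := by
  induction l with
  | zero => simp [truncMean_self]
  | succ l ih =>
    rw [Finset.sum_range_succ]
    have := truncMean_triangle (ω := ω) n (x := x) (y := x + l) (z := x + l + 1) (by omega)
      (by omega)
    push_cast
    rw [← add_assoc]
    exact this.trans (add_le_add ih le_rfl)

theorem passMean_eq_sum (x : ℤ) (l : ℕ) : passMean ω x (x + l) =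
    ∑ j ∈ Finset.range l, passMean ω (x + j) (x + j + 1) := by
  induction l with
  | zero => simp [passMean_self]
  | succ l ih =>
    rw [Finset.sum_range_succ, ← ih]
    push_cast
    rw [← add_assoc]
    exact passMean_add (by omega) (by omega)

/-- The odd numbers add up to a square: this is where `E ξ ^ 2` comes from. -/
theorem sum_block (a : ℝ≥0∞) (l : ℕ) :
    ∑ j ∈ Finset.range l, (1 + a + 2 * (j : ℝ≥0∞)) = (l : ℝ≥0∞) ^ 2 + l * a := by
  induction l with
  | zero => simp
  | succ l ih => rw [Finset.sum_range_succ, ih]; push_cast; ring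

/-! ### Expected passage times in the sparse environment -/

theorem S_zero (m : Marks) : S m 0 = 0 := by simp [S]

theorem S_one (m : Marks) : S m 1 = ((m 1).1 : ℕ) := by simp [S]

theorem sparseEnv_between (m : Marks) (k : ℤ) (j : ℕ) (h1 : 1 ≤ j) (h2 : j < ((m (k + 1)).1 : ℕ)) :
    sparseEnv m (S m k + j) = half := by
  rw [sparseEnv, dif_neg]
  rintro ⟨i, hi⟩
  have hk : S m k < S m i := by omega
  have hk' : S m i < S m (k + 1) := by
    rw [S_succ, hi]
    have : ((m (k + 1)).1 : ℤ) = (((m (k + 1)).1 : ℕ) : ℤ) := rfl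
    omega
  have := (S_strictMono m).lt_iff_lt.1 hk
  have := (S_strictMono m).lt_iff_lt.1 hk'
  omega

theorem rho_sparseEnv_between (m : Marks) (k : ℤ) (j : ℕ) (h1 : 1 ≤ j)
    (h2 : j < ((m (k + 1)).1 : ℕ)) : rho (sparseEnv m (S m k + j)) = 1 := by
  rw [sparseEnv_between m k j h1 h2, rho_half]

/-- The sum `2 ξ_0 + 2 ρ_0 ξ_{-1} + 2 ρ_0 ρ_{-1} ξ_{-2} + ⋯`. -/
noncomputable def backSeries (m : Marks) : ℝ≥0∞ :=
  ∑' j : ℕ, 2 * ((m (-j)).1 : ℕ) * ∏ i ∈ Finset.range j, rho (m (-i)).2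

theorem S_succ_sub_one (m : Marks) (k : ℤ) :
    S m (k + 1) - 1 = S m k + (((m (k + 1)).1 : ℕ) - 1 : ℕ) := by
  rw [S_succ]
  have : ((m (k + 1)).1 : ℤ) = (((m (k + 1)).1 : ℕ) : ℤ) := rfl
  have := (m (k + 1)).1.pos
  omega

theorem one_add_block (a : ℝ≥0∞) (l : ℕ) (hl : 0 < l) :
    1 + (1 + a + 2 * ((l - 1 : ℕ) : ℝ≥0∞)) = 2 * l + a := by
  obtain ⟨l, rfl⟩ : ∃ k, l = k + 1 := ⟨l - 1, by omega⟩
  push_cast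
  ring

/-- The recursion is read at the last site of each block, and adding `1` to the crossing time makes
its constant term exactly `2 ξ`. -/
theorem truncMean_level_le (m : Marks) (n : ℕ) (k : ℤ) :
    1 + truncMean (sparseEnv m) n (S m (k + 1) - 1) (S m (k + 1)) ≤
      2 * ((m (k + 1)).1 : ℕ) +
        rho (m (k + 1)).2 * (1 + truncMean (sparseEnv m) n (S m k - 1) (S m k)) := by
  have h := block_le (u := fun i => truncMean (sparseEnv m) n i (i + 1))
    (r := fun i => rho (sparseEnv m i)) (truncMean_succ_site_le n) (s := S m k)
    (rho_sparseEnv_between m k) (((m (k + 1)).1 : ℕ) - 1) (by have := (m (k + 1)).1.pos; omega)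
  simp only [← S_succ_sub_one, sub_add_cancel, sparseEnv_S] at h
  rw [← one_add_block _ _ (m (k + 1)).1.pos]
  gcongr

theorem passMean_level_ge (m : Marks) (k : ℤ) :
    2 * ((m (k + 1)).1 : ℕ) +
        rho (m (k + 1)).2 * (1 + passMean (sparseEnv m) (S m k - 1) (S m k)) ≤
    1 + passMean (sparseEnv m) (S m (k + 1) - 1) (S m (k + 1)) := by
  have h := block_ge (u := fun i => passMean (sparseEnv m) i (i + 1))
    (r := fun i => rho (sparseEnv m i)) passMean_succ_site_ge (s := S m k)
    (rho_sparseEnv_between m k) (((m (k + 1)).1 : ℕ) - 1) (by have := (m (k + 1)).1.pos; omega)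
  simp only [← S_succ_sub_one, sub_add_cancel, sparseEnv_S] at h
  rw [← one_add_block _ _ (m (k + 1)).1.pos]
  gcongr

theorem iterate_le {c a r : ℕ → ℝ≥0∞} (h : ∀ j, c j ≤ a j + r j * c (j + 1)) (J : ℕ) :
    c 0 ≤ ∑ j ∈ Finset.range J, a j * ∏ i ∈ Finset.range j, r i +
      (∏ i ∈ Finset.range J, r i) * c J := by
  induction J with
  | zero => simp
  | succ J ih =>
    refine ih.trans ?_
    rw [Finset.sum_range_succ, Finset.prod_range_succ, add_assoc]
    gcongr
    calc _ ≤ (∏ i ∈ Finset.range J, r i) * (a J + r J * c (J + 1)) := by gcongr; exact h J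
      _ = _ := by ring

theorem iterate_ge {c a r : ℕ → ℝ≥0∞} (h : ∀ j, a j + r j * c (j + 1) ≤ c j) (J : ℕ) :
    ∑ j ∈ Finset.range J, a j * ∏ i ∈ Finset.range j, r i +
      (∏ i ∈ Finset.range J, r i) * c J ≤ c 0 := by
  induction J with
  | zero => simp
  | succ J ih =>
    refine le_trans ?_ ih
    rw [Finset.sum_range_succ, Finset.prod_range_succ, add_assoc]
    gcongr
    calc _ = (∏ i ∈ Finset.range J, r i) * (a J + r J * c (J + 1)) := by ring
      _ ≤ _ := by gcongr; exact h J

/-- Since `ξ ≥ 1`, the products are dominated by the terms of a convergent series. -/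
theorem tendsto_prod_rho {m : Marks} (h : backSeries m ≠ ∞) :
    Tendsto (fun J : ℕ => ∏ i ∈ Finset.range J, rho (m (-i)).2) atTop (𝓝 0) := by
  have h0 := ENNReal.tendsto_atTop_zero_of_tsum_ne_top h
  refine tendsto_of_tendsto_of_tendsto_of_le_of_le tendsto_const_nhds h0
    (fun _ => zero_le) fun J => ?_
  have h1 : (1 : ℝ≥0∞) ≤ 2 * ((m (-J)).1 : ℕ) := by
    have := (m (-J)).1.pos
    exact_mod_cast (by omega : 1 ≤ 2 * ((m (-J)).1 : ℕ))
  calc _ = 1 * ∏ i ∈ Finset.range J, rho (m (-i)).2 := (one_mul _).symm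
    _ ≤ _ := by gcongr

/-- The level recursion is unrolled to the left `J` times. For a fixed truncation `n` the remainder
is at most the product of the ratios times `1 + n`, which vanishes as `J → ∞`; for the lower bound
the remainder is simply dropped. -/
theorem passMean_level_eq {m : Marks} (h : backSeries m ≠ ∞) :
    1 + passMean (sparseEnv m) (-1) 0 = backSeries m := by
  refine le_antisymm ?_ ?_
  · rw [← iSup_truncMean, ENNReal.add_iSup]
    refine iSup_le fun n => ?_
    have h1 := iterate_le (c := fun j : ℕ =>
      1 + truncMean (sparseEnv m) n (S m (-j) - 1) (S m (-j))) (a := fun j => 2 * ((m (-j)).1 : ℕ))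
      (r := fun j => rho (m (-j)).2) fun j => by
        have := truncMean_level_le m n (-(j + 1 : ℕ))
        rw [show -((j + 1 : ℕ) : ℤ) + 1 = -j by push_cast; ring] at this
        exact this
    simp only [Nat.cast_zero, neg_zero, S_zero, zero_sub] at h1
    have h2 : ∀ J : ℕ, 1 + truncMean (sparseEnv m) n (-1) 0 ≤ backSeries m +
        (∏ i ∈ Finset.range J, rho (m (-i)).2) * (1 + n) := by
      intro J
      refine (h1 J).trans ?_
      gcongr
      · exact ENNReal.sum_le_tsum _
      · exact truncMean_le _ _ _
    have h3 : Tendsto (fun J : ℕ => backSeries m +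
        (∏ i ∈ Finset.range J, rho (m (-i)).2) * (1 + n)) atTop (𝓝 (backSeries m + 0 * (1 + n))) :=
      tendsto_const_nhds.add (ENNReal.Tendsto.mul_const (tendsto_prod_rho h)
        (Or.inr (by simp)))
    rw [zero_mul, add_zero] at h3
    exact ge_of_tendsto' h3 h2
  · refine ENNReal.tsum_le_of_sum_range_le fun J => ?_
    have h1 := iterate_ge (c := fun j : ℕ =>
      1 + passMean (sparseEnv m) (S m (-j) - 1) (S m (-j))) (a := fun j => 2 * ((m (-j)).1 : ℕ))
      (r := fun j => rho (m (-j)).2) (fun j => by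
        have := passMean_level_ge m (-(j + 1 : ℕ))
        rw [show -((j + 1 : ℕ) : ℤ) + 1 = -j by push_cast; ring] at this
        exact this) J
    simp only [Nat.cast_zero, neg_zero, S_zero, zero_sub] at h1
    exact le_self_add.trans h1

theorem passMean_S_one {m : Marks} (h : backSeries m ≠ ∞) :
    passMean (sparseEnv m) 0 (S m 1) =
      (((m 1).1 : ℕ) : ℝ≥0∞) ^ 2 + ((m 1).1 : ℕ) * (rho (m 1).2 * backSeries m) := by
  have hlev := passMean_level_eq h
  have hbetween := rho_sparseEnv_between m 0
  have hS := sparseEnv_S m 0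
  rw [zero_add, S_zero] at hbetween
  rw [zero_add, S_zero] at hS
  rw [← sum_block, ← hlev]
  refine le_antisymm ?_ ?_
  · rw [← iSup_truncMean]
    refine iSup_le fun n => ?_
    have := truncMean_le_sum (ω := sparseEnv m) n 0 ((m 1).1 : ℕ)
    rw [zero_add, ← S_one] at this
    refine this.trans (Finset.sum_le_sum fun j hj => ?_)
    have h1 := block_le (u := fun i => truncMean (sparseEnv m) n i (i + 1))
      (r := fun i => rho (sparseEnv m i)) (truncMean_succ_site_le n) (s := 0)
      hbetween j (Finset.mem_range.1 hj)
    simp only [hS, zero_sub, Int.reduceNeg, neg_add_cancel, zero_add] at h1 ⊢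
    refine h1.trans ?_
    gcongr
    exact truncMean_le_passMean n (-1) 0
  · have := passMean_eq_sum (ω := sparseEnv m) 0 ((m 1).1 : ℕ)
    rw [zero_add, ← S_one] at this
    rw [this]
    refine Finset.sum_le_sum fun j hj => ?_
    have h1 := block_ge (u := fun i => passMean (sparseEnv m) i (i + 1))
      (r := fun i => rho (sparseEnv m i)) passMean_succ_site_ge (s := 0)
      hbetween j (Finset.mem_range.1 hj)
    simp only [hS, zero_sub, Int.reduceNeg, neg_add_cancel, zero_add] at h1 ⊢
    exact h1

/-! ### The walk is bounded below -/

/-- `w i` is the increment from `i` to `i + 1` of a function harmonic for the walk, that is, the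
resistance of this edge. -/
theorem exists_conductance (ω : Env) : ∃ w : ℤ → ℝ≥0∞, w (-1) = 1 ∧
    ∀ i, w i = rho (ω i) * w (i - 1) := by
  refine ⟨fun i => if 0 ≤ i then ∏ l ∈ Finset.range (i.toNat + 1), rho (ω l) else
    ∏ l ∈ Finset.range (-1 - i).toNat, (rho (ω (-1 - l)))⁻¹, by simp, fun i => ?_⟩
  dsimp only
  rcases lt_trichotomy i 0 with h | rfl | h
  · rw [if_neg (by omega), if_neg (by omega)]
    obtain ⟨n, rfl⟩ : ∃ n : ℕ, i = -1 - n := ⟨(-1 - i).toNat, by omega⟩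
    rw [show (-1 - (-1 - (n : ℤ) - 1)).toNat = n + 1 by omega,
      show (-1 - (-1 - (n : ℤ))).toNat = n by omega, Finset.prod_range_succ, mul_comm, mul_assoc,
      ENNReal.inv_mul_cancel (rho_ne_zero _) (rho_ne_top _), mul_one]
  · simp
  · rw [if_pos (by omega), if_pos (by omega)]
    obtain ⟨n, rfl⟩ : ∃ n : ℕ, i = n + 1 := ⟨(i - 1).toNat, by omega⟩
    rw [show ((n : ℤ) + 1).toNat = n + 1 by omega, show ((n : ℤ) + 1 - 1).toNat = n by omega,
      Finset.prod_range_succ, mul_comm]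
    push_cast
    rfl

/-- The tail sum of the resistances is a nonnegative harmonic function of the starting point,
possibly infinite. The inequality is optional stopping at the passage time of `y`, done by induction
on the horizon. -/
theorem hitProb_mul_le {ω : Env} {w : ℤ → ℝ≥0∞} (hw : ∀ i, w i = rho (ω i) * w (i - 1))
    (n : ℕ) (x y : ℤ) :
    hitProb ω n x y * ∑' j : ℕ, w (y + j) ≤ ∑' j : ℕ, w (x + j) := by
  induction n generalizing x with
  | zero =>
    by_cases h : x = y
    · rw [h, hitProb_self, one_mul]
    · rw [hitProb_zero h, zero_mul]
      exact zero_le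
  | succ n ih =>
    by_cases h : x = y
    · rw [h, hitProb_self, one_mul]
    · have h1 : ∀ x, ∑' j : ℕ, w (x + j) = w x + ∑' j : ℕ, w (x + 1 + j) := by
        intro x
        rw [tsum_eq_zero_add' ENNReal.summable]
        simp only [Nat.cast_zero, add_zero, Nat.cast_succ]
        congr 1
        exact tsum_congr fun j => by congr 1; ring
      rw [hitProb_succ n h, add_mul, mul_assoc, mul_assoc]
      have h2 := h1 (x - 1)
      rw [sub_add_cancel] at h2
      calc _ ≤ ENNReal.ofReal (ω x) * ∑' j : ℕ, w (x + 1 + j) +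
            ENNReal.ofReal (1 - ω x) * (w (x - 1) + ∑' j : ℕ, w (x + j)) := by
            rw [← h2]
            gcongr
            · exact ih _
            · exact ih _
        _ = ENNReal.ofReal (ω x) * (w x + ∑' j : ℕ, w (x + 1 + j)) +
            ENNReal.ofReal (1 - ω x) * ∑' j : ℕ, w (x + j) := by
            rw [hw x, ← ofReal_mul_rho]; ring
        _ = ∑' j : ℕ, w (x + j) := by
            rw [← h1, ← add_mul, ofReal_add_ofReal_one_sub, one_mul]

theorem exists_eq_of_nearest {p : Path} (hp : ∀ n, p (n + 1) = p n + 1 ∨ p (n + 1) = p n - 1)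
    {y : ℤ} (h0 : y ≤ p 0) {n : ℕ} (hn : p n ≤ y) : ∃ t ≤ n, p t = y := by
  induction n with
  | zero => exact ⟨0, le_rfl, by omega⟩
  | succ n ih =>
    by_cases h : p n ≤ y
    · obtain ⟨t, ht, h'⟩ := ih h
      exact ⟨t, by omega, h'⟩
    · exact ⟨n + 1, le_rfl, by have := hp n; omega⟩

theorem ae_bddBelow_of_conductance {ω : Env} {w : ℤ → ℝ≥0∞}
    (hw : ∀ i, w i = rho (ω i) * w (i - 1)) (hfin : ∑' j : ℕ, w j ≠ ∞)
    (hinf : ∀ c : ℝ≥0∞, c ≠ ∞ → ∃ y < 0, c ≤ w y) :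
    ∀ᵐ p ∂(walk ω 0), ∃ c : ℤ, ∀ n, c ≤ p n := by
  have hhit : ∀ y, walk ω 0 {p | ∃ t, p t = y} * w y ≤ ∑' j : ℕ, w j := by
    intro y
    have e : {p : Path | ∃ t, p t = y} = ⋃ n : ℕ, {p | T p y ≤ n} := by
      ext p
      simp only [Set.mem_ofPred_eq, Set.mem_iUnion]
      constructor
      · rintro ⟨t, ht⟩
        exact ⟨t, iInf₂_le t ht⟩
      · rintro ⟨n, hn⟩
        have h : T p y ≠ ∞ := ne_top_of_le_ne_top (ENNReal.natCast_ne_top n) hn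
        rw [Ne, T_eq_top] at h
        push Not at h
        exact h
    have hmono : Monotone fun n : ℕ => {p : Path | T p y ≤ n} :=
      fun a b hab p (hp : T p y ≤ a) => hp.trans (by exact_mod_cast hab)
    rw [e, hmono.measure_iUnion, ENNReal.iSup_mul]
    refine iSup_le fun n => ?_
    have h1 := hitProb_mul_le hw n 0 y
    simp only [zero_add] at h1
    refine le_trans ?_ h1
    gcongr
    · exact le_rfl
    · simpa using ENNReal.le_tsum (f := fun j : ℕ => w (y + j)) 0
  have hzero : walk ω 0 {p | ∀ y < 0, ∃ t, p t = y} = 0 := by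
    by_contra hne
    set a := walk ω 0 {p | ∀ y < 0, ∃ t, p t = y} with ha
    -- If all negative sites were visited with probability `a > 0`, then `a * w y` would be bounded
    -- by the forward resistance for every `y < 0`; this threshold makes it exceed that bound by
    -- `1`.
    obtain ⟨y, hy, hwy⟩ := hinf ((∑' j : ℕ, w j + 1) / a) (ENNReal.div_ne_top (by simp [hfin]) hne)
    have hsub : {p : Path | ∀ y < 0, ∃ t, p t = y} ⊆ {p | ∃ t, p t = y} := fun p hp => hp y hy
    have h1 : a * w y ≤ ∑' j : ℕ, w j :=
      le_trans (mul_le_mul_left (measure_mono hsub) _) (hhit y)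
    have h2 : a * ((∑' j : ℕ, w j + 1) / a) ≤ ∑' j : ℕ, w j := le_trans (by gcongr) h1
    rw [ENNReal.mul_div_cancel hne (measure_ne_top _ _)] at h2
    exact absurd h2 (not_le.2 (ENNReal.lt_add_right hfin one_ne_zero))
  have h1 : ∀ᵐ p ∂(walk ω 0), ¬ ∀ y < 0, ∃ t, p t = y := by
    rw [ae_iff]
    simpa using hzero
  filter_upwards [h1, ae_walk_nearest ω 0, ae_walk_start ω 0] with p hp hn h0
  push Not at hp
  obtain ⟨y, hy, hne⟩ := hp
  refine ⟨y, fun n => ?_⟩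
  by_contra hlt
  obtain ⟨t, -, ht⟩ := exists_eq_of_nearest hn (y := y) (by omega) (n := n) (by omega)
  exact hne t ht

/-- The sum `ρ_1 ξ_1 + ρ_1 ρ_2 ξ_2 + ⋯`. -/
noncomputable def forwardSeries (m : Marks) : ℝ≥0∞ :=
  ∑' k : ℕ, ((m (k + 1)).1 : ℕ) * ∏ i ∈ Finset.range (k + 1), rho (m (i + 1)).2

/-- The resistance is constant on each block. To the right the resistances add up to
`forwardSeries`. To the left they are the inverses of the products in `backSeries`, which tend to
`0`, so they are unbounded. -/
theorem ae_bddBelow {m : Marks} (hf : forwardSeries m ≠ ∞) (hb : backSeries m ≠ ∞) :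
    ∀ᵐ p ∂(walk (sparseEnv m) 0), ∃ c : ℤ, ∀ n, c ≤ p n := by
  obtain ⟨w, hw1, hw⟩ := exists_conductance (sparseEnv m)
  have hblock : ∀ (k : ℤ) (j : ℕ), j < ((m (k + 1)).1 : ℕ) →
      w (S m k + j) = rho (m (k + 1)).2 * w (S m k - 1) := by
    intro k j hj
    induction j with
    | zero => rw [Nat.cast_zero, add_zero, hw, sparseEnv_S]
    | succ j ih =>
      rw [hw, rho_sparseEnv_between m k (j + 1) (by omega) hj, one_mul, ← ih (by omega)]
      congr 1
      push_cast
      ring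
  have hlev : ∀ k, w (S m (k + 1) - 1) = rho (m (k + 1)).2 * w (S m k - 1) := by
    intro k
    rw [S_succ_sub_one, hblock]
    have := (m (k + 1)).1.pos
    omega
  have hfor : ∀ n : ℕ, w (S m n - 1) = ∏ i ∈ Finset.range n, rho (m (i + 1)).2 := by
    intro n
    induction n with
    | zero => simpa [S_zero] using hw1
    | succ n ih => rw [Finset.prod_range_succ, ← ih, Nat.cast_succ, hlev, mul_comm]
  have hback : ∀ n : ℕ, w (S m (-n) - 1) * ∏ i ∈ Finset.range n, rho (m (-i)).2 = 1 := by
    intro n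
    induction n with
    | zero => simpa [S_zero] using hw1
    | succ n ih =>
      rw [← ih, Finset.prod_range_succ]
      have := hlev (-(n + 1 : ℕ))
      rw [show -((n + 1 : ℕ) : ℤ) + 1 = -n by push_cast; ring] at this
      rw [this]
      ring
  have hSn : ∀ n : ℕ, (n : ℤ) ≤ S m n := by
    intro n
    induction n with
    | zero => simp [S_zero]
    | succ n ih =>
      push_cast
      rw [S_succ]
      have := (m (n + 1)).1.pos
      have : ((m (n + 1)).1 : ℤ) = (((m (n + 1)).1 : ℕ) : ℤ) := rfl
      omega
  have hsum : ∀ n : ℕ, ∑ j ∈ Finset.range (S m n).toNat, w j =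
      ∑ k ∈ Finset.range n, ((m (k + 1)).1 : ℕ) *
        ∏ i ∈ Finset.range (k + 1), rho (m (i + 1)).2 := by
    intro n
    induction n with
    | zero => simp [S_zero]
    | succ n ih =>
      have h1 : (S m (n + 1 : ℕ)).toNat = (S m n).toNat + ((m (n + 1)).1 : ℕ) := by
        push_cast
        rw [S_succ]
        have : ((m (n + 1)).1 : ℤ) = (((m (n + 1)).1 : ℕ) : ℤ) := rfl
        have := hSn n
        omega
      rw [h1, Finset.sum_range_add, ih, Finset.sum_range_succ]
      congr 1
      have h2 : ∀ j ∈ Finset.range ((m (n + 1)).1 : ℕ), w (((S m n).toNat + j : ℕ) : ℤ) =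
          ∏ i ∈ Finset.range (n + 1), rho (m (i + 1)).2 := by
        intro j hj
        have := hSn n
        rw [show (((S m n).toNat + j : ℕ) : ℤ) = S m n + j by omega,
          hblock n j (Finset.mem_range.1 hj), hfor, Finset.prod_range_succ, mul_comm]
      rw [Finset.sum_congr rfl h2, Finset.sum_const, Finset.card_range, nsmul_eq_mul]
  refine ae_bddBelow_of_conductance hw ?_ ?_
  · refine ne_top_of_le_ne_top hf (ENNReal.tsum_le_of_sum_range_le fun n => ?_)
    refine le_trans ?_ ((hsum n).trans_le (ENNReal.sum_le_tsum _))
    refine Finset.sum_le_sum_of_subset fun j hj => ?_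
    have := hSn n
    have := Finset.mem_range.1 hj
    exact Finset.mem_range.2 (by omega)
  · intro c hc
    have h1 := tendsto_prod_rho hb
    have h2 : ∀ᶠ n : ℕ in atTop, ∏ i ∈ Finset.range n, rho (m (-i)).2 < (c + 1)⁻¹ :=
      h1.eventually_lt_const (by simp [hc])
    obtain ⟨n, hn⟩ := h2.exists
    refine ⟨S m (-n) - 1, ?_, ?_⟩
    · have := (S_strictMono m).monotone (show -(n : ℤ) ≤ 0 by omega)
      rw [S_zero] at this
      omega
    · rw [ENNReal.eq_inv_of_mul_eq_one_left (hback n)]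
      refine le_trans (le_self_add (b := 1)) ?_
      rw [ENNReal.le_inv_iff_le_inv]
      exact hn.le

/-! ### The sequence of marks -/

section Marks

variable {ν : Measure (ℕ+ × Set.Ioo (0 : ℝ) 1)} [IsProbabilityMeasure ν]

/-- The marks seen from the first marked site to the right of the origin. -/
def mshift (m : Marks) : Marks := fun k => m (k + 1)

theorem measurable_mshift : Measurable mshift :=
  measurable_pi_lambda _ fun k => measurable_pi_apply (k + 1)

theorem measurePreserving_mshift :
    MeasurePreserving mshift (Measure.infinitePi fun _ : ℤ => ν) (Measure.infinitePi fun _ => ν) :=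
  ⟨measurable_mshift, Measure.map_infinitePi_infinitePi_of_inj (P := fun _ : ℤ => ν)
    (f := fun k : ℤ => k + 1) (add_left_injective 1)⟩

theorem iterate_mshift (n : ℕ) (m : Marks) (k : ℤ) : mshift^[n] m k = m (k + n) := by
  induction n generalizing m with
  | zero => simp
  | succ n ih =>
    rw [Function.iterate_succ_apply, ih, mshift]
    congr 1
    push_cast
    ring

/-- The index sequence `b` is arbitrary because the marks are read both to the left (`backSeries`)
and to the right (`forwardSeries`, `S`). -/
theorem ae_tendsto_average_marks {f : ℕ+ × Set.Ioo (0 : ℝ) 1 → ℝ} (hf : Measurable f)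
    (hint : Integrable f ν) {b : ℕ → ℤ} (hb : Function.Injective b) :
    ∀ᵐ m ∂(Measure.infinitePi fun _ : ℤ => ν),
      Tendsto (fun n : ℕ => (∑ i ∈ Finset.range n, f (m (b i))) / n) atTop (𝓝 (∫ x, f x ∂ν)) := by
  have hmp : ∀ k : ℤ, MeasurePreserving (fun m : Marks => m k)
      (Measure.infinitePi fun _ : ℤ => ν) ν :=
    fun k => measurePreserving_eval_infinitePi (fun _ : ℤ => ν) k
  have hind := iIndepFun_infinitePi (P := fun _ : ℤ => ν) (X := fun _ => f) (fun _ => hf)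
  have h := strong_law_ae_real (μ := Measure.infinitePi fun _ : ℤ => ν)
    (fun i m => f (m (b i))) ((hmp (b 0)).integrable_comp_of_integrable hint)
    (fun i j hij => hind.indepFun (hb.ne hij))
    (fun i => ⟨(hf.comp (hmp _).measurable).aemeasurable, (hf.comp (hmp _).measurable).aemeasurable,
      by
        rw [← Function.comp_def f fun m : Marks => m (b i),
          ← Function.comp_def f fun m : Marks => m (b 0), ← Measure.map_map hf (hmp _).measurable,
          ← Measure.map_map hf (hmp _).measurable, (hmp _).map_eq, (hmp _).map_eq]⟩)
  have e : ∫ m : Marks, f (m (b 0)) ∂(Measure.infinitePi fun _ : ℤ => ν) = ∫ x, f x ∂ν := by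
    have := integral_map (μ := Measure.infinitePi fun _ : ℤ => ν)
      (hmp (b 0)).measurable.aemeasurable hf.aestronglyMeasurable
    rw [(hmp _).map_eq] at this
    exact this.symm
  rwa [e] at h

/-- The integral may be `-∞`. Cutting from below makes the function integrable, and by monotone
convergence a low enough cut keeps the integral negative. For `log ρ` this suffices, since only
upper bounds on the products are needed. -/
theorem exists_truncation_integral_neg {α : Type*} [MeasurableSpace α] {μ : Measure α}
    [IsFiniteMeasure μ] {f : α → ℝ} (hf : Measurable f)
    (h : ∫⁻ x, ENNReal.ofReal (f x) ∂μ < ∫⁻ x, ENNReal.ofReal (-f x) ∂μ) :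
    ∃ n : ℕ, Integrable (fun x => max (f x) (-n)) μ ∧ ∫ x, max (f x) (-n) ∂μ < 0 := by
  have hpos : ∀ n : ℕ, ∀ x, ENNReal.ofReal (max (f x) (-n)) = ENNReal.ofReal (f x) := by
    intro n x
    rcases le_total (f x) (-n) with hx | hx
    · have hn : -(n : ℝ) ≤ 0 := by simp
      rw [max_eq_right hx, ENNReal.ofReal_of_nonpos hn, ENNReal.ofReal_of_nonpos (hx.trans hn)]
    · rw [max_eq_left hx]
  have hneg : ∀ n : ℕ, ∀ x, ENNReal.ofReal (-max (f x) (-n)) = min (ENNReal.ofReal (-f x)) n := by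
    intro n x
    rw [← min_neg_neg, neg_neg, ENNReal.ofReal_min, ENNReal.ofReal_natCast]
  have hsup : ∫⁻ x, ENNReal.ofReal (-f x) ∂μ =
      ⨆ n : ℕ, ∫⁻ x, ENNReal.ofReal (-max (f x) (-n)) ∂μ := by
    simp only [hneg]
    rw [← lintegral_iSup]
    · simp only [iSup_min_natCast]
    · exact fun n => hf.neg.ennreal_ofReal.min measurable_const
    · exact fun a b hab x => min_le_min le_rfl (by exact_mod_cast hab)
  rw [hsup, lt_iSup_iff] at h
  obtain ⟨n, hn⟩ := h
  have hm : Measurable fun x => max (f x) (-(n : ℝ)) := hf.max measurable_const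
  have h1 : ∫⁻ x, ENNReal.ofReal (max (f x) (-n)) ∂μ <
      ∫⁻ x, ENNReal.ofReal (-max (f x) (-n)) ∂μ := by
    simpa only [hpos] using hn
  have h2 : ∫⁻ x, ENNReal.ofReal (-max (f x) (-n)) ∂μ ≠ ∞ := by
    simp only [hneg]
    refine ne_top_of_le_ne_top ?_ (lintegral_mono fun x => min_le_right _ _)
    rw [lintegral_const]
    exact ENNReal.mul_ne_top (by simp) (measure_ne_top _ _)
  have hint : Integrable (fun x => max (f x) (-(n : ℝ))) μ := by
    refine ⟨hm.aestronglyMeasurable, ?_⟩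
    rw [hasFiniteIntegral_iff_norm]
    have : ∀ x, ENNReal.ofReal ‖max (f x) (-(n : ℝ))‖ =
        ENNReal.ofReal (max (f x) (-n)) + ENNReal.ofReal (-max (f x) (-n)) := by
      intro x
      rw [Real.norm_eq_abs]
      rcases le_total 0 (max (f x) (-(n : ℝ))) with hx | hx
      · rw [abs_of_nonneg hx, ENNReal.ofReal_of_nonpos (p := -_) (by linarith), add_zero]
      · rw [abs_of_nonpos hx, ENNReal.ofReal_of_nonpos hx, zero_add]
    simp only [this]
    rw [lintegral_add_left hm.ennreal_ofReal]
    exact ENNReal.add_lt_top.2 ⟨h1.trans_le le_top, h2.lt_top⟩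
  refine ⟨n, hint, ?_⟩
  rw [integral_eq_lintegral_pos_part_sub_lintegral_neg_part hint, sub_neg]
  exact (ENNReal.toReal_lt_toReal (h1.trans_le le_top).ne h2).2 h1

/-- By the law of large numbers for the truncated logarithms, with mean `c < 0`, the product is
eventually at most `exp (c / 2) ^ j`. The factor `ξ` is at most `(L + 1) (j + 1)`, being one summand
of a sum that grows at rate `L = E ξ`. -/
theorem ae_series_ne_top
    (hlog : ∫⁻ x, ENNReal.ofReal (Real.log ((1 - (x.2 : ℝ)) / x.2)) ∂ν <
      ∫⁻ x, ENNReal.ofReal (-Real.log ((1 - (x.2 : ℝ)) / x.2)) ∂ν)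
    (hξ : Integrable (fun x => ((x.1 : ℕ) : ℝ)) ν) {a b : ℕ → ℤ} (ha : Function.Injective a)
    (hb : Function.Injective b) :
    ∀ᵐ m ∂(Measure.infinitePi fun _ : ℤ => ν),
      ∑' j : ℕ, (((m (a j)).1 : ℕ) : ℝ≥0∞) * ∏ i ∈ Finset.range j, rho (m (b i)).2 ≠ ∞ := by
  have hml' : Measurable fun x : ℕ+ × Set.Ioo (0 : ℝ) 1 => (x.2 : ℝ) :=
    measurable_subtype_coe.comp measurable_snd
  have hml : Measurable fun x : ℕ+ × Set.Ioo (0 : ℝ) 1 => Real.log ((1 - (x.2 : ℝ)) / x.2) :=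
    Real.measurable_log.comp ((measurable_const.sub hml').div hml')
  have hmξ : Measurable fun x : ℕ+ × Set.Ioo (0 : ℝ) 1 => ((x.1 : ℕ) : ℝ) :=
    (Measurable.of_discrete (f := fun x : ℕ+ => ((x : ℕ) : ℝ))).comp measurable_fst
  obtain ⟨N, hint, hneg⟩ := exists_truncation_integral_neg hml hlog
  set c := ∫ x, max (Real.log ((1 - (x.2 : ℝ)) / x.2)) (-(N : ℝ)) ∂ν
  set L := ∫ x, ((x.1 : ℕ) : ℝ) ∂ν
  filter_upwards [ae_tendsto_average_marks (hml.max measurable_const) hint hb,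
    ae_tendsto_average_marks hmξ hξ ha] with m h1 h2
  set t : ℕ → ℝ := fun j => ((m (a j)).1 : ℕ) * ∏ i ∈ Finset.range j,
    ((1 - ((m (b i)).2 : ℝ)) / (m (b i)).2) with ht
  have hρ : ∀ i, 0 < (1 - ((m (b i)).2 : ℝ)) / (m (b i)).2 := fun i => by
    have := (m (b i)).2.2
    exact div_pos (by linarith [this.2]) this.1
  have ht0 : ∀ j, 0 ≤ t j := fun j =>
    mul_nonneg (Nat.cast_nonneg _) (Finset.prod_nonneg fun i _ => (hρ i).le)
  have e : ∀ j, (((m (a j)).1 : ℕ) : ℝ≥0∞) * ∏ i ∈ Finset.range j, rho (m (b i)).2 =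
      ENNReal.ofReal (t j) := by
    intro j
    rw [ht, ENNReal.ofReal_mul (Nat.cast_nonneg _), ENNReal.ofReal_natCast,
      ENNReal.ofReal_prod_of_nonneg fun i _ => (hρ i).le]
    rfl
  simp only [e]
  have hsum : Summable fun j : ℕ => (L + 1) * ((j + 1) * Real.exp (c / 2) ^ j) := by
    refine Summable.mul_left _ ?_
    have hlt : ‖Real.exp (c / 2)‖ < 1 := by
      rw [Real.norm_of_nonneg (Real.exp_pos _).le, Real.exp_lt_one_iff]
      linarith
    have s1 := summable_pow_mul_geometric_of_norm_lt_one 1 hlt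
    have s0 := summable_geometric_of_norm_lt_one hlt
    refine (s1.add s0).congr fun j => ?_
    ring
  have hev : ∀ᶠ j in atTop, ‖t j‖ ≤ (L + 1) * ((j + 1) * Real.exp (c / 2) ^ j) := by
    have e1 := h1.eventually_lt_const (show c < c / 2 by linarith)
    have e2 := ((tendsto_add_atTop_iff_nat 1).2 h2).eventually_lt_const (show L < L + 1 by linarith)
    filter_upwards [e1, e2, eventually_gt_atTop 0] with j he1 he2 hj
    have hj' : (0 : ℝ) < j := by exact_mod_cast hj
    rw [div_lt_iff₀ hj'] at he1
    rw [div_lt_iff₀ (by positivity)] at he2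
    rw [Real.norm_of_nonneg (ht0 j), ht]
    have hξj : (((m (a j)).1 : ℕ) : ℝ) ≤ (L + 1) * (j + 1) := by
      refine le_trans ?_ (he2.le.trans (by push_cast; rfl))
      exact Finset.single_le_sum (f := fun i => (((m (a i)).1 : ℕ) : ℝ))
        (fun i _ => Nat.cast_nonneg _) (Finset.mem_range.2 (Nat.lt_succ_self j))
    have hprod : ∏ i ∈ Finset.range j, ((1 - ((m (b i)).2 : ℝ)) / (m (b i)).2) ≤
        Real.exp (c / 2) ^ j := by
      rw [← Real.exp_nat_mul, mul_comm]
      refine le_trans ?_ (Real.exp_le_exp.2 he1.le)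
      rw [Real.exp_sum]
      refine Finset.prod_le_prod (fun i _ => (hρ i).le) fun i _ => ?_
      conv_lhs => rw [← Real.exp_log (hρ i)]
      exact Real.exp_le_exp.2 (le_max_left _ _)
    calc _ ≤ ((L + 1) * (j + 1)) * Real.exp (c / 2) ^ j := by
          refine mul_le_mul hξj hprod (Finset.prod_nonneg fun i _ => (hρ i).le) ?_
          exact (Nat.cast_nonneg _).trans hξj
      _ = _ := by ring
  exact (Summable.of_norm_bounded_eventually_nat hsum hev).tsum_ofReal_ne_top

theorem ae_backSeries_ne_top
    (hlog : ∫⁻ x, ENNReal.ofReal (Real.log ((1 - (x.2 : ℝ)) / x.2)) ∂ν <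
      ∫⁻ x, ENNReal.ofReal (-Real.log ((1 - (x.2 : ℝ)) / x.2)) ∂ν)
    (hξ : Integrable (fun x => ((x.1 : ℕ) : ℝ)) ν) :
    ∀ᵐ m ∂(Measure.infinitePi fun _ : ℤ => ν), backSeries m ≠ ∞ := by
  have hinj : Function.Injective fun j : ℕ => -(j : ℤ) := fun i j h => by simpa using h
  filter_upwards [ae_series_ne_top hlog hξ hinj hinj] with m hm
  have : backSeries m = 2 * ∑' j : ℕ, (((m (-j)).1 : ℕ) : ℝ≥0∞) *
      ∏ i ∈ Finset.range j, rho (m (-i)).2 := by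
    rw [← ENNReal.tsum_mul_left]
    exact tsum_congr fun j => mul_assoc _ _ _
  rw [this]
  exact ENNReal.mul_ne_top (by simp) hm

theorem ae_forwardSeries_ne_top
    (hlog : ∫⁻ x, ENNReal.ofReal (Real.log ((1 - (x.2 : ℝ)) / x.2)) ∂ν <
      ∫⁻ x, ENNReal.ofReal (-Real.log ((1 - (x.2 : ℝ)) / x.2)) ∂ν)
    (hξ : Integrable (fun x => ((x.1 : ℕ) : ℝ)) ν) :
    ∀ᵐ m ∂(Measure.infinitePi fun _ : ℤ => ν), forwardSeries m ≠ ∞ := by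
  -- With these indices the term `j = 0` is `ξ_0`, and the remaining terms are those of
  -- `forwardSeries`.
  filter_upwards [ae_series_ne_top hlog hξ (a := fun j => (j : ℤ)) (b := fun i => (i : ℤ) + 1)
    (fun i j h => by simpa using h) (fun i j h => by simpa using h)] with m hm
  rw [tsum_eq_zero_add' ENNReal.summable] at hm
  have := (ENNReal.add_ne_top.1 hm).2
  simpa [forwardSeries] using this

end Marks

/-! ### The shift to the first passage of the next marked site -/

theorem S_mshift (m : Marks) (k : ℤ) : S (mshift m) k = S m (k + 1) - S m 1 := by
  induction k using Int.induction_on with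
  | zero => simp [S_zero]
  | succ k ih =>
    rw [S_succ, ih, S_succ m (k + 1)]
    simp only [mshift]
    ring
  | pred k ih =>
    have h1 := S_succ (mshift m) (-k - 1)
    have h2 := S_succ m (-k - 1 + 1)
    simp only [mshift] at h1
    rw [sub_add_cancel] at h1 h2
    rw [sub_add_cancel]
    linarith

/-- `S_1` is itself a marked site, so the environment seen from it is again a sparse environment
whose origin is marked. -/
theorem sparseEnv_mshift (m : Marks) (n : ℤ) :
    sparseEnv (mshift m) n = sparseEnv m (n + S m 1) := by
  by_cases h : ∃ k, S (mshift m) k = n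
  · obtain ⟨k, rfl⟩ := h
    rw [sparseEnv_S, S_mshift, sub_add_cancel, sparseEnv_S]
    rfl
  · rw [sparseEnv, dif_neg h, sparseEnv, dif_neg]
    rintro ⟨k, hk⟩
    exact h ⟨k - 1, by rw [S_mshift, sub_add_cancel]; omega⟩

theorem S_one_pos (m : Marks) : 0 < S m 1 := by
  rw [S_one]
  exact_mod_cast (m 1).1.pos

/-- The trajectory after the passage time of `S_1`, seen from `S_1`. -/
noncomputable def pathShift (m : Marks) (x : Path) : Path :=
  -- The floor only converts the passage time to a natural number. It is `0` where the passage time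
  -- is infinite, a null event under `Passes`.
  ptrans (-S m 1) (pdrop ⌊(T x (S m 1)).toReal⌋₊ x)

/-- The environment and the trajectory seen from `S_1` at its passage time. -/
noncomputable def passShift (q : Marks × Path) : Marks × Path := (mshift q.1, pathShift q.1 q.2)

/-- The passage time of `S_1`. -/
noncomputable def passTime (q : Marks × Path) : ℝ≥0∞ := T q.2 (S q.1 1)

theorem measurable_passTime : Measurable passTime :=
  measurable_T_uncurry.comp (measurable_snd.prodMk ((measurable_S 1).comp measurable_fst))

theorem measurable_passShift : Measurable passShift := by
  refine (measurable_mshift.comp measurable_fst).prodMk (measurable_pi_lambda _ fun n => ?_)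
  have h1 : Measurable fun z : Path × ℕ => z.1 (z.2 + n) :=
    measurable_from_prod_countable_left fun t => measurable_pi_apply (t + n)
  have h2 : Measurable fun q : Marks × Path => q.2 (⌊(passTime q).toReal⌋₊ + n) :=
    h1.comp (measurable_snd.prodMk
      (Nat.measurable_floor.comp measurable_passTime.ennreal_toReal))
  exact h2.add ((measurable_S 1).comp measurable_fst).neg

theorem measurable_pathShift (m : Marks) : Measurable (pathShift m) :=
  measurable_snd.comp (measurable_passShift.comp measurable_prodMk_left)

theorem pathShift_of_mem_hits {m : Marks} {t : ℕ} {x : Path} (h : x ∈ hits (S m 1) t) :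
    pathShift m x = ptrans (-S m 1) (pdrop t x) := by
  rw [pathShift, T_of_mem_hits h]
  simp

theorem measure_eq_tsum_hits {ω : Env} {x y : ℤ} (h : ∀ᵐ p ∂(walk ω x), T p y ≠ ∞)
    {A : Set Path} (hA : MeasurableSet A) : walk ω x A = ∑' t, walk ω x (hits y t ∩ A) := by
  rw [← measure_iUnion]
  · refine measure_congr ?_
    filter_upwards [h] with p hp
    obtain ⟨t, ht⟩ := exists_T_eq_natCast hp
    refine propext ⟨fun hpA => ?_, fun hpA => ?_⟩
    · exact Set.mem_iUnion.2 ⟨t, T_eq_natCast.1 ht, hpA⟩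
    · obtain ⟨s, -, hs⟩ := Set.mem_iUnion.1 hpA
      exact hs
  · intro s t hst
    refine Set.disjoint_left.2 fun p hs ht => hst ?_
    have := T_of_mem_hits hs.1
    rw [T_of_mem_hits ht.1] at this
    exact_mod_cast this.symm
  · exact fun t => (measurableSet_hits y t).inter hA

/-- The passage time of `S_1` is independent of the trajectory after it, which is a walk in the
shifted environment. -/
theorem walk_passTime_inter_pathShift {m : Marks}
    (h : ∀ᵐ p ∂(walk (sparseEnv m) 0), T p (S m 1) ≠ ∞) {D : Set ℝ≥0∞} (hD : MeasurableSet D)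
    {B : Set Path} (hB : MeasurableSet B) :
    walk (sparseEnv m) 0 ({x | T x (S m 1) ∈ D} ∩ pathShift m ⁻¹' B) =
      walk (sparseEnv m) 0 {x | T x (S m 1) ∈ D} * walk (sparseEnv (mshift m)) 0 B := by
  have hmD : MeasurableSet {x : Path | T x (S m 1) ∈ D} := measurable_T _ hD
  rw [measure_eq_tsum_hits h (hmD.inter (measurable_pathShift m hB)), measure_eq_tsum_hits h hmD,
    ← ENNReal.tsum_mul_right]
  refine tsum_congr fun t => ?_
  by_cases ht : (t : ℝ≥0∞) ∈ D
  · have e1 : hits (S m 1) t ∩ {x | T x (S m 1) ∈ D} = hits (S m 1) t := by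
      refine Set.inter_eq_left.2 fun x hx => ?_
      change T x _ ∈ D
      rwa [T_of_mem_hits hx]
    have hB' := measurable_ptrans (-S m 1) hB
    have e2 : hits (S m 1) t ∩ ({x | T x (S m 1) ∈ D} ∩ pathShift m ⁻¹' B) =
        hits (S m 1) t ∩ pdrop t ⁻¹' (ptrans (-S m 1) ⁻¹' B) := by
      rw [← Set.inter_assoc, e1]
      ext x
      refine and_congr_right fun hx => ?_
      simp only [Set.mem_preimage, pathShift_of_mem_hits hx]
    have e3 : walk (sparseEnv m) (S m 1) (ptrans (-S m 1) ⁻¹' B) =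
        walk (sparseEnv (mshift m)) 0 B := by
      have := walk_map_ptrans (sparseEnv m) 0 (S m 1)
      simp only [← sparseEnv_mshift, zero_add] at this
      rw [← this, Measure.map_apply (measurable_ptrans _) hB']
      congr 1
      ext x
      have : ptrans (-S m 1) (ptrans (S m 1) x) = x := by ext n; simp [ptrans]
      simp [this]
    rw [e1, e2, walk_hits_inter _ _ _ _ hB', e3]
  · have e1 : hits (S m 1) t ∩ {x | T x (S m 1) ∈ D} = ∅ := by
      rw [Set.eq_empty_iff_forall_notMem]
      rintro x ⟨hx, hx'⟩
      change T x _ ∈ D at hx'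
      rw [T_of_mem_hits hx] at hx'
      exact ht hx'
    rw [← Set.inter_assoc, e1]
    simp

theorem walk_pathShift {m : Marks} (h : ∀ᵐ p ∂(walk (sparseEnv m) 0), T p (S m 1) ≠ ∞)
    {B : Set Path} (hB : MeasurableSet B) :
    walk (sparseEnv m) 0 (pathShift m ⁻¹' B) = walk (sparseEnv (mshift m)) 0 B := by
  have := walk_passTime_inter_pathShift h MeasurableSet.univ hB
  have e : {x | T x (S m 1) ∈ Set.univ} = Set.univ := by ext; simp
  rwa [e, Set.univ_inter, measure_univ, one_mul] at this

theorem quenchedKernel_comap_apply (m : Marks) :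
    quenchedKernel.comap sparseEnv measurable_sparseEnv m = walk (sparseEnv m) 0 := rfl

section Annealed

variable {ν : Measure (ℕ+ × Set.Ioo (0 : ℝ) 1)} [IsProbabilityMeasure ν]

instance : IsProbabilityMeasure (annealed ν) := by unfold annealed; infer_instance

theorem annealed_apply {C : Set (Marks × Path)} (hC : MeasurableSet C) : annealed ν C =
    ∫⁻ m, walk (sparseEnv m) 0 (Prod.mk m ⁻¹' C) ∂(Measure.infinitePi fun _ : ℤ => ν) :=
  Measure.compProd_apply hC

theorem measurable_walk_section {C : Set (Marks × Path)} (hC : MeasurableSet C) :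
    Measurable fun m => walk (sparseEnv m) 0 (Prod.mk m ⁻¹' C) := by
  have := Kernel.measurable_kernel_prodMk_left
    (κ := quenchedKernel.comap sparseEnv measurable_sparseEnv) hC
  simpa only [quenchedKernel_comap_apply] using this

theorem lintegral_annealed {f : Marks × Path → ℝ≥0∞} (hf : Measurable f) :
    ∫⁻ q, f q ∂(annealed ν) =
      ∫⁻ m, ∫⁻ x, f (m, x) ∂(walk (sparseEnv m) 0) ∂(Measure.infinitePi fun _ : ℤ => ν) :=
  Measure.lintegral_compProd hf

theorem ae_annealed_of_ae {Q : Marks × Path → Prop} (hQ : MeasurableSet {q | Q q})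
    (h : ∀ᵐ m ∂(Measure.infinitePi fun _ : ℤ => ν), ∀ᵐ x ∂(walk (sparseEnv m) 0), Q (m, x)) :
    ∀ᵐ q ∂(annealed ν), Q q :=
  (Measure.ae_compProd_iff hQ).2 h

/-- For almost every sequence of marks, all walks reach the next marked site. -/
def Passes (ν : Measure (ℕ+ × Set.Ioo (0 : ℝ) 1)) : Prop :=
  ∀ᵐ m ∂(Measure.infinitePi fun _ : ℤ => ν),
    ∀ᵐ p ∂(walk (sparseEnv m) 0), T p (S m 1) ≠ ∞

/-- Given the marks, the strong Markov property turns the shifted trajectory into a walk in the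
environment of `mshift m`; then the stationarity of the marks applies. -/
theorem measurePreserving_passShift (h : Passes ν) :
    MeasurePreserving passShift (annealed ν) (annealed ν) := by
  refine ⟨measurable_passShift, Measure.ext fun C hC => ?_⟩
  have h1 := (measurePreserving_mshift (ν := ν)).lintegral_comp (measurable_walk_section hC)
  rw [Measure.map_apply measurable_passShift hC, annealed_apply (measurable_passShift hC),
    annealed_apply hC, ← h1]
  refine lintegral_congr_ae ?_
  filter_upwards [h] with m hm
  have e : Prod.mk m ⁻¹' (passShift ⁻¹' C) = pathShift m ⁻¹' (Prod.mk (mshift m) ⁻¹' C) := rfl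
  rw [e, walk_pathShift hm (measurable_prodMk_left hC)]

theorem ae_walk_iterate_passShift (h : Passes ν) {C : Set (Marks × Path)} (hC : MeasurableSet C)
    (n : ℕ) : ∀ᵐ m ∂(Measure.infinitePi fun _ : ℤ => ν),
      walk (sparseEnv m) 0 (Prod.mk m ⁻¹' (passShift^[n] ⁻¹' C)) =
        walk (sparseEnv (mshift^[n] m)) 0 (Prod.mk (mshift^[n] m) ⁻¹' C) := by
  induction n with
  | zero => exact ae_of_all _ fun m => rfl
  | succ n ih =>
    filter_upwards [h, measurePreserving_mshift.quasiMeasurePreserving.ae ih] with m hm hm'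
    rw [Function.iterate_succ_apply, ← hm', ← walk_pathShift hm
      (measurable_prodMk_left (measurable_passShift.iterate n hC)), Function.iterate_succ]
    rfl

/-- Under the annealed law the passage time of `S_1` and the passage time after the `d`-th shift
are independent given the marks. -/
theorem annealed_inter_iterate (h : Passes ν) {D D' : Set ℝ≥0∞} (hD : MeasurableSet D)
    (hD' : MeasurableSet D') (d : ℕ) :
    annealed ν (passTime ⁻¹' D ∩ (passTime ∘ passShift^[d + 1]) ⁻¹' D') =
      ∫⁻ m, walk (sparseEnv m) 0 {x | T x (S m 1) ∈ D} *
        walk (sparseEnv (mshift^[d + 1] m)) 0 {x | T x (S (mshift^[d + 1] m) 1) ∈ D'}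
        ∂(Measure.infinitePi fun _ : ℤ => ν) := by
  have hC := measurable_passTime hD'
  have hC' := measurable_passShift.iterate d hC
  rw [annealed_apply ((measurable_passTime hD).inter
    ((measurable_passTime.comp (measurable_passShift.iterate (d + 1))) hD'))]
  refine lintegral_congr_ae ?_
  filter_upwards [h, measurePreserving_mshift.quasiMeasurePreserving.ae
    (ae_walk_iterate_passShift h hC d)] with m hm hm'
  rw [← Function.iterate_succ_apply] at hm'
  have := walk_passTime_inter_pathShift hm hD
    (measurable_prodMk_left (x := mshift m) hC')
  rw [hm'] at this
  exact this

end Annealed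

/-! ### Passage times of the marked sites as sums -/

/-- A nearest-neighbour path from below `y` must pass `y` before it reaches `z`. The crossing lemma
for downward passages is applied to the reflected path. -/
theorem T_add_of_nearest {p : Path} (hp : ∀ n, p (n + 1) = p n + 1 ∨ p (n + 1) = p n - 1)
    {y z : ℤ} (h0 : p 0 ≤ y) (hyz : y ≤ z) {t : ℕ} (ht : p ∈ hits y t) :
    T p z = t + T (pdrop t p) z := by
  have hle : ∀ s, p s = z → t ≤ s := by
    intro s hs
    have hneg : ∀ n, -p (n + 1) = -p n + 1 ∨ -p (n + 1) = -p n - 1 := fun n => by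
      have := hp n
      omega
    obtain ⟨r, hr, hpr⟩ := exists_eq_of_nearest (p := fun n => -p n) hneg (y := -y) (by omega)
      (n := s) (by omega)
    by_contra hlt
    exact ht.2 r (by omega) (by omega)
  by_cases h : T (pdrop t p) z = ∞
  · rw [h, add_top, T_eq_top]
    rw [T_eq_top] at h
    intro s hs
    refine h (s - t) ?_
    rw [pdrop, Nat.add_sub_cancel' (hle s hs), hs]
  · obtain ⟨r, hr⟩ := exists_T_eq_natCast h
    rw [hr]
    have hr' := T_eq_natCast.1 hr
    have : p ∈ hits z (t + r) := by
      refine ⟨hr'.1, fun s hs hz => ?_⟩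
      have := hle s hz
      refine hr'.2 (s - t) (by omega) ?_
      rw [pdrop, Nat.add_sub_cancel' this, hz]
    rw [T_of_mem_hits this]
    push_cast
    rfl

theorem T_ptrans (p : Path) (y z : ℤ) : T (ptrans y p) (z + y) = T p z := by
  simp only [T, ptrans, add_left_inj]

/-- A pathwise identity, obtained by peeling off the first block and applying the induction
hypothesis to `passShift q`. -/
theorem T_S_eq_sum {q : Marks × Path} (h0 : q.2 0 = 0)
    (hn : ∀ n, q.2 (n + 1) = q.2 n + 1 ∨ q.2 (n + 1) = q.2 n - 1)
    (hT : ∀ j, passTime (passShift^[j] q) ≠ ∞) (k : ℕ) :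
    T q.2 (S q.1 k) = ∑ j ∈ Finset.range k, passTime (passShift^[j] q) := by
  induction k generalizing q with
  | zero => simp [S_zero, T_eq_zero h0]
  | succ k ih =>
    obtain ⟨t, ht⟩ := exists_T_eq_natCast (hT 0)
    have ht' := T_eq_natCast.1 ht
    have hs : (passShift q).2 = ptrans (-S q.1 1) (pdrop t q.2) := pathShift_of_mem_hits ht'
    have h1 : (passShift q).2 0 = 0 := by
      rw [hs]
      have := ht'.1
      change q.2 (t + 0) + -S q.1 1 = 0
      rw [add_zero]
      simp only [Function.iterate_zero, id] at this
      omega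
    have h2 : ∀ n, (passShift q).2 (n + 1) = (passShift q).2 n + 1 ∨
        (passShift q).2 (n + 1) = (passShift q).2 n - 1 := by
      intro n
      rw [hs]
      have := hn (t + n)
      simp only [ptrans, pdrop]
      rw [← add_assoc]
      omega
    have h3 := ih h1 h2 fun j => by
      rw [← Function.iterate_succ_apply]
      exact hT (j + 1)
    rw [Finset.sum_range_succ', Function.iterate_zero, id]
    simp only [← Function.iterate_succ_apply] at h3
    rw [← h3, add_comm _ (passTime q)]
    have hS : S (passShift q).1 k = S q.1 (k + 1 : ℕ) + -S q.1 1 := by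
      change S (mshift q.1) k = _
      rw [S_mshift]
      push_cast
      ring
    rw [hS, hs, T_ptrans]
    have hpt : passTime q = t := ht
    rw [hpt]
    refine T_add_of_nearest hn ?_ ?_ ht'
    · rw [h0]
      exact (S_one_pos q.1).le
    · exact (S_strictMono q.1).monotone (by push_cast; omega)

/-! ### The law of large numbers for truncated passage times -/

theorem min_T_congr {p q : Path} {K : ℕ} (h : ∀ i ≤ K, p i = q i) (y : ℤ) :
    min (T p y) K = min (T q y) K := by
  have key : ∀ p q : Path, (∀ i ≤ K, p i = q i) → min (T q y) (K : ℝ≥0∞) ≤ min (T p y) K := by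
    intro p q h
    refine le_min (le_iInf₂ fun k hk => ?_) (min_le_right _ _)
    by_cases hkK : k ≤ K
    · exact (min_le_left _ _).trans (iInf₂_le k ((h k hkK).symm.trans hk))
    · exact (min_le_right _ _).trans (by exact_mod_cast (by omega : K ≤ k))
  exact le_antisymm (key q p fun i hi => (h i hi).symm) (key p q h)

theorem S_congr {m m' : Marks} {K : ℤ} (h : ∀ k, |k| ≤ K → m k = m' k) {k : ℤ} (hk : |k| ≤ K) :
    S m k = S m' k := by
  rw [abs_le] at hk
  have hsum : ∀ s : Finset ℤ, (∀ j ∈ s, |j| ≤ K) →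
      ∑ j ∈ s, ((m j).1 : ℤ) = ∑ j ∈ s, ((m' j).1 : ℤ) :=
    fun s hs => Finset.sum_congr rfl fun j hj => by rw [h j (hs j hj)]
  unfold S
  split_ifs with h0
  · refine hsum _ fun j hj => ?_
    rw [Finset.mem_Icc] at hj
    rw [abs_le]
    omega
  · rw [hsum _ fun j hj => ?_]
    rw [Finset.mem_Icc] at hj
    rw [abs_le]
    omega

theorem abs_le_abs_S (m : Marks) (k : ℤ) : |k| ≤ |S m k| := by
  induction k using Int.induction_on with
  | zero => simp
  | succ k ih =>
    have h0 := (S_strictMono m).monotone (show (0 : ℤ) ≤ k by omega)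
    have h1 := S_strictMono m (show (k : ℤ) < k + 1 by omega)
    rw [S_zero] at h0
    rw [abs_of_nonneg (by omega), abs_of_nonneg h0] at ih
    rw [abs_of_nonneg (by omega), abs_of_nonneg (by omega)]
    omega
  | pred k ih =>
    have h0 := (S_strictMono m).monotone (show -(k : ℤ) ≤ 0 by omega)
    have h1 := S_strictMono m (show -(k : ℤ) - 1 < -k by omega)
    rw [S_zero] at h0
    rw [abs_of_nonpos (by omega), abs_of_nonpos h0] at ih
    rw [abs_of_nonpos (by omega), abs_of_nonpos (by omega)]
    omega

/-- Since `ξ ≥ 1`, only the `S_k` with `|k| ≤ K` can lie in `[-K, K]`. The value at `S_k` is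
`λ_{k+1}`, whence the window `K + 1`. -/
theorem sparseEnv_congr {m m' : Marks} {K : ℤ} (h : ∀ k, |k| ≤ K + 1 → m k = m' k) {n : ℤ}
    (hn : |n| ≤ K) : sparseEnv m n = sparseEnv m' n := by
  have hk : ∀ (m : Marks) k, S m k = n → |k| ≤ K := fun m k hk =>
    (abs_le_abs_S m k).trans (by rw [hk]; exact hn)
  by_cases hex : ∃ k, S m k = n
  · obtain ⟨k, hkn⟩ := hex
    have hkK := hk m k hkn
    have h1 : S m' k = n := by rw [← S_congr h (by omega), hkn]
    rw [← hkn, sparseEnv_S, hkn, ← h1, sparseEnv_S, h]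
    rw [abs_le] at hkK ⊢
    omega
  · rw [sparseEnv, dif_neg hex, sparseEnv, dif_neg]
    rintro ⟨k, hkn⟩
    refine hex ⟨k, ?_⟩
    have hkK := hk m' k hkn
    rw [S_congr h (by omega), hkn]

/-- Truncation at `K` makes the event depend on the first `K` steps only, and these stay within
distance `K` of the origin. -/
theorem walk_min_T_congr {m m' : Marks} {K : ℕ} (h : ∀ k : ℤ, |k| ≤ K + 1 → m k = m' k)
    {A : Set ℝ≥0∞} (hA : MeasurableSet A) :
    walk (sparseEnv m) 0 {x | T x (S m 1) ∈ {a : ℝ≥0∞ | min a K ∈ A}} =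
      walk (sparseEnv m') 0 {x | T x (S m' 1) ∈ {a : ℝ≥0∞ | min a K ∈ A}} := by
  rw [S_congr h (k := 1) (by simp)]
  refine walk_congr (n := K) (fun y hy => sparseEnv_congr h (by simpa using hy)) ?_ ?_
  · exact ((measurable_T _).min measurable_const) hA
  · intro p q hpq
    simp only [Set.mem_ofPred_eq, min_T_congr hpq]

section Annealed

variable {ν : Measure (ℕ+ × Set.Ioo (0 : ℝ) 1)} [IsProbabilityMeasure ν]

theorem exists_eq_comp_restrict {f : Marks → ℝ≥0∞} (hf : Measurable f) {I : Finset ℤ}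
    (hI : ∀ m m' : Marks, (∀ k ∈ I, m k = m' k) → f m = f m') :
    ∃ F : (I → ℕ+ × Set.Ioo (0 : ℝ) 1) → ℝ≥0∞, Measurable F ∧
      ∀ m : Marks, f m = F (fun i => m i) := by
  classical
  -- The mark `(1, half)` put outside `I` is arbitrary, as `f` does not look there.
  refine ⟨fun z => f fun k => if hk : k ∈ I then z ⟨k, hk⟩ else (1, half), ?_, ?_⟩
  · refine hf.comp (measurable_pi_lambda _ fun k => ?_)
    by_cases hk : k ∈ I
    · simp only [hk, dif_pos]
      exact measurable_pi_apply _
    · simp only [hk]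
      exact measurable_const
  · exact fun m => hI _ _ fun k hk => by simp [hk]

theorem lintegral_mul_of_disjoint {f g : Marks → ℝ≥0∞} (hf : Measurable f) (hg : Measurable g)
    {I J : Finset ℤ} (hIJ : Disjoint I J)
    (hI : ∀ m m' : Marks, (∀ k ∈ I, m k = m' k) → f m = f m')
    (hJ : ∀ m m' : Marks, (∀ k ∈ J, m k = m' k) → g m = g m') :
    ∫⁻ m, f m * g m ∂(Measure.infinitePi fun _ : ℤ => ν) =
      (∫⁻ m, f m ∂(Measure.infinitePi fun _ : ℤ => ν)) *
        ∫⁻ m, g m ∂(Measure.infinitePi fun _ : ℤ => ν) := by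
  obtain ⟨F, hF, hfF⟩ := exists_eq_comp_restrict hf hI
  obtain ⟨G, hG, hgG⟩ := exists_eq_comp_restrict hg hJ
  have hind := iIndepFun_infinitePi (P := fun _ : ℤ => ν) (X := fun _ x => x)
    (fun _ => measurable_id)
  have h1 := (hind.indepFun_finset I J hIJ fun k => measurable_pi_apply k).comp hF hG
  have e1 : f = F ∘ fun (m : Marks) (i : I) => m i := funext hfF
  have e2 : g = G ∘ fun (m : Marks) (i : J) => m i := funext hgG
  rw [← e1, ← e2] at h1
  exact lintegral_mul_eq_lintegral_mul_lintegral_of_indepFun hf hg h1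

/-- The quenched probability that the passage time of `S_1` belongs to `D`. -/
noncomputable def passProb (D : Set ℝ≥0∞) (m : Marks) : ℝ≥0∞ :=
  walk (sparseEnv m) 0 (Prod.mk m ⁻¹' (passTime ⁻¹' D))

theorem measurable_passProb {D : Set ℝ≥0∞} (hD : MeasurableSet D) : Measurable (passProb D) :=
  measurable_walk_section (measurable_passTime hD)

theorem annealed_passTime {D : Set ℝ≥0∞} (hD : MeasurableSet D) : annealed ν (passTime ⁻¹' D) =
    ∫⁻ m, passProb D m ∂(Measure.infinitePi fun _ : ℤ => ν) :=
  annealed_apply (measurable_passTime hD)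

/-- Given the marks, the two events are independent, so the probability of the intersection is the
mean of a product of quenched probabilities. These depend on the marks in windows of radius `K + 1`
around `0` and `d`, which are disjoint exactly when `d > 2K + 2`. -/
theorem annealed_inter_of_window (h : Passes ν) {D D' : Set ℝ≥0∞} (hD : MeasurableSet D)
    (hD' : MeasurableSet D') {K d : ℕ} (hd : 2 * K + 2 < d)
    (hw : ∀ m m' : Marks, (∀ k : ℤ, |k| ≤ K + 1 → m k = m' k) → passProb D m = passProb D m')
    (hw' : ∀ m m' : Marks, (∀ k : ℤ, |k| ≤ K + 1 → m k = m' k) → passProb D' m = passProb D' m') :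
    annealed ν (passTime ⁻¹' D ∩ (passTime ∘ passShift^[d]) ⁻¹' D') =
      annealed ν (passTime ⁻¹' D) * annealed ν (passTime ⁻¹' D') := by
  obtain ⟨d, rfl⟩ : ∃ e, d = e + 1 := ⟨d - 1, by omega⟩
  have h1 : annealed ν (passTime ⁻¹' D ∩ (passTime ∘ passShift^[d + 1]) ⁻¹' D') =
      ∫⁻ m, passProb D m * passProb D' (mshift^[d + 1] m) ∂(Measure.infinitePi fun _ : ℤ => ν) :=
    annealed_inter_iterate h hD hD' d
  have h2 := ((measurePreserving_mshift (ν := ν)).iterate (d + 1)).lintegral_comp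
    (measurable_passProb hD')
  rw [h1, annealed_passTime hD, annealed_passTime hD', ← h2]
  refine lintegral_mul_of_disjoint (measurable_passProb hD)
    ((measurable_passProb hD').comp (measurable_mshift.iterate (d + 1)))
    (I := Finset.Icc (-(K + 1 : ℤ)) (K + 1))
    (J := Finset.Icc (d + 1 - (K + 1 : ℤ)) (d + 1 + (K + 1))) ?_ ?_ ?_
  · rw [Finset.disjoint_left]
    intro k hk hk'
    rw [Finset.mem_Icc] at hk hk'
    omega
  · intro m m' hmm
    exact hw _ _ fun k hk => hmm k (by rw [abs_le] at hk; rw [Finset.mem_Icc]; omega)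
  · intro m m' hmm
    refine hw' _ _ fun k hk => ?_
    rw [iterate_mshift, iterate_mshift]
    exact hmm _ (by rw [abs_le] at hk; rw [Finset.mem_Icc]; push_cast; omega)

theorem annealed_inter_min (h : Passes ν) {A A' : Set ℝ≥0∞} (hA : MeasurableSet A)
    (hB : MeasurableSet A') {K d : ℕ} (hd : 2 * K + 2 < d) :
    annealed ν ({q | min (passTime q) K ∈ A} ∩ {q | min (passTime (passShift^[d] q)) K ∈ A'}) =
      annealed ν {q | min (passTime q) K ∈ A} * annealed ν {q | min (passTime q) K ∈ A'} :=
  annealed_inter_of_window h ((measurable_id.min measurable_const) hA)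
    ((measurable_id.min measurable_const) hB) hd
    (fun _ _ hmm => walk_min_T_congr hmm hA) (fun _ _ hmm => walk_min_T_congr hmm hB)

/-- The sum of the first `n` truncated passage times. -/
noncomputable def truncSum (K n : ℕ) (q : Marks × Path) : ℝ :=
  ∑ i ∈ Finset.range n, (min (passTime (passShift^[i] q)) K).toReal

theorem measurable_min_passTime (K : ℕ) : Measurable fun q => min (passTime q) (K : ℝ≥0∞) :=
  measurable_passTime.min measurable_const

theorem integrable_min_passTime (K : ℕ) :
    Integrable (fun q => (min (passTime q) (K : ℝ≥0∞)).toReal) (annealed ν) := by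
  refine Integrable.of_bound (measurable_min_passTime K).ennreal_toReal.aestronglyMeasurable K
    (ae_of_all _ fun q => ?_)
  rw [Real.norm_of_nonneg ENNReal.toReal_nonneg]
  exact ENNReal.toReal_le_of_le_ofReal (Nat.cast_nonneg _) (by simp)

/-- Along a residue class modulo `2K + 3`, the smallest admissible gap, the truncated durations are
identically distributed and pairwise independent, which is all that the strong law requires. -/
theorem ae_tendsto_truncSum_class (h : Passes ν) (K r : ℕ) :
    ∀ᵐ q ∂(annealed ν), Tendsto (fun n : ℕ => (∑ j ∈ Finset.range n,
      (min (passTime (passShift^[r + (2 * K + 3) * j] q)) (K : ℝ≥0∞)).toReal) / n) atTop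
      (𝓝 (∫ q, (min (passTime q) (K : ℝ≥0∞)).toReal ∂(annealed ν))) := by
  have hmp : ∀ n, MeasurePreserving (passShift^[n]) (annealed ν) (annealed ν) :=
    fun n => (measurePreserving_passShift h).iterate n
  have hφ : Measurable fun q => (min (passTime q) (K : ℝ≥0∞)).toReal :=
    (measurable_min_passTime K).ennreal_toReal
  have hX : ∀ i, Measurable fun q => (min (passTime (passShift^[i] q)) (K : ℝ≥0∞)).toReal :=
    fun i => hφ.comp (hmp i).measurable
  have hlaw : ∀ i, (annealed ν).map
      (fun q => (min (passTime (passShift^[i] q)) (K : ℝ≥0∞)).toReal) =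
      (annealed ν).map (fun q => (min (passTime q) (K : ℝ≥0∞)).toReal) := by
    intro i
    conv_rhs => rw [← (hmp i).map_eq, Measure.map_map hφ (hmp i).measurable]
    rfl
  have hind : ∀ i d : ℕ, 2 * K + 2 < d → IndepFun
      (fun q => (min (passTime (passShift^[i] q)) (K : ℝ≥0∞)).toReal)
      (fun q => (min (passTime (passShift^[i + d] q)) (K : ℝ≥0∞)).toReal) (annealed ν) := by
    intro i d hd
    rw [indepFun_iff_measure_inter_preimage_eq_mul]
    intro A A' hA hA'
    have hA1 := ENNReal.measurable_toReal hA
    have hA2 := ENNReal.measurable_toReal hA'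
    have e0 := annealed_inter_min h hA1 hA2 hd
    have hs : ∀ {A : Set ℝ}, MeasurableSet A →
        MeasurableSet {q | min (passTime q) (K : ℝ≥0∞) ∈ ENNReal.toReal ⁻¹' A} :=
      fun hA => measurable_min_passTime K (ENNReal.measurable_toReal hA)
    have hs' : MeasurableSet {q | min (passTime (passShift^[d] q)) (K : ℝ≥0∞) ∈
        ENNReal.toReal ⁻¹' A'} := (hmp d).measurable (hs hA')
    have e1 := (hmp i).measure_preimage (((hs hA).inter hs').nullMeasurableSet)
    have e2 := (hmp i).measure_preimage (hs hA).nullMeasurableSet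
    have e3 := (hmp (i + d)).measure_preimage (hs hA').nullMeasurableSet
    rw [← e1, ← e2, ← e3] at e0
    rw [add_comm i d] at e0 ⊢
    convert e0 using 2
    · congr 1
      ext q
      simp only [Set.mem_preimage, Function.iterate_add_apply]
      rfl
    · rfl
    · rfl
  have hLpos : 0 < 2 * K + 3 := by omega
  have hlt : ∀ i j : ℕ, i < j → IndepFun
      (fun q => (min (passTime (passShift^[r + (2 * K + 3) * i] q)) (K : ℝ≥0∞)).toReal)
      (fun q => (min (passTime (passShift^[r + (2 * K + 3) * j] q)) (K : ℝ≥0∞)).toReal)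
      (annealed ν) := by
    intro i j hij
    have := hind (r + (2 * K + 3) * i) ((2 * K + 3) * (j - i)) (by
      have : 1 ≤ j - i := by omega
      nlinarith)
    rwa [add_assoc, ← mul_add, Nat.add_sub_cancel' hij.le] at this
  have := strong_law_ae_real (μ := annealed ν)
    (fun j q => (min (passTime (passShift^[r + (2 * K + 3) * j] q)) (K : ℝ≥0∞)).toReal)
    ((hmp _).integrable_comp_of_integrable (integrable_min_passTime K))
    (fun i j hij => by
      rcases lt_or_gt_of_ne hij with hlt' | hlt'
      · exact hlt i j hlt'
      · exact (hlt j i hlt').symm)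
    (fun i => ⟨(hX _).aemeasurable, (hX _).aemeasurable, by rw [hlaw, hlaw]⟩)
  have e : ∫ q, (min (passTime (passShift^[r + (2 * K + 3) * 0] q)) (K : ℝ≥0∞)).toReal
      ∂(annealed ν) = ∫ q, (min (passTime q) (K : ℝ≥0∞)).toReal ∂(annealed ν) := by
    have h1 := integral_map (μ := annealed ν) (f := fun y : ℝ => y)
      (hX (r + (2 * K + 3) * 0)).aemeasurable
      measurable_id.aestronglyMeasurable
    have h2 := integral_map (μ := annealed ν) (f := fun y : ℝ => y) hφ.aemeasurable
      measurable_id.aestronglyMeasurable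
    rw [← h1, ← h2, hlaw]
  rwa [e] at this

/-- Averaging over the residue classes gives the limit along multiples of `L`; the gaps are filled
because the partial sums are monotone. -/
theorem ae_tendsto_truncSum (h : Passes ν) (K : ℕ) :
    ∀ᵐ q ∂(annealed ν), Tendsto (fun n : ℕ => truncSum K n q / n) atTop
      (𝓝 (∫ q, (min (passTime q) (K : ℝ≥0∞)).toReal ∂(annealed ν))) := by
  set c := ∫ q, (min (passTime q) (K : ℝ≥0∞)).toReal ∂(annealed ν) with hc
  set L := 2 * K + 3 with hL
  filter_upwards [ae_all_iff.2 fun r => ae_tendsto_truncSum_class h K r] with q hq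
  have hmono : Monotone fun n => truncSum K n q := by
    intro a b hab
    exact Finset.sum_le_sum_of_subset_of_nonneg (Finset.range_mono hab)
      fun _ _ _ => ENNReal.toReal_nonneg
  refine tendsto_div_of_monotone_of_exists_subseq_tendsto_div _ _ hmono fun a ha => ?_
  refine ⟨fun n => L * n, ?_, ?_, ?_⟩
  · have h1 : Tendsto (fun n : ℕ => (a - 1) * (n : ℝ)) atTop atTop :=
      tendsto_natCast_atTop_atTop.const_mul_atTop (by linarith)
    filter_upwards [h1.eventually_ge_atTop 1] with n hn
    push_cast
    have hLpos : (0 : ℝ) < L := by positivity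
    nlinarith
  · exact tendsto_id.const_mul_atTop' (by omega)
  · have hsum : ∀ n, truncSum K (L * n) q = ∑ r ∈ Finset.range L, ∑ j ∈ Finset.range n,
        (min (passTime (passShift^[r + L * j] q)) (K : ℝ≥0∞)).toReal := by
      intro n
      induction n with
      | zero => simp [truncSum]
      | succ n ih =>
        have : truncSum K (L * (n + 1)) q = truncSum K (L * n) q + ∑ r ∈ Finset.range L,
            (min (passTime (passShift^[L * n + r] q)) (K : ℝ≥0∞)).toReal := by
          rw [mul_add, mul_one]
          unfold truncSum
          rw [Finset.sum_range_add]
        rw [this, ih, ← Finset.sum_add_distrib]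
        refine Finset.sum_congr rfl fun r _ => ?_
        rw [Finset.sum_range_succ, add_comm (L * n)]
    have h1 : Tendsto (fun n : ℕ => (∑ r ∈ Finset.range L, (∑ j ∈ Finset.range n,
        (min (passTime (passShift^[r + L * j] q)) (K : ℝ≥0∞)).toReal) / n) / L) atTop
        (𝓝 ((∑ r ∈ Finset.range L, c) / L)) :=
      (tendsto_finsetSum _ fun r _ => hq r).div_const _
    have hL0 : (L : ℝ) ≠ 0 := by positivity
    rw [Finset.sum_const, Finset.card_range, nsmul_eq_mul, mul_div_cancel_left₀ _ hL0] at h1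
    refine h1.congr fun n => ?_
    rw [hsum, ← Finset.sum_div, div_div]
    push_cast
    rw [mul_comm (n : ℝ)]

end Annealed

/-! ### The maximal ergodic inequality -/

section Maximal

variable {α : Type*}

/-- The maximum of `0` and the first `N` Birkhoff sums of `g`. -/
noncomputable def maxSum (f : α → α) (g : α → ℝ) : ℕ → α → ℝ
  | 0 => fun _ => 0
  | N + 1 => fun x => max 0 (g x + maxSum f g N (f x))

theorem maxSum_nonneg (f : α → α) (g : α → ℝ) (N : ℕ) (x : α) : 0 ≤ maxSum f g N x := by
  cases N with
  | zero => exact le_rfl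
  | succ N => exact le_max_left _ _

theorem maxSum_mono (f : α → α) (g : α → ℝ) (x : α) : Monotone fun N => maxSum f g N x := by
  refine monotone_nat_of_le_succ fun N => ?_
  induction N generalizing x with
  | zero => exact maxSum_nonneg f g 1 x
  | succ N ih => exact max_le_max le_rfl (add_le_add le_rfl (ih (f x)))

theorem sum_le_maxSum (f : α → α) (g : α → ℝ) (N : ℕ) (x : α) :
    ∑ i ∈ Finset.range N, g (f^[i] x) ≤ maxSum f g N x := by
  induction N generalizing x with
  | zero => simp [maxSum]
  | succ N ih =>
    rw [Finset.sum_range_succ', add_comm]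
    refine le_trans ?_ (le_max_right _ _)
    exact add_le_add le_rfl (ih (f x))

variable [MeasurableSpace α] {μ : Measure α} {f : α → α} {g : α → ℝ}

theorem measurable_maxSum (hf : Measurable f) (hg : Measurable g) (N : ℕ) :
    Measurable (maxSum f g N) := by
  induction N with
  | zero => exact measurable_const
  | succ N ih => exact measurable_const.max (hg.add (ih.comp hf))

theorem integrable_maxSum (hf : MeasurePreserving f μ μ) (hint : Integrable g μ) (N : ℕ) :
    Integrable (maxSum f g N) μ := by
  induction N with
  | zero => exact integrable_zero _ _ _
  | succ N ih =>
    exact (integrable_zero _ _ _).sup (hint.add (hf.integrable_comp_of_integrable ih))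

/-- Garsia's argument: where the maximum `M_N` is positive it equals `g + M_{N-1} ∘ f ≤ g + M_N ∘
f`, and elsewhere `M_N = 0 ≤ M_N ∘ f`. Integrating cancels `M_N` against `M_N ∘ f` by invariance. -/
theorem setIntegral_maxSum_pos_nonneg (hf : MeasurePreserving f μ μ) (hg : Measurable g)
    (hint : Integrable g μ) (N : ℕ) : 0 ≤ ∫ x in {x | 0 < maxSum f g N x}, g x ∂μ := by
  have hM := integrable_maxSum hf hint N
  have hms : MeasurableSet {x | 0 < maxSum f g N x} :=
    measurableSet_lt measurable_const (measurable_maxSum hf.measurable hg N)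
  have hle : ∀ x, maxSum f g N x ≤
      {x | 0 < maxSum f g N x}.indicator g x + maxSum f g N (f x) := by
    intro x
    by_cases hx : 0 < maxSum f g N x
    · rw [Set.indicator_of_mem (show x ∈ {x | 0 < maxSum f g N x} from hx)]
      cases N with
      | zero => exact absurd hx (lt_irrefl _)
      | succ N =>
        have h1 := maxSum_mono f g (f x) (Nat.le_succ N)
        rw [maxSum, lt_max_iff] at hx
        have h2 : maxSum f g (N + 1) x = g x + maxSum f g N (f x) :=
          max_eq_right (by rcases hx with h | h; exacts [absurd h (lt_irrefl _), h.le])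
        rw [h2]
        exact add_le_add le_rfl h1
    · rw [Set.indicator_of_notMem (show x ∉ {x | 0 < maxSum f g N x} from hx), zero_add]
      exact (not_lt.1 hx).trans (maxSum_nonneg f g N _)
  have hcomp := hf.integrable_comp_of_integrable hM
  have h1 := integral_mono hM ((hint.indicator hms).add hcomp) hle
  have h2 : ∫ x, maxSum f g N (f x) ∂μ = ∫ x, maxSum f g N x ∂μ := by
    have := integral_map (μ := μ) hf.measurable.aemeasurable
      (f := maxSum f g N) (measurable_maxSum hf.measurable hg N).aestronglyMeasurable
    rw [hf.map_eq] at this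
    exact this.symm
  have h3 : ∫ x, ({x | 0 < maxSum f g N x}.indicator g x + maxSum f g N (f x)) ∂μ =
      ∫ x, {x | 0 < maxSum f g N x}.indicator g x ∂μ + ∫ x, maxSum f g N (f x) ∂μ :=
    integral_add (hint.indicator hms) hcomp
  simp only [Pi.add_apply, Function.comp_apply] at h1
  rw [h3, h2, integral_indicator hms] at h1
  linarith

/-- The maximal inequality for `h - a`. As `h ≥ 0`, its integral over the exceptional set is at most
the full integral. -/
theorem mul_measure_exists_lt_sum_le [IsFiniteMeasure μ] (hf : MeasurePreserving f μ μ)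
    {h : α → ℝ} (hm : Measurable h) (hint : Integrable h μ) (h0 : ∀ᵐ x ∂μ, 0 ≤ h x) {a : ℝ}
    (ha : 0 ≤ a) :
    ENNReal.ofReal a * μ {x | ∃ n : ℕ, a * n < ∑ i ∈ Finset.range n, h (f^[i] x)} ≤
      ENNReal.ofReal (∫ x, h x ∂μ) := by
  set g : α → ℝ := fun x => h x - a with hgdef
  have hg : Measurable g := hm.sub measurable_const
  have hgi : Integrable g μ := hint.sub (integrable_const a)
  have hsub : {x | ∃ n : ℕ, a * n < ∑ i ∈ Finset.range n, h (f^[i] x)} ⊆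
      ⋃ N, {x | 0 < maxSum f g N x} := by
    rintro x ⟨n, hn⟩
    refine Set.mem_iUnion.2 ⟨n, lt_of_lt_of_le ?_ (sum_le_maxSum f g n x)⟩
    simp only [hgdef, Finset.sum_sub_distrib, Finset.sum_const, Finset.card_range, nsmul_eq_mul]
    linarith
  have hmono : Monotone fun N => {x | 0 < maxSum f g N x} :=
    fun M N hMN x (hx : 0 < maxSum f g M x) => hx.trans_le (maxSum_mono f g x hMN)
  refine (mul_le_mul_right (measure_mono hsub) _).trans ?_
  rw [hmono.measure_iUnion, ENNReal.mul_iSup]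
  refine iSup_le fun N => ?_
  have hms : MeasurableSet {x | 0 < maxSum f g N x} :=
    measurableSet_lt measurable_const (measurable_maxSum hf.measurable hg N)
  have h1 := setIntegral_maxSum_pos_nonneg hf hg hgi N
  rw [hgdef, integral_sub hint.integrableOn (integrable_const a).integrableOn,
    setIntegral_const, smul_eq_mul] at h1
  have h2 := setIntegral_le_integral (s := {x | 0 < maxSum f g N x}) hint h0
  rw [← ofReal_measureReal (measure_ne_top _ _), ← ENNReal.ofReal_mul ha]
  refine ENNReal.ofReal_le_ofReal ?_
  rw [mul_comm]
  linarith

end Maximal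

/-! ### The law of large numbers for the passage times of the marked sites -/

theorem iSup_lintegral_min_passTime {η : Measure (Marks × Path)} :
    ⨆ K : ℕ, ∫⁻ q, min (passTime q) K ∂η = ∫⁻ q, passTime q ∂η := by
  rw [← lintegral_iSup]
  · simp only [iSup_min_natCast]
  · exact fun n => measurable_min_passTime n
  · exact fun a b hab q => min_le_min le_rfl (by exact_mod_cast hab)

section Annealed

variable {ν : Measure (ℕ+ × Set.Ioo (0 : ℝ) 1)} [IsProbabilityMeasure ν]

theorem ae_passTime_iterate_ne_top (h : Passes ν) :
    ∀ᵐ q ∂(annealed ν), ∀ i, passTime (passShift^[i] q) ≠ ∞ := by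
  have h0 : ∀ᵐ q ∂(annealed ν), passTime q ≠ ∞ :=
    ae_annealed_of_ae (measurable_passTime (measurableSet_singleton ∞).compl) h
  exact ae_all_iff.2 fun i =>
    ((measurePreserving_passShift h).iterate i).quasiMeasurePreserving.ae h0

theorem ofReal_integral_min_passTime (K : ℕ) :
    ENNReal.ofReal (∫ q, (min (passTime q) (K : ℝ≥0∞)).toReal ∂(annealed ν)) =
      ∫⁻ q, min (passTime q) K ∂(annealed ν) := by
  rw [ofReal_integral_eq_lintegral_ofReal (integrable_min_passTime K)
    (ae_of_all _ fun q => ENNReal.toReal_nonneg)]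
  refine lintegral_congr fun q => ENNReal.ofReal_toReal ?_
  exact ne_top_of_le_ne_top (ENNReal.natCast_ne_top K) (min_le_right _ _)

theorem ofReal_truncSum_le (K n : ℕ) (q : Marks × Path) :
    ENNReal.ofReal (truncSum K n q) ≤ ∑ i ∈ Finset.range n, passTime (passShift^[i] q) := by
  rw [truncSum, ENNReal.ofReal_sum_of_nonneg fun i _ => ENNReal.toReal_nonneg]
  refine Finset.sum_le_sum fun i _ => ?_
  exact ENNReal.ofReal_toReal_le.trans (min_le_left _ _)

/-- Any `a` below the mean is below some truncated mean, and truncated sums bound the full ones from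
below. This covers an infinite mean as well. -/
theorem ae_eventually_lt_average (h : Passes ν) :
    ∀ᵐ q ∂(annealed ν), ∀ a < ∫⁻ q, passTime q ∂(annealed ν), ∀ᶠ n : ℕ in atTop,
      a < (∑ i ∈ Finset.range n, passTime (passShift^[i] q)) / n := by
  filter_upwards [ae_all_iff.2 fun K => ae_tendsto_truncSum h K] with q hq a ha
  rw [← iSup_lintegral_min_passTime, lt_iSup_iff] at ha
  obtain ⟨K, hK⟩ := ha
  rw [← ofReal_integral_min_passTime] at hK
  have h1 := (ENNReal.tendsto_ofReal (hq K)).eventually_const_lt hK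
  filter_upwards [h1, eventually_gt_atTop 0] with n hn hn0
  refine hn.trans_le ?_
  rw [ENNReal.ofReal_div_of_pos (by exact_mod_cast hn0), ENNReal.ofReal_natCast]
  exact ENNReal.div_le_div_right (ofReal_truncSum_le K n q) _

/-- The sum splits into its truncated part, which eventually stays below `(D + a) n`, and the
remainder with summands `g K`. By the maximal inequality the partial sums of the remainder ever
exceed `a n` with probability at most `(D - c K) / a`. The bad event `B` does not involve `K`, so `K
→ ∞` shows that it is null. -/
theorem ae_eventually_sum_le (h : Passes ν) (hD : ∫⁻ q, passTime q ∂(annealed ν) ≠ ∞) {a : ℝ}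
    (ha : 0 < a) :
    ∀ᵐ q ∂(annealed ν), ∀ᶠ n : ℕ in atTop,
      ∑ i ∈ Finset.range n, (passTime (passShift^[i] q)).toReal ≤
        ((∫⁻ q, passTime q ∂(annealed ν)).toReal + 2 * a) * n := by
  set D := ∫⁻ q, passTime q ∂(annealed ν) with hDdef
  set c : ℕ → ℝ := fun K => ∫ q, (min (passTime q) (K : ℝ≥0∞)).toReal ∂(annealed ν) with hc
  set g : ℕ → Marks × Path → ℝ :=
    fun K q => (passTime q).toReal - (min (passTime q) (K : ℝ≥0∞)).toReal with hg
  have hfin : ∀ᵐ q ∂(annealed ν), passTime q ≠ ∞ := by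
    filter_upwards [ae_lt_top measurable_passTime hD] with q hq using hq.ne
  have hint : Integrable (fun q => (passTime q).toReal) (annealed ν) :=
    integrable_toReal_of_lintegral_ne_top measurable_passTime.aemeasurable hD
  have hDreal : ∫ q, (passTime q).toReal ∂(annealed ν) = D.toReal :=
    integral_toReal measurable_passTime.aemeasurable (ae_lt_top measurable_passTime hD)
  have hcD : ∀ K, c K ≤ D.toReal := by
    intro K
    rw [← ENNReal.ofReal_le_iff_le_toReal hD, hc, ofReal_integral_min_passTime]
    exact lintegral_mono fun q => min_le_left _ _
  have hclim : Tendsto c atTop (𝓝 D.toReal) := by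
    have h1 : Tendsto (fun K : ℕ => ∫⁻ q, min (passTime q) K ∂(annealed ν)) atTop (𝓝 D) := by
      rw [hDdef, ← iSup_lintegral_min_passTime]
      refine tendsto_atTop_iSup fun a b hab => lintegral_mono fun q => ?_
      exact min_le_min le_rfl (by exact_mod_cast hab)
    refine ((ENNReal.tendsto_toReal hD).comp h1).congr fun K => ?_
    rw [Function.comp_apply, ← ofReal_integral_min_passTime, ENNReal.toReal_ofReal]
    exact integral_nonneg fun q => ENNReal.toReal_nonneg
  have hgint : ∀ K, Integrable (g K) (annealed ν) :=
    fun K => hint.sub (integrable_min_passTime K)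
  have hgval : ∀ K, ∫ q, g K q ∂(annealed ν) = D.toReal - c K := by
    intro K
    rw [hg, integral_sub hint (integrable_min_passTime K), hDreal]
  have hgmeas : ∀ K, Measurable (g K) := fun K =>
    measurable_passTime.ennreal_toReal.sub (measurable_min_passTime K).ennreal_toReal
  have hg0 : ∀ K, ∀ᵐ q ∂(annealed ν), 0 ≤ g K q := by
    intro K
    filter_upwards [hfin] with q hq
    exact sub_nonneg.2 (ENNReal.toReal_mono hq (min_le_left _ _))
  set B := {q | ¬ ∀ᶠ n : ℕ in atTop, ∑ i ∈ Finset.range n, (passTime (passShift^[i] q)).toReal ≤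
        (D.toReal + 2 * a) * n} with hB
  have hBle : ∀ K, annealed ν B ≤ annealed ν {q | ∃ n : ℕ, a * n <
      ∑ i ∈ Finset.range n, g K (passShift^[i] q)} := by
    intro K
    refine measure_mono_ae ?_
    filter_upwards [ae_tendsto_truncSum h K] with q hq hqB
    by_contra hno
    refine hqB ?_
    have hno' : ∀ n : ℕ, ∑ i ∈ Finset.range n, g K (passShift^[i] q) ≤ a * n := by
      intro n
      by_contra hlt
      exact hno ⟨n, not_le.1 hlt⟩
    have h1 := hq.eventually_lt_const (show c K < D.toReal + a by linarith [hcD K])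
    filter_upwards [h1, eventually_gt_atTop 0] with n hn hn0
    have hn0' : (0 : ℝ) < n := by exact_mod_cast hn0
    rw [div_lt_iff₀ hn0'] at hn
    have h2 := hno' n
    simp only [hg, Finset.sum_sub_distrib] at h2
    unfold truncSum at hn
    linarith
  have hmax : ∀ K, ENNReal.ofReal a * annealed ν B ≤ ENNReal.ofReal (D.toReal - c K) := by
    intro K
    rw [← hgval]
    exact (mul_le_mul_right (hBle K) _).trans (mul_measure_exists_lt_sum_le
      (measurePreserving_passShift h) (hgmeas K) (hgint K) (hg0 K) ha.le)
  have hlim : Tendsto (fun K => ENNReal.ofReal (D.toReal - c K)) atTop (𝓝 0) := by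
    have := ENNReal.tendsto_ofReal (hclim.const_sub D.toReal)
    simpa using this
  have hzero : ENNReal.ofReal a * annealed ν B = 0 :=
    le_antisymm (ge_of_tendsto' hlim hmax) zero_le
  rw [mul_eq_zero, ENNReal.ofReal_eq_zero] at hzero
  exact hzero.resolve_left (not_le.2 ha)

theorem ae_tendsto_average_passTime (h : Passes ν) :
    ∀ᵐ q ∂(annealed ν), Tendsto
      (fun n : ℕ => (∑ i ∈ Finset.range n, passTime (passShift^[i] q)) / n) atTop
      (𝓝 (∫⁻ q, passTime q ∂(annealed ν))) := by
  set D := ∫⁻ q, passTime q ∂(annealed ν) with hDdef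
  by_cases hD : D = ∞
  · filter_upwards [ae_eventually_lt_average h] with q hq
    refine tendsto_order.2 ⟨hq, fun b hb => ?_⟩
    rw [hD] at hb
    exact absurd hb (not_lt.2 le_top)
  · have hpos : ∀ j : ℕ, (0 : ℝ) < 1 / ((j : ℝ) + 1) := fun j => by positivity
    filter_upwards [ae_eventually_lt_average h, ae_passTime_iterate_ne_top h,
      ae_all_iff.2 fun j => ae_eventually_sum_le h hD (hpos j)] with q hq hfin hup
    refine tendsto_order.2 ⟨hq, fun b hb => ?_⟩
    have hlim : Tendsto (fun j : ℕ => ENNReal.ofReal (D.toReal + 2 * (1 / ((j : ℝ) + 1)))) atTop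
        (𝓝 D) := by
      have := ENNReal.tendsto_ofReal
        ((tendsto_one_div_add_atTop_nhds_zero_nat.const_mul 2).const_add D.toReal)
      rwa [mul_zero, add_zero, ENNReal.ofReal_toReal hD] at this
    obtain ⟨j, hj⟩ := (hlim.eventually_lt_const hb).exists
    filter_upwards [hup j, eventually_gt_atTop 0] with n hn hn0
    refine lt_of_le_of_lt ?_ hj
    have hn0' : (0 : ℝ) < n := by exact_mod_cast hn0
    rw [ENNReal.div_le_iff (by exact_mod_cast hn0.ne') (ENNReal.natCast_ne_top n)]
    have e : ∑ i ∈ Finset.range n, passTime (passShift^[i] q) =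
        ENNReal.ofReal (∑ i ∈ Finset.range n, (passTime (passShift^[i] q)).toReal) := by
      rw [ENNReal.ofReal_sum_of_nonneg fun i _ => ENNReal.toReal_nonneg]
      exact Finset.sum_congr rfl fun i _ => (ENNReal.ofReal_toReal (hfin i)).symm
    rw [e, ← ENNReal.ofReal_natCast, ← ENNReal.ofReal_mul (by positivity)]
    exact ENNReal.ofReal_le_ofReal hn

end Annealed

/-! ### Interpolation between the marked sites -/

/-- Used twice: for the number of marked sites up to `n` and for the running maximum of the walk at
time `n`. -/
theorem exists_inverse {s : ℕ → ℕ} (hs : StrictMono s) (h0 : s 0 = 0) :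
    ∃ k : ℕ → ℕ, Tendsto k atTop atTop ∧ ∀ n, s (k n) ≤ n ∧ n < s (k n + 1) := by
  classical
  have hid : ∀ k, k ≤ s k := fun _ => hs.le_apply
  refine ⟨fun n => Nat.findGreatest (fun k => s k ≤ n) n, ?_, fun n => ⟨?_, ?_⟩⟩
  · refine tendsto_atTop.2 fun b => ?_
    filter_upwards [eventually_ge_atTop (s b)] with n hn
    exact Nat.le_findGreatest ((hid b).trans hn) hn
  · exact Nat.findGreatest_spec (P := fun k => s k ≤ n) (Nat.zero_le n) (by omega)
  · by_contra hle
    push Not at hle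
    have := Nat.le_findGreatest (P := fun k => s k ≤ n) ((hid _).trans hle) hle
    omega

/-- For `s k ≤ n < s (k + 1)`, monotonicity puts `t n / n` between `t (s k) / s (k + 1)` and `t (s
(k + 1)) / s k`. Both tend to `D / a`, since `s k / k` has a positive finite limit. -/
theorem tendsto_div_of_tendsto_subseq {t : ℕ → ℝ≥0∞} (ht : Monotone t) {s : ℕ → ℕ}
    (hs : StrictMono s) (h0 : s 0 = 0) {a : ℝ} (ha : 0 < a)
    (hsa : Tendsto (fun k => (s k : ℝ) / k) atTop (𝓝 a)) {D : ℝ≥0∞}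
    (hD : Tendsto (fun k => t (s k) / k) atTop (𝓝 D)) :
    Tendsto (fun n : ℕ => t n / n) atTop (𝓝 (D / ENNReal.ofReal a)) := by
  obtain ⟨k, hk, hkn⟩ := exists_inverse hs h0
  have hspos : ∀ k, 0 < k → 0 < s k := fun k hk => hk.trans_le (hs.le_apply)
  have hlim : D / ENNReal.ofReal a = D * ENNReal.ofReal a⁻¹ := by
    rw [ENNReal.ofReal_inv_of_pos ha, div_eq_mul_inv]
  -- Multiplication is continuous at `(D, a⁻¹)` even for `D = ∞`, because the second factor is
  -- neither `0` nor `∞`.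
  have hinv : ENNReal.ofReal a⁻¹ ≠ 0 := by simpa using ha
  have hr : Tendsto (fun k : ℕ => ((k : ℝ) + 1) / k) atTop (𝓝 1) := by
    have := (tendsto_one_div_atTop_nhds_zero_nat (𝕜 := ℝ)).const_add 1
    rw [add_zero] at this
    refine this.congr' ?_
    filter_upwards [eventually_gt_atTop 0] with k hk
    have : (k : ℝ) ≠ 0 := by exact_mod_cast hk.ne'
    field_simp
  have h1 : Tendsto (fun k : ℕ => ((k : ℝ) + 1) / s k) atTop (𝓝 a⁻¹) := by
    have := hr.mul (hsa.inv₀ ha.ne')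
    rw [one_mul] at this
    refine this.congr' ?_
    filter_upwards [eventually_gt_atTop 0] with k hk
    have h2 : (k : ℝ) ≠ 0 := by exact_mod_cast hk.ne'
    have h3 : (s k : ℝ) ≠ 0 := by exact_mod_cast (hspos k hk).ne'
    field_simp
  have h2 : Tendsto (fun k : ℕ => (k : ℝ) / s (k + 1)) atTop (𝓝 a⁻¹) := by
    have := (hr.inv₀ one_ne_zero).mul (((tendsto_add_atTop_iff_nat 1).2 hsa).inv₀ ha.ne')
    rw [inv_one, one_mul] at this
    refine this.congr' ?_
    filter_upwards [eventually_gt_atTop 0] with k hk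
    have h2 : (k : ℝ) ≠ 0 := by exact_mod_cast hk.ne'
    have h3 : (s (k + 1) : ℝ) ≠ 0 := by exact_mod_cast (hspos (k + 1) (by omega)).ne'
    push_cast
    field_simp
  have hmul : ∀ {x y : ℕ → ℝ≥0∞} {z : ℕ → ℝ}, Tendsto x atTop (𝓝 D) →
      Tendsto z atTop (𝓝 a⁻¹) → (∀ᶠ k in atTop, x k * ENNReal.ofReal (z k) = y k) →
      Tendsto y atTop (𝓝 (D * ENNReal.ofReal a⁻¹)) := by
    intro x y z hx hz hxy
    refine Tendsto.congr' hxy ?_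
    exact ENNReal.Tendsto.mul hx (Or.inr ENNReal.ofReal_ne_top) (ENNReal.tendsto_ofReal hz)
      (Or.inl hinv)
  have hfrac : ∀ (x : ℝ≥0∞) (i j : ℕ), 0 < i → 0 < j →
      x / i * ENNReal.ofReal ((i : ℝ) / j) = x / j := by
    intro x i j hi hj
    have hi' : (i : ℝ≥0∞) ≠ 0 := by exact_mod_cast hi.ne'
    rw [ENNReal.ofReal_div_of_pos (by exact_mod_cast hj), ENNReal.ofReal_natCast,
      ENNReal.ofReal_natCast, div_eq_mul_inv, div_eq_mul_inv, div_eq_mul_inv, mul_assoc,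
      ← mul_assoc (i : ℝ≥0∞)⁻¹, ENNReal.inv_mul_cancel hi' (ENNReal.natCast_ne_top i), one_mul]
  have hU : Tendsto (fun k : ℕ => t (s (k + 1)) / s k) atTop (𝓝 (D / ENNReal.ofReal a)) := by
    rw [hlim]
    refine hmul ((tendsto_add_atTop_iff_nat 1).2 hD) h1 ?_
    filter_upwards [eventually_gt_atTop 0] with k hk
    rw [← Nat.cast_succ]
    exact hfrac _ _ _ (by omega) (hspos k hk)
  have hL : Tendsto (fun k : ℕ => t (s k) / s (k + 1)) atTop (𝓝 (D / ENNReal.ofReal a)) := by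
    rw [hlim]
    refine hmul hD h2 ?_
    filter_upwards [eventually_gt_atTop 0] with k hk
    exact hfrac _ _ _ hk (hspos _ (by omega))
  refine tendsto_of_tendsto_of_tendsto_of_le_of_le (hL.comp hk) (hU.comp hk) (fun n => ?_)
    fun n => ?_
  · exact ENNReal.div_le_div (ht (hkn n).1) (by exact_mod_cast (hkn n).2.le)
  · exact ENNReal.div_le_div (ht (hkn n).2.le) (by exact_mod_cast (hkn n).1)

theorem exists_eq_of_le_of_nearest {p : Path}
    (hp : ∀ n, p (n + 1) = p n + 1 ∨ p (n + 1) = p n - 1) {y : ℤ} (h0 : p 0 ≤ y) {n : ℕ}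
    (hn : y ≤ p n) : ∃ t ≤ n, p t = y := by
  have hneg : ∀ n, -p (n + 1) = -p n + 1 ∨ -p (n + 1) = -p n - 1 := fun n => by
    have := hp n
    omega
  obtain ⟨r, hr, hpr⟩ := exists_eq_of_nearest (p := fun n => -p n) hneg (y := -y) (by omega)
    (n := n) (by omega)
  exact ⟨r, hr, by omega⟩

theorem T_mono_of_nearest {p : Path} (hp : ∀ n, p (n + 1) = p n + 1 ∨ p (n + 1) = p n - 1)
    {y z : ℤ} (h0 : p 0 ≤ y) (hyz : y ≤ z) : T p y ≤ T p z := by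
  refine le_iInf₂ fun k hk => ?_
  obtain ⟨r, hr, hpr⟩ := exists_eq_of_le_of_nearest hp h0 (n := k) (by omega)
  exact (iInf₂_le r hpr).trans (by exact_mod_cast hr)

theorem abs_sub_le_of_nearest {p : Path} (hp : ∀ n, p (n + 1) = p n + 1 ∨ p (n + 1) = p n - 1)
    (a b : ℕ) : |p (a + b) - p a| ≤ b := by
  induction b with
  | zero => simp
  | succ b ih =>
    have := hp (a + b)
    rw [abs_le] at ih ⊢
    rw [← add_assoc]
    push_cast
    omega

/-- Let `k n` be the running maximum, so that `T_{k n} ≤ n < T_{k n + 1}`; then `k n / n → v` and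
`X_n ≤ k n`. If `v > 0`, then `T_{k n} / n → 1`, and unit steps give `X_n ≥ k n - (n - T_{k n})`. If
`v = 0`, the time since the last maximum is not controlled, and `hb` supplies the lower bound. -/
theorem tendsto_position_of_tendsto_T {p : Path} (h0 : p 0 = 0)
    (hp : ∀ n, p (n + 1) = p n + 1 ∨ p (n + 1) = p n - 1) (hT : ∀ n : ℕ, T p n ≠ ∞)
    {v : ℝ≥0∞} (hv : v ≠ ∞) (hlim : Tendsto (fun n : ℕ => T p n / n) atTop (𝓝 v⁻¹))
    (hb : ∃ c : ℤ, ∀ n, c ≤ p n) :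
    Tendsto (fun n : ℕ => (p n : ℝ) / n) atTop (𝓝 v.toReal) := by
  choose t ht using fun n : ℕ => exists_T_eq_natCast (hT n)
  have hhit : ∀ n, p (t n) = n := fun n => (T_eq_natCast.1 (ht n)).1
  have hmin : ∀ n s : ℕ, p s = n → t n ≤ s := fun n s hs => by
    by_contra hlt
    exact (T_eq_natCast.1 (ht n)).2 s (by omega) hs
  have ht0 : t 0 = 0 := Nat.le_zero.1 (hmin 0 0 (by simpa using h0))
  have htmono : StrictMono t := by
    refine strictMono_nat_of_lt_succ fun n => ?_
    obtain ⟨r, hr, hpr⟩ := exists_eq_of_le_of_nearest hp (y := n) (by omega) (n := t (n + 1))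
      (by rw [hhit]; push_cast; omega)
    refine lt_of_le_of_ne ((hmin n r hpr).trans hr) fun h => ?_
    have h1 := hhit n
    rw [h, hhit] at h1
    push_cast at h1
    omega
  obtain ⟨k, hk, hkn⟩ := exists_inverse htmono ht0
  have htpos : ∀ n, 0 < n → 0 < t n := fun n hn => hn.trans_le htmono.le_apply
  have hinv : Tendsto (fun n : ℕ => (n : ℝ) / t n) atTop (𝓝 v.toReal) := by
    have h1 : Tendsto (fun n : ℕ => (T p n / n)⁻¹) atTop (𝓝 v) := by
      have := tendsto_inv_iff.2 hlim
      rwa [inv_inv] at this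
    refine ((ENNReal.tendsto_toReal hv).comp h1).congr fun n => ?_
    rw [Function.comp_apply, ht, ENNReal.toReal_inv, ENNReal.toReal_div, inv_div]
    simp
  have hinv' : Tendsto (fun n : ℕ => (n : ℝ) / t (n + 1)) atTop (𝓝 v.toReal) := by
    have h1 := (tendsto_add_atTop_iff_nat 1).2 hinv
    have h2 : Tendsto (fun n : ℕ => 1 / (t (n + 1) : ℝ)) atTop (𝓝 0) :=
      (tendsto_add_atTop_iff_nat 1).2 (tendsto_one_div_atTop_nhds_zero_nat.comp
        htmono.tendsto_atTop)
    have h3 := h1.sub h2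
    rw [sub_zero] at h3
    refine h3.congr fun n => ?_
    rw [← sub_div]
    push_cast
    ring_nf
  have hkdiv : Tendsto (fun n : ℕ => (k n : ℝ) / n) atTop (𝓝 v.toReal) := by
    refine tendsto_of_tendsto_of_tendsto_of_le_of_le' (hinv'.comp hk) (hinv.comp hk) ?_ ?_
    · filter_upwards [eventually_gt_atTop 0] with n hn
      refine div_le_div_of_nonneg_left (Nat.cast_nonneg _) (by exact_mod_cast hn) ?_
      exact_mod_cast (hkn n).2.le
    · filter_upwards [hk.eventually_gt_atTop 0] with n hn
      refine div_le_div_of_nonneg_left (Nat.cast_nonneg _) (by exact_mod_cast htpos _ hn) ?_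
      exact_mod_cast (hkn n).1
  have hpk : ∀ n, p n ≤ k n := by
    intro n
    by_contra hlt
    obtain ⟨r, hr, hpr⟩ := exists_eq_of_le_of_nearest hp (y := (k n + 1 : ℕ)) (by omega) (n := n)
      (by push_cast; omega)
    have := hmin _ r hpr
    have := (hkn n).2
    omega
  have hup : ∀ n : ℕ, (p n : ℝ) / n ≤ k n / n := fun n =>
    div_le_div_of_nonneg_right (by exact_mod_cast hpk n) (Nat.cast_nonneg n)
  by_cases hv0 : v = 0
  · obtain ⟨c, hc⟩ := hb
    have hlow : Tendsto (fun n : ℕ => (c : ℝ) / n) atTop (𝓝 v.toReal) := by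
      rw [hv0, ENNReal.toReal_zero]
      exact tendsto_const_div_atTop_nhds_zero_nat _
    refine tendsto_of_tendsto_of_tendsto_of_le_of_le hlow hkdiv (fun n => ?_) hup
    have hcn : (c : ℝ) ≤ p n := by exact_mod_cast hc n
    exact div_le_div_of_nonneg_right hcn (Nat.cast_nonneg n)
  · have hvpos : v.toReal ≠ 0 := (ENNReal.toReal_pos hv0 hv).ne'
    have h1 : Tendsto (fun n : ℕ => (t (k n) : ℝ) / n) atTop (𝓝 1) := by
      have h2 := ((hinv.comp hk).inv₀ hvpos).mul hkdiv
      rw [inv_mul_cancel₀ hvpos] at h2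
      refine h2.congr' ?_
      filter_upwards [hk.eventually_gt_atTop 0] with n hn
      have h3 : (k n : ℝ) ≠ 0 := by exact_mod_cast hn.ne'
      rw [Function.comp_apply, inv_div]
      field_simp
    have hlow : Tendsto (fun n : ℕ => (k n : ℝ) / n - (1 - (t (k n) : ℝ) / n)) atTop
        (𝓝 v.toReal) := by
      have := hkdiv.sub (h1.const_sub 1)
      rwa [sub_self, sub_zero] at this
    refine tendsto_of_tendsto_of_tendsto_of_le_of_le' hlow hkdiv ?_ (Eventually.of_forall hup)
    filter_upwards [eventually_gt_atTop 0] with n hn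
    have hnpos : (0 : ℝ) < n := by exact_mod_cast hn
    have h2 := abs_sub_le_of_nearest hp (t (k n)) (n - t (k n))
    rw [Nat.add_sub_cancel' (hkn n).1, hhit, abs_le] at h2
    have h3 : ((k n : ℝ) - (n - t (k n))) ≤ p n := by
      have h4 := h2.1
      have h5 := (hkn n).1
      have h6 : (k n : ℤ) - ((n : ℤ) - t (k n)) ≤ p n := by omega
      exact_mod_cast h6
    calc _ = ((k n : ℝ) - (n - t (k n))) / n := by field_simp
      _ ≤ _ := div_le_div_of_nonneg_right h3 hnpos.le

/-! ### The annealed expectation of the passage time -/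

section Annealed

variable {ν : Measure (ℕ+ × Set.Ioo (0 : ℝ) 1)} [IsProbabilityMeasure ν]

theorem lintegral_mark {f : ℕ+ × Set.Ioo (0 : ℝ) 1 → ℝ≥0∞} (hf : Measurable f) (k : ℤ) :
    ∫⁻ m, f (m k) ∂(Measure.infinitePi fun _ : ℤ => ν) = ∫⁻ x, f x ∂ν :=
  (measurePreserving_eval_infinitePi (fun _ : ℤ => ν) k).lintegral_comp hf

theorem measurable_rho : Measurable rho :=
  ((measurable_const.sub measurable_subtype_coe).div measurable_subtype_coe).ennreal_ofReal

theorem measurable_size : Measurable fun x : ℕ+ × Set.Ioo (0 : ℝ) 1 => ((x.1 : ℕ) : ℝ≥0∞) :=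
  (Measurable.of_discrete (f := fun x : ℕ+ => ((x : ℕ) : ℝ≥0∞))).comp measurable_fst

theorem lintegral_prod_rho (j : ℕ) :
    ∫⁻ m : Marks, ∏ i ∈ Finset.range j, rho (m (-i)).2 ∂(Measure.infinitePi fun _ : ℤ => ν) =
      (∫⁻ x, rho x.2 ∂ν) ^ j := by
  have hρ : ∀ k : ℤ, Measurable fun m : Marks => rho (m k).2 := fun k =>
    measurable_rho.comp (measurable_snd.comp (measurable_pi_apply k))
  induction j with
  | zero => simp
  | succ j ih =>
    simp only [Finset.prod_range_succ]
    rw [lintegral_mul_of_disjoint (I := Finset.Ioc (-(j : ℤ)) 0) (J := {-(j : ℤ)}), ih, pow_succ,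
      lintegral_mark (f := fun x => rho x.2) (measurable_rho.comp measurable_snd)]
    · exact Finset.measurable_fun_prod _ fun i _ => hρ _
    · exact hρ _
    · simp
    · intro m m' h
      refine Finset.prod_congr rfl fun i hi => ?_
      rw [h]
      have := Finset.mem_range.1 hi
      rw [Finset.mem_Ioc]
      omega
    · intro m m' h
      rw [h _ (Finset.mem_singleton_self _)]

/-- `ξ_{-j}` comes from a different pair than each of the ratios in the product, so the dependence
between `ξ` and `λ` inside one pair is harmless. -/
theorem lintegral_size_mul_prod_rho (j : ℕ) :
    ∫⁻ m : Marks, ((m (-j)).1 : ℕ) * ∏ i ∈ Finset.range j, rho (m (-i)).2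
      ∂(Measure.infinitePi fun _ : ℤ => ν) =
      (∫⁻ x, ((x.1 : ℕ) : ℝ≥0∞) ∂ν) * (∫⁻ x, rho x.2 ∂ν) ^ j := by
  have hρ : ∀ k : ℤ, Measurable fun m : Marks => rho (m k).2 := fun k =>
    measurable_rho.comp (measurable_snd.comp (measurable_pi_apply k))
  rw [lintegral_mul_of_disjoint (I := {-(j : ℤ)}) (J := Finset.Ioc (-(j : ℤ)) 0),
    lintegral_prod_rho, lintegral_mark measurable_size]
  · exact measurable_size.comp (measurable_pi_apply _)
  · exact Finset.measurable_fun_prod _ fun i _ => hρ _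
  · simp
  · intro m m' h
    rw [h _ (Finset.mem_singleton_self _)]
  · intro m m' h
    refine Finset.prod_congr rfl fun i hi => ?_
    rw [h]
    have := Finset.mem_range.1 hi
    rw [Finset.mem_Ioc]
    omega

/-- The mean of `passMean_S_one`, integrated term by term. The only factors with a common index are
`ξ_1` and `ρ_1`. In `ℝ≥0∞` the geometric series equals `(1 - E ρ)⁻¹` for every value of `E ρ`: the
truncated difference is `0`, and its inverse `∞`, once `E ρ ≥ 1`. -/
theorem lintegral_passTime
    (hlog : ∫⁻ x, ENNReal.ofReal (Real.log ((1 - (x.2 : ℝ)) / x.2)) ∂ν <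
      ∫⁻ x, ENNReal.ofReal (-Real.log ((1 - (x.2 : ℝ)) / x.2)) ∂ν)
    (hξ : Integrable (fun x => ((x.1 : ℕ) : ℝ)) ν) :
    ∫⁻ q, passTime q ∂(annealed ν) = ∫⁻ x, ((x.1 : ℕ) : ℝ≥0∞) ^ 2 ∂ν +
      (∫⁻ x, rho x.2 * ((x.1 : ℕ) : ℝ≥0∞) ∂ν) *
        (2 * (∫⁻ x, ((x.1 : ℕ) : ℝ≥0∞) ∂ν) * (1 - ∫⁻ x, rho x.2 ∂ν)⁻¹) := by
  have hρ : ∀ k : ℤ, Measurable fun m : Marks => rho (m k).2 := fun k =>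
    measurable_rho.comp (measurable_snd.comp (measurable_pi_apply k))
  have hsz : ∀ k : ℤ, Measurable fun m : Marks => (((m k).1 : ℕ) : ℝ≥0∞) := fun k =>
    measurable_size.comp (measurable_pi_apply k)
  have hρξ : Measurable fun x : ℕ+ × Set.Ioo (0 : ℝ) 1 => rho x.2 * ((x.1 : ℕ) : ℝ≥0∞) :=
    (measurable_rho.comp measurable_snd).mul measurable_size
  have hterm : ∀ j : ℕ, ∫⁻ m : Marks, rho (m 1).2 * ((m 1).1 : ℕ) *
      (((m (-j)).1 : ℕ) * ∏ i ∈ Finset.range j, rho (m (-i)).2)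
      ∂(Measure.infinitePi fun _ : ℤ => ν) = (∫⁻ x, rho x.2 * ((x.1 : ℕ) : ℝ≥0∞) ∂ν) *
        ((∫⁻ x, ((x.1 : ℕ) : ℝ≥0∞) ∂ν) * (∫⁻ x, rho x.2 ∂ν) ^ j) := by
    intro j
    rw [lintegral_mul_of_disjoint (I := {(1 : ℤ)}) (J := Finset.Icc (-(j : ℤ)) 0),
      lintegral_size_mul_prod_rho, lintegral_mark hρξ]
    · exact (hρ 1).mul (hsz 1)
    · exact (hsz _).mul (Finset.measurable_fun_prod _ fun i _ => hρ _)
    · simp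
    · intro m m' h
      rw [h _ (Finset.mem_singleton_self _)]
    · intro m m' h
      congr 1
      · rw [h]
        rw [Finset.mem_Icc]
        omega
      · refine Finset.prod_congr rfl fun i hi => ?_
        rw [h]
        have := Finset.mem_range.1 hi
        rw [Finset.mem_Icc]
        omega
  have hseries : ∀ m : Marks, (((m 1).1 : ℕ) : ℝ≥0∞) * (rho (m 1).2 * backSeries m) =
      ∑' j : ℕ, 2 * (rho (m 1).2 * ((m 1).1 : ℕ) *
        (((m (-j)).1 : ℕ) * ∏ i ∈ Finset.range j, rho (m (-i)).2)) := by
    intro m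
    rw [backSeries, ← ENNReal.tsum_mul_left, ← ENNReal.tsum_mul_left]
    exact tsum_congr fun j => by ring
  have hmterm : ∀ j : ℕ, Measurable fun m : Marks => rho (m 1).2 * ((m 1).1 : ℕ) *
      (((m (-j)).1 : ℕ) * ∏ i ∈ Finset.range j, rho (m (-i)).2) := fun j =>
    ((hρ 1).mul (hsz 1)).mul ((hsz _).mul (Finset.measurable_fun_prod _ fun i _ => hρ _))
  have h1 : ∫⁻ q, passTime q ∂(annealed ν) = ∫⁻ m : Marks, ((((m 1).1 : ℕ) : ℝ≥0∞) ^ 2 +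
      ((m 1).1 : ℕ) * (rho (m 1).2 * backSeries m)) ∂(Measure.infinitePi fun _ : ℤ => ν) := by
    rw [lintegral_annealed measurable_passTime]
    refine lintegral_congr_ae ?_
    filter_upwards [ae_backSeries_ne_top hlog hξ] with m hm
    exact passMean_S_one hm
  rw [h1, lintegral_add_left ((hsz 1).pow_const 2),
    lintegral_mark (f := fun x => ((x.1 : ℕ) : ℝ≥0∞) ^ 2) (measurable_size.pow_const 2)]
  congr 1
  simp only [hseries]
  rw [lintegral_tsum fun j => ((hmterm j).const_mul 2).aemeasurable]
  simp only [lintegral_const_mul 2 (hmterm _), hterm]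
  rw [← ENNReal.tsum_geometric, ← ENNReal.tsum_mul_left, ← ENNReal.tsum_mul_left]
  exact tsum_congr fun j => by ring

/-- The quenched mean of the passage time is almost surely finite, even when its annealed mean is
not. -/
theorem passes_of_log
    (hlog : ∫⁻ x, ENNReal.ofReal (Real.log ((1 - (x.2 : ℝ)) / x.2)) ∂ν <
      ∫⁻ x, ENNReal.ofReal (-Real.log ((1 - (x.2 : ℝ)) / x.2)) ∂ν)
    (hξ : Integrable (fun x => ((x.1 : ℕ) : ℝ)) ν) : Passes ν := by
  filter_upwards [ae_backSeries_ne_top hlog hξ] with m hm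
  refine ae_T_ne_top ?_
  rw [passMean_S_one hm]
  exact ENNReal.add_ne_top.2 ⟨by simp, ENNReal.mul_ne_top (by simp)
    (ENNReal.mul_ne_top (rho_ne_top _) hm)⟩

end Annealed

/-! ### The speed of the walk -/

section Annealed

variable {ν : Measure (ℕ+ × Set.Ioo (0 : ℝ) 1)} [IsProbabilityMeasure ν]

theorem ae_annealed_of_walk {Q : Path → Prop} (hQ : MeasurableSet {p | Q p})
    (h : ∀ᵐ m ∂(Measure.infinitePi fun _ : ℤ => ν), ∀ᵐ p ∂(walk (sparseEnv m) 0), Q p) :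
    ∀ᵐ q ∂(annealed ν), Q q.2 :=
  ae_annealed_of_ae (Q := fun q => Q q.2) (measurable_snd hQ) h

theorem ae_annealed_of_marks {Q : Marks → Prop}
    (h : ∀ᵐ m ∂(Measure.infinitePi fun _ : ℤ => ν), Q m) : ∀ᵐ q ∂(annealed ν), Q q.1 := by
  have hmp : MeasurePreserving Prod.fst (annealed ν) (Measure.infinitePi fun _ : ℤ => ν) :=
    ⟨measurable_fst, Measure.fst_compProd _ _⟩
  exact hmp.quasiMeasurePreserving.ae h

theorem ae_annealed_start : ∀ᵐ q ∂(annealed ν), q.2 0 = 0 :=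
  ae_annealed_of_walk (Q := fun p => p 0 = 0) (measurableSet_coord 0 0)
    (ae_of_all _ fun _ => ae_walk_start _ _)

theorem ae_annealed_nearest :
    ∀ᵐ q ∂(annealed ν), ∀ n, q.2 (n + 1) = q.2 n + 1 ∨ q.2 (n + 1) = q.2 n - 1 := by
  refine ae_annealed_of_walk (Q := fun p => ∀ n, p (n + 1) = p n + 1 ∨ p (n + 1) = p n - 1) ?_
    (ae_of_all _ fun _ => ae_walk_nearest _ _)
  have : {p : Path | ∀ n, p (n + 1) = p n + 1 ∨ p (n + 1) = p n - 1} =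
      ⋂ n, {p : Path | p (n + 1) = p n + 1 ∨ p (n + 1) = p n - 1} := by
    ext p
    simp
  rw [this]
  exact MeasurableSet.iInter fun n => measurableSet_nearest n

theorem ae_annealed_bddBelow
    (hlog : ∫⁻ x, ENNReal.ofReal (Real.log ((1 - (x.2 : ℝ)) / x.2)) ∂ν <
      ∫⁻ x, ENNReal.ofReal (-Real.log ((1 - (x.2 : ℝ)) / x.2)) ∂ν)
    (hξ : Integrable (fun x => ((x.1 : ℕ) : ℝ)) ν) :
    ∀ᵐ q ∂(annealed ν), ∃ c : ℤ, ∀ n, c ≤ q.2 n := by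
  refine ae_annealed_of_walk (Q := fun p => ∃ c : ℤ, ∀ n, c ≤ p n) ?_ ?_
  · have : {p : Path | ∃ c : ℤ, ∀ n, c ≤ p n} = ⋃ c : ℤ, ⋂ n, {p : Path | c ≤ p n} := by
      ext p
      simp
    rw [this]
    exact MeasurableSet.iUnion fun c => MeasurableSet.iInter fun n =>
      measurableSet_le measurable_const (measurable_pi_apply n)
  · filter_upwards [ae_forwardSeries_ne_top hlog hξ, ae_backSeries_ne_top hlog hξ] with m hf hb
    exact ae_bddBelow hf hb

theorem natCast_le_S (m : Marks) (n : ℕ) : (n : ℤ) ≤ S m n := by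
  have h0 := (S_strictMono m).monotone (show (0 : ℤ) ≤ n by omega)
  rw [S_zero] at h0
  have := abs_le_abs_S m n
  rwa [abs_of_nonneg (by omega), abs_of_nonneg h0] at this

theorem S_eq_sum (m : Marks) (n : ℕ) :
    (S m n : ℝ) = ∑ i ∈ Finset.range n, (((m (i + 1)).1 : ℕ) : ℝ) := by
  induction n with
  | zero => simp [S_zero]
  | succ n ih =>
    rw [Finset.sum_range_succ, ← ih, Nat.cast_succ, S_succ, Int.cast_add]
    rfl

/-- The limits of `T_{S_k} / k` and `S_k / k` are combined by interpolation. Finiteness of `T_n`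
follows from `n ≤ S_n`. -/
theorem ae_tendsto_T_div
    (hlog : ∫⁻ x, ENNReal.ofReal (Real.log ((1 - (x.2 : ℝ)) / x.2)) ∂ν <
      ∫⁻ x, ENNReal.ofReal (-Real.log ((1 - (x.2 : ℝ)) / x.2)) ∂ν)
    (hξ : Integrable (fun x => ((x.1 : ℕ) : ℝ)) ν) :
    ∀ᵐ q ∂(annealed ν), (∀ n : ℕ, T q.2 n ≠ ∞) ∧
      Tendsto (fun n : ℕ => T q.2 n / n) atTop
        (𝓝 ((∫⁻ q, passTime q ∂(annealed ν)) / ∫⁻ x, ((x.1 : ℕ) : ℝ≥0∞) ∂ν)) := by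
  have hpass := passes_of_log hlog hξ
  have hmeas : Measurable fun x : ℕ+ × Set.Ioo (0 : ℝ) 1 => ((x.1 : ℕ) : ℝ) :=
    (Measurable.of_discrete (f := fun x : ℕ+ => ((x : ℕ) : ℝ))).comp measurable_fst
  have hone : 1 ≤ ∫ x, ((x.1 : ℕ) : ℝ) ∂ν := by
    have h1 : ∀ x : ℕ+ × Set.Ioo (0 : ℝ) 1, (1 : ℝ) ≤ ((x.1 : ℕ) : ℝ) := fun x =>
      Nat.one_le_cast.2 x.1.pos
    have := integral_mono (μ := ν) (integrable_const (1 : ℝ)) hξ h1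
    simpa using this
  have hof : ENNReal.ofReal (∫ x, ((x.1 : ℕ) : ℝ) ∂ν) = ∫⁻ x, ((x.1 : ℕ) : ℝ≥0∞) ∂ν := by
    rw [ofReal_integral_eq_lintegral_ofReal hξ (ae_of_all _ fun x => Nat.cast_nonneg _)]
    simp only [ENNReal.ofReal_natCast]
  have hS := ae_annealed_of_marks (ae_tendsto_average_marks hmeas hξ
    (b := fun i : ℕ => (i : ℤ) + 1) (fun i j h => by simpa using h))
  filter_upwards [ae_annealed_start (ν := ν), ae_annealed_nearest (ν := ν),
    ae_passTime_iterate_ne_top hpass, ae_tendsto_average_passTime hpass, hS]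
    with q h0 hn hT hlim hSq
  have hmono : ∀ a b : ℕ, a ≤ b → T q.2 a ≤ T q.2 b := fun a b hab =>
    T_mono_of_nearest hn (by rw [h0]; omega) (by exact_mod_cast hab)
  have hsum := T_S_eq_sum h0 hn hT
  have hScast : ∀ k : ℕ, (((S q.1 k).toNat : ℕ) : ℤ) = S q.1 k := fun k =>
    Int.toNat_of_nonneg ((Int.natCast_nonneg k).trans (natCast_le_S q.1 k))
  refine ⟨fun n => ?_, ?_⟩
  · have h1 : T q.2 n ≤ T q.2 (S q.1 n) :=
      T_mono_of_nearest hn (by rw [h0]; omega) (natCast_le_S q.1 n)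
    refine ne_top_of_le_ne_top ?_ h1
    rw [hsum]
    exact ENNReal.sum_ne_top.2 fun i _ => hT i
  · rw [← hof]
    refine tendsto_div_of_tendsto_subseq (t := fun n => T q.2 n) (fun a b hab => hmono a b hab)
      (s := fun k => (S q.1 k).toNat) (fun a b hab => ?_) (by simp [S_zero]) (by linarith) ?_ ?_
    · have := S_strictMono q.1 (show (a : ℤ) < b by exact_mod_cast hab)
      have := hScast a
      have := hScast b
      dsimp only
      omega
    · refine hSq.congr fun k => ?_
      have h1 : (((S q.1 k).toNat : ℕ) : ℝ) = S q.1 k := by exact_mod_cast hScast k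
      rw [h1, S_eq_sum]
    · refine hlim.congr fun k => ?_
      rw [hScast, hsum]

end Annealed

end SparseRWRE

/-- `(ξ, lam)` is the generic random vector and `ρ = (1 - lam) / lam`. The hypothesis `hlog`, that
the positive part of `log ρ` has a smaller expectation than the negative part, says that
`E log ρ` exists in `[-∞, ∞]` and belongs to `[-∞, 0)`. -/
theorem proposition1 {Ω : Type*} [MeasurableSpace Ω] (μ : Measure Ω) [IsProbabilityMeasure μ]
    (ξ : Ω → ℕ+) (lam : Ω → Set.Ioo (0 : ℝ) 1) (hξm : Measurable ξ) (hlam : Measurable lam)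
    (ρ : Ω → ℝ) (hρ : ∀ w, ρ w = (1 - (lam w : ℝ)) / (lam w : ℝ))
    (hlog : ∫⁻ w, ENNReal.ofReal (Real.log (ρ w)) ∂μ < ∫⁻ w, ENNReal.ofReal (-Real.log (ρ w)) ∂μ)
    (hξ : Integrable (fun w => (ξ w : ℝ)) μ)
    (ν : Measure (ℕ+ × Set.Ioo (0 : ℝ) 1)) (hν : ν = μ.map (fun w => (ξ w, lam w)))
    (v : ℝ≥0∞) (hv : v = SparseRWRE.speed ν) :
    -- `v` is the almost sure speed of the walk
    v ≠ ∞ ∧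
    (∀ᵐ q ∂(SparseRWRE.annealed ν),
      Tendsto (fun n : ℕ => (q.2 n : ℝ) / (n : ℝ)) atTop (𝓝 v.toReal)) ∧
    (∀ᵐ q ∂(SparseRWRE.annealed ν),
      Tendsto (fun n : ℕ => SparseRWRE.T q.2 (n : ℤ) / (n : ℝ≥0∞)) atTop (𝓝 v⁻¹)) ∧
    -- its value in the ballistic case
    ((Integrable ρ μ ∧ ∫ w, ρ w ∂μ < 1) ∧ Integrable (fun w => ρ w * (ξ w : ℝ)) μ ∧
        Integrable (fun w => (ξ w : ℝ) ^ 2) μ →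
      v ≠ 0 ∧
      v.toReal = ((1 - ∫ w, ρ w ∂μ) * ∫ w, (ξ w : ℝ) ∂μ) /
        ((1 - ∫ w, ρ w ∂μ) * (∫ w, (ξ w : ℝ) ^ 2 ∂μ) +
          2 * (∫ w, (ξ w : ℝ) ∂μ) * ∫ w, ρ w * (ξ w : ℝ) ∂μ) ∧
      (v⁻¹).toReal = 1 / (∫ w, (ξ w : ℝ) ∂μ) *
        ((∫ w, (ξ w : ℝ) ^ 2 ∂μ) +
          2 * (∫ w, (ξ w : ℝ) ∂μ) * (∫ w, ρ w * (ξ w : ℝ) ∂μ) / (1 - ∫ w, ρ w ∂μ))) ∧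
    -- its value in all other cases
    (¬((Integrable ρ μ ∧ ∫ w, ρ w ∂μ < 1) ∧ Integrable (fun w => ρ w * (ξ w : ℝ)) μ ∧
        Integrable (fun w => (ξ w : ℝ) ^ 2) μ) →
      v = 0 ∧ v⁻¹ = ∞) := by
  have hpair : Measurable fun w => (ξ w, lam w) := hξm.prodMk hlam
  have : IsProbabilityMeasure ν := by
    rw [hν]
    exact Measure.isProbabilityMeasure_map hpair.aemeasurable
  have hml : Measurable fun x : ℕ+ × Set.Ioo (0 : ℝ) 1 => (1 - (x.2 : ℝ)) / x.2 :=
    (measurable_const.sub (measurable_subtype_coe.comp measurable_snd)).div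
      (measurable_subtype_coe.comp measurable_snd)
  have hmξ : Measurable fun x : ℕ+ × Set.Ioo (0 : ℝ) 1 => ((x.1 : ℕ) : ℝ) :=
    (Measurable.of_discrete (f := fun x : ℕ+ => ((x : ℕ) : ℝ))).comp measurable_fst
  have hρm : Measurable ρ := by
    have : ρ = fun w => (1 - (lam w : ℝ)) / (lam w : ℝ) := funext hρ
    rw [this]
    exact hml.comp hpair
  have hρpos : ∀ w, 0 < ρ w := fun w => by
    rw [hρ]
    have := (lam w).2
    exact div_pos (by linarith [this.2]) this.1
  have hξm' : Measurable fun w => (ξ w : ℝ) := hmξ.comp hpair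
  have hlog' : ∫⁻ x, ENNReal.ofReal (Real.log ((1 - (x.2 : ℝ)) / x.2)) ∂ν <
      ∫⁻ x, ENNReal.ofReal (-Real.log ((1 - (x.2 : ℝ)) / x.2)) ∂ν := by
    rw [hν, lintegral_map
        (f := fun x : ℕ+ × Set.Ioo (0 : ℝ) 1 => ENNReal.ofReal (Real.log ((1 - (x.2 : ℝ)) / x.2)))
        (Real.measurable_log.comp hml).ennreal_ofReal hpair,
      lintegral_map
        (f := fun x : ℕ+ × Set.Ioo (0 : ℝ) 1 => ENNReal.ofReal (-Real.log ((1 - (x.2 : ℝ)) / x.2)))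
        (Real.measurable_log.comp hml).neg.ennreal_ofReal hpair]
    simpa only [← hρ] using hlog
  have hξ' : Integrable (fun x => ((x.1 : ℕ) : ℝ)) ν := by
    rw [hν, integrable_map_measure hmξ.aestronglyMeasurable hpair.aemeasurable]
    exact hξ
  set a₁ := ∫⁻ x, ((x.1 : ℕ) : ℝ≥0∞) ∂ν with ha₁
  set D := ∫⁻ q, SparseRWRE.passTime q ∂(SparseRWRE.annealed ν) with hDdef
  have hvD : v = a₁ / D := hv
  have e₁ : a₁ = ENNReal.ofReal (∫ w, (ξ w : ℝ) ∂μ) := by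
    rw [ofReal_integral_eq_lintegral_ofReal hξ (ae_of_all _ fun w => Nat.cast_nonneg _), ha₁, hν,
      lintegral_map SparseRWRE.measurable_size hpair]
    simp only [ENNReal.ofReal_natCast]
  have hD := SparseRWRE.lintegral_passTime hlog' hξ'
  have hm₂ : ∫⁻ x, ((x.1 : ℕ) : ℝ≥0∞) ^ 2 ∂ν = ∫⁻ w, ENNReal.ofReal ((ξ w : ℝ) ^ 2) ∂μ := by
    rw [hν, lintegral_map (SparseRWRE.measurable_size.pow_const 2) hpair]
    refine lintegral_congr fun w => ?_
    rw [ENNReal.ofReal_pow (Nat.cast_nonneg _), ENNReal.ofReal_natCast]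
  have hmρ : ∫⁻ x, SparseRWRE.rho x.2 ∂ν = ∫⁻ w, ENNReal.ofReal (ρ w) ∂μ := by
    rw [hν, lintegral_map (f := fun x : ℕ+ × Set.Ioo (0 : ℝ) 1 => SparseRWRE.rho x.2)
      (SparseRWRE.measurable_rho.comp measurable_snd) hpair]
    refine lintegral_congr fun w => ?_
    rw [hρ]
    rfl
  have hmρξ : ∫⁻ x, SparseRWRE.rho x.2 * ((x.1 : ℕ) : ℝ≥0∞) ∂ν =
      ∫⁻ w, ENNReal.ofReal (ρ w * (ξ w : ℝ)) ∂μ := by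
    rw [hν, lintegral_map
      (f := fun x : ℕ+ × Set.Ioo (0 : ℝ) 1 => SparseRWRE.rho x.2 * ((x.1 : ℕ) : ℝ≥0∞))
      ((SparseRWRE.measurable_rho.comp measurable_snd).mul SparseRWRE.measurable_size) hpair]
    refine lintegral_congr fun w => ?_
    rw [hρ, ENNReal.ofReal_mul' (Nat.cast_nonneg _), ENNReal.ofReal_natCast]
    rfl
  rw [← ha₁, ← hDdef, hm₂, hmρ, hmρξ] at hD
  have hξ1 : ∀ w, (1 : ℝ) ≤ ξ w := fun w => by exact_mod_cast (ξ w).pos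
  have hone : 1 ≤ ∫ w, (ξ w : ℝ) ∂μ := by
    have := integral_mono (μ := μ) (integrable_const (1 : ℝ)) hξ hξ1
    simpa using this
  have ha₁0 : a₁ ≠ 0 := by
    rw [e₁, Ne, ENNReal.ofReal_eq_zero]
    linarith
  have ha₁t : a₁ ≠ ∞ := by rw [e₁]; exact ENNReal.ofReal_ne_top
  have hsq : 1 ≤ ∫⁻ w, ENNReal.ofReal ((ξ w : ℝ) ^ 2) ∂μ := by
    calc (1 : ℝ≥0∞) = ∫⁻ _, 1 ∂μ := by simp
      _ ≤ _ := lintegral_mono fun w => by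
        rw [ENNReal.one_le_ofReal]
        nlinarith [hξ1 w]
  -- Positivity ensures that an infinite geometric series makes `D` infinite, as `0 * ∞ = 0` in
  -- `ℝ≥0∞`.
  have hρξ0 : ∫⁻ w, ENNReal.ofReal (ρ w * (ξ w : ℝ)) ∂μ ≠ 0 := by
    rw [Ne, lintegral_eq_zero_iff (f := fun w => ENNReal.ofReal (ρ w * (ξ w : ℝ)))
      (hρm.mul hξm').ennreal_ofReal]
    intro h
    obtain ⟨w, hw⟩ := h.exists
    have h1 : ENNReal.ofReal (ρ w * (ξ w : ℝ)) = 0 := hw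
    rw [ENNReal.ofReal_eq_zero] at h1
    exact absurd h1 (not_le.2 (mul_pos (hρpos w) (by linarith [hξ1 w])))
  have hD0 : D ≠ 0 := by
    intro h
    rw [h] at hD
    have := hsq.trans (le_self_add.trans hD.ge)
    simp at this
  have hvtop : v ≠ ∞ := by rw [hvD]; exact ENNReal.div_ne_top ha₁t hD0
  have hvinv : v⁻¹ = D / a₁ := by rw [hvD, ENNReal.inv_div (Or.inr ha₁t) (Or.inr ha₁0)]
  have hTlim := SparseRWRE.ae_tendsto_T_div hlog' hξ'
  rw [← hDdef, ← ha₁, ← hvinv] at hTlim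
  refine ⟨hvtop, ?_, ?_, ?_, ?_⟩
  · filter_upwards [hTlim, SparseRWRE.ae_annealed_start (ν := ν),
      SparseRWRE.ae_annealed_nearest (ν := ν), SparseRWRE.ae_annealed_bddBelow hlog' hξ']
      with q hq h0 hn hb
    exact SparseRWRE.tendsto_position_of_tendsto_T h0 hn hq.1 hvtop hq.2 hb
  · filter_upwards [hTlim] with q hq using hq.2
  · rintro ⟨⟨hρi, hρ1⟩, hρξi, hξ2⟩
    have hρ0 : 0 ≤ ∫ w, ρ w ∂μ := integral_nonneg fun w => (hρpos w).le
    have hρξnn : 0 ≤ ∫ w, ρ w * (ξ w : ℝ) ∂μ :=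
      integral_nonneg fun w => mul_nonneg (hρpos w).le (Nat.cast_nonneg _)
    rw [← ofReal_integral_eq_lintegral_ofReal hξ2 (ae_of_all _ fun w => sq_nonneg _),
      ← ofReal_integral_eq_lintegral_ofReal hρi (ae_of_all _ fun w => (hρpos w).le),
      ← ofReal_integral_eq_lintegral_ofReal hρξi
        (ae_of_all _ fun w => mul_nonneg (hρpos w).le (Nat.cast_nonneg _)), e₁] at hD
    have h2nn : 0 ≤ ∫ w, (ξ w : ℝ) ^ 2 ∂μ := integral_nonneg fun w => sq_nonneg _
    have h2pos : 1 ≤ ∫ w, (ξ w : ℝ) ^ 2 ∂μ := by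
      have := integral_mono (μ := μ) (integrable_const (1 : ℝ)) hξ2 fun w => by
        show (1 : ℝ) ≤ (ξ w : ℝ) ^ 2
        nlinarith [hξ1 w]
      simpa using this
    set x₁ := ∫ w, (ξ w : ℝ) ∂μ
    set x₂ := ∫ w, (ξ w : ℝ) ^ 2 ∂μ
    set r := ∫ w, ρ w ∂μ
    set y := ∫ w, ρ w * (ξ w : ℝ) ∂μ
    have hDr : D = ENNReal.ofReal (x₂ + y * (2 * x₁ * (1 - r)⁻¹)) := by
      have h1r : 0 < 1 - r := by linarith
      rw [hD, ENNReal.ofReal_add h2nn (by positivity), ENNReal.ofReal_mul hρξnn,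
        ENNReal.ofReal_mul (by positivity), ENNReal.ofReal_mul (by positivity),
        ENNReal.ofReal_inv_of_pos h1r, ENNReal.ofReal_sub _ hρ0]
      simp
    have h1r : 0 < 1 - r := by linarith
    have hDpos : 0 < x₂ + y * (2 * x₁ * (1 - r)⁻¹) := by positivity
    have hDt : D.toReal = x₂ + y * (2 * x₁ * (1 - r)⁻¹) := by
      rw [hDr, ENNReal.toReal_ofReal hDpos.le]
    have ha₁r : a₁.toReal = x₁ := by rw [e₁, ENNReal.toReal_ofReal (by linarith)]
    refine ⟨?_, ?_, ?_⟩
    · rw [hvD]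
      refine (ENNReal.div_pos ha₁0 ?_).ne'
      rw [hDr]
      exact ENNReal.ofReal_ne_top
    · rw [hvD, ENNReal.toReal_div, hDt, ha₁r]
      have h3 : 0 < (1 - r) * x₂ + 2 * x₁ * y := by positivity
      field_simp
    · rw [hvinv, ENNReal.toReal_div, hDt, ha₁r]
      field_simp
  · intro hnot
    -- By contraposition: if `D` is finite, each part of its formula is finite, and this forces all
    -- the moment conditions.
    have hDtop : D = ∞ := by
      by_contra hDne
      refine hnot ?_
      rw [hD] at hDne
      obtain ⟨h2, h3⟩ := ENNReal.add_ne_top.1 hDne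
      have hfin : ∀ {f : Ω → ℝ}, Measurable f → (∀ w, 0 ≤ f w) →
          ∫⁻ w, ENNReal.ofReal (f w) ∂μ ≠ ∞ → Integrable f μ := by
        intro f hf hf0 hne
        refine ⟨hf.aestronglyMeasurable, ?_⟩
        rw [hasFiniteIntegral_iff_ofReal (ae_of_all _ hf0)]
        exact hne.lt_top
      -- Otherwise the truncated difference `1 - E ρ` is `0`, its inverse is `∞`, and the factors
      -- multiplying it are nonzero.
      have hr : ∫⁻ w, ENNReal.ofReal (ρ w) ∂μ < 1 := by
        by_contra hge
        refine h3 ?_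
        rw [tsub_eq_zero_of_le (not_lt.1 hge), ENNReal.inv_zero, ENNReal.mul_top (by simp [ha₁0]),
          ENNReal.mul_top hρξ0]
      have hρi := hfin hρm (fun w => (hρpos w).le) (hr.trans_le le_top).ne
      refine ⟨⟨hρi, ?_⟩, ?_, ?_⟩
      · rw [← ofReal_integral_eq_lintegral_ofReal hρi (ae_of_all _ fun w => (hρpos w).le),
          ENNReal.ofReal_lt_one] at hr
        exact hr
      · refine hfin (hρm.mul hξm') (fun w => mul_nonneg (hρpos w).le (Nat.cast_nonneg _)) ?_
        intro htop
        refine h3 ?_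
        rw [htop, ENNReal.top_mul]
        simp [ha₁0]
      · exact hfin (hξm'.pow_const 2) (fun w => sq_nonneg _) h2
    have hv0 : v = 0 := by rw [hvD, hDtop, ENNReal.div_top]
    exact ⟨hv0, by rw [hv0, ENNReal.inv_zero]⟩
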